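/- Let $N\ge 1$, let $\mathfrak h$ be the upper half plane, and let $\mathfrak p_N=\mathbb L(X,Y,t_\alpha\mid\alpha\in(N^{-1}\mathbb Z/\mathbb Z)^2)^\wedge/(\sum_\alpha t_\alpha=[X,Y])$ be the quotient, by the closed ideal generated by the relation, of the free complex Lie algebra completed along its lower central series. A power series in $X$ acts on $\mathfrak p_N$ through $\mathrm{ad}_X$, and elements of $\mathfrak p_N$ are viewed in $\mathrm{Der}\,\mathfrak p_N$ by the adjoint action. A $\mathfrak p_N$-valued function is holomorphic if it is so in every nilpotent truncation of $\mathfrak p_N$; likewise for forms. *Action.* The group $\Gamma(N)\ltimes\mathbb Z^2$, with product $(\gamma,v)(\gamma',v')=(\gamma\gamma',v\gamma'+v')$, acts on $\mathfrak h\times\mathbb C$ by $(\tau,z)\mapsto\bigl(\gamma\tau,\tfrac{z+m\tau+n}{c\tau+d}\bigr)$ for $\gamma=\begin{pmatrix}a&b\\c&d\end{pmatrix}$, $v=(m,n)$, and on $\mathfrak h\times\mathbb C\times\mathfrak p_N$ through the factors of automorphy $\widetilde M_g(\tau,z)\in\mathrm{Aut}\,\mathfrak p_N$ satisfying $\widetilde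 M_{gh}(x)=\widetilde M_g(hx)\widetilde M_h(x)$ and determined by $$\widetilde M_\gamma(\tau,z)=M_\gamma(\tau)\circ\exp\!\Bigl(\frac{czX}{c\tau+d}\Bigr)\ (\gamma\in\Gamma(N)),\qquad \widetilde M_{(m,n)}=\exp(-mX)\ ((m,n)\in\mathbb Z^2),$$ where $M_\gamma(\tau)$ maps $X\mapsto(c\tau+d)X$, $Y\mapsto(c\tau+d)^{-1}Y+\frac{c}{2\pi i}X$, $t_\alpha\mapsto t_\alpha$. Let $\mathcal P_N\to\mathcal E_N$ be the quotient bundle over the universal elliptic curve $\mathcal E_N=(\Gamma(N)\ltimes\mathbb Z^2)\backslash(\mathfrak h\times\mathbb C)$ (an orbifold if $N\le 2$), so that sections of $\mathcal P_N$ and $\mathcal P_N$-valued forms are equivariant sections and forms on $\mathfrak h\times\mathbb C$. *Connection.* Let $\theta(z|\tau)=\sum_{n\in\mathbb Z}(-1)^ne^{\pi i\tau(n+1/2)^2}e^{z(n+1/2)}$ and $$F(x,z,\tau)=2\pi i\,\frac{\theta'(0|\tau)\,\theta(x+2\pi iz|\tau)}{\theta(x|\tau)\,\theta(2\pi iz|\tau)}.$$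 For $\alpha=(x_\alpha,y_\alpha)$ put $h_\alpha(x,z|\tau)=e^{-y_\alpha x}F(x,z-x_\alpha-y_\alpha\tau,\tau)-\frac{2\pi i}{x}$, $g_\alpha=\partial h_\alpha/\partial x$, and $g_\alpha(x,0|\tau)=\sum_{m\ge0}A_{m,\alpha}(\tau)x^m$ (removable singularities being removed). Let $\delta_{m,\alpha}\in\mathrm{Der}\,\mathfrak p_N$ be given by $$X\mapsto0,\qquad Y\mapsto\sum_{j+k=m-1}\sum_\beta(-1)^j[\mathrm{ad}_X^jt_\beta,\mathrm{ad}_X^kt_{\alpha+\beta}],\qquad t_\beta\mapsto[t_\beta,\mathrm{ad}_X^mt_{\beta+\alpha}+(-1)^m\mathrm{ad}_X^mt_{\beta-\alpha}],$$ let $Y\frac{\partial}{\partial X}\in\mathrm{Der}\,\mathfrak p_N$ be given by $X\mapsto Y$, $Y\mapsto0$, $t_\alpha\mapsto0$, and let $$\Omega_N=\Bigl(2\pi i\,Y\frac{\partial}{\partial X}+\frac12\sum_{m\ge0,\,\alpha}A_{m,\alpha}(\tau)\,\delta_{m,\alpha}+\sum_\alpha g_\alpha(X,z|\tau)\cdot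 t_\alpha\Bigr)d\tau+\Bigl(2\pi i\,Y+\sum_\alpha h_\alpha(X,z|\tau)\cdot t_\alpha\Bigr)dz.$$ Let $\Lambda_N\subset\mathfrak h\times\mathbb C$ be the preimage of the set of $N$-torsion sections, i.e. the set of $(\tau,z)$ with $z\in N^{-1}\mathbb Z+N^{-1}\mathbb Z\tau$. **Proposition.** The form $\Omega_N$ is holomorphic outside $\Lambda_N$ with at most logarithmic poles along $\Lambda_N$, the $\widetilde M_g$ are holomorphic, and the connection $\nabla=d+\Omega_N$ on the trivial bundle $\mathfrak h\times\mathbb C\times\mathfrak p_N\to\mathfrak h\times\mathbb C$ is invariant under $\Gamma(N)\ltimes\mathbb Z^2$: for every $g\in\Gamma(N)\ltimes\mathbb Z^2$ and every holomorphic section $s$ over an open set one has $\nabla(gs)=g(\nabla s)$ outside $\Lambda_N$, where $(gs)(gx)=\widetilde M_g(x)s(x)$; also, outside $\Lambda_N$, $$g^*\Omega_N=\widetilde M_g\,\Omega_N\,\widetilde M_g^{-1}-(d\widetilde M_g)\,\widetilde M_g^{-1}.$$ Hence $\nabla$ descends to a connection on $\mathcal P_N\to\mathcal E_N$ with logarithmic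 singularities along the $N$-torsion sections: there is exactly one such connection that is given by $d+\Omega_N$ on the equivariant sections that represent sections of $\mathcal P_N$ over open subsets of $\mathcal E_N$. -/

import Mathlib

open scoped Topology MatrixGroups UpperHalfPlane

namespace KZB

/-- The generators `X`, `Y` and `t_α`, where `α` runs through the `N`-torsion sections. -/
inductive Gen (N : ℕ) : Type
  | X : Gen N
  | Y : Gen N
  | t : ZMod N × ZMod N → Gen N

set_option linter.unusedSectionVars false

section LieAlgebraP

variable (N : ℕ) [NeZero N]

/-- The free complex Lie algebra on the generators. -/
abbrev FreeL : Type := FreeLieAlgebra ℂ (Gen N)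

/-- The element `∑ t_α - [X, Y]`. -/
noncomputable def relator : FreeL N :=
  (∑ α : ZMod N × ZMod N, FreeLieAlgebra.of ℂ (Gen.t α)) -
    ⁅(FreeLieAlgebra.of ℂ Gen.X : FreeL N), (FreeLieAlgebra.of ℂ Gen.Y : FreeL N)⁆

/-- The sum of the ideal generated by the relator and of the `n`-th term of the lower central
series, where the `0`-th term is the whole Lie algebra. -/
noncomputable def truncIdeal (n : ℕ) : LieIdeal ℂ (FreeL N) :=
  LieSubmodule.lieSpan ℂ (FreeL N) {relator N} ⊔
    LieModule.lowerCentralSeries ℂ (FreeL N) (FreeL N) n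

/-- The `n`-th nilpotent truncation of `𝔭_N`. -/
abbrev Trunc (n : ℕ) : Type := FreeL N ⧸ truncIdeal N n

/-- The class of an element of the free Lie algebra in the `n`-th truncation. -/
noncomputable def tmk (n : ℕ) : FreeL N →ₗ[ℂ] Trunc N n :=
  (truncIdeal N n).toSubmodule.mkQ

/-- The Lie algebra `𝔭_N = 𝕃(X, Y, t_α)^∧ / (∑ t_α = [X, Y])`, as the inverse limit of its
nilpotent truncations: the elements are the sequences `(u_n)` of classes such that, for each `n`,
`u_0, …, u_n` are the classes of one and the same element. -/
noncomputable def pCarrier : Submodule ℂ (∀ n, Trunc N n) where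
  carrier := {u | ∀ n, ∃ a : FreeL N, ∀ m ≤ n, u m = tmk N m a}
  zero_mem' n := ⟨0, fun m _ => by simp⟩
  add_mem' {u v} hu hv n := by
    obtain ⟨a, ha⟩ := hu n
    obtain ⟨b, hb⟩ := hv n
    exact ⟨a + b, fun m hm => by simp [ha m hm, hb m hm]⟩
  smul_mem' c u hu n := by
    obtain ⟨a, ha⟩ := hu n
    exact ⟨c • a, fun m hm => by simp [ha m hm]⟩

/-- The complete Lie algebra `𝔭_N`. -/
def P : Type := pCarrier N

noncomputable instance : AddCommGroup (P N) := inferInstanceAs (AddCommGroup (pCarrier N))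
noncomputable instance : Module ℂ (P N) := inferInstanceAs (Module ℂ (pCarrier N))

variable {N}

/-- The projection of `𝔭_N` to its `n`-th truncation. -/
noncomputable def proj (n : ℕ) : P N →ₗ[ℂ] Trunc N n :=
  (LinearMap.proj n).comp (pCarrier N).subtype

theorem P.ext {u v : P N} (h : ∀ n, proj n u = proj n v) : u = v :=
  Subtype.ext (funext h)

theorem P.exists_rep (u : P N) (n : ℕ) : ∃ a : FreeL N, ∀ m ≤ n, proj m u = tmk N m a :=
  u.2 n

theorem tmk_lie (n : ℕ) (a b : FreeL N) : tmk N n ⁅a, b⁆ = ⁅tmk N n a, tmk N n b⁆ := rfl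

theorem tmk_surjective (n : ℕ) : Function.Surjective (tmk N n) := Submodule.mkQ_surjective _

theorem tmk_eq_zero {n : ℕ} {a : FreeL N} : tmk N n a = 0 ↔ a ∈ truncIdeal N n :=
  Submodule.Quotient.mk_eq_zero _

/-- Elements of `𝔭_N` from compatible sequences. -/
noncomputable def P.mk (u : ∀ n, Trunc N n) (h : ∀ n, ∃ a : FreeL N, ∀ m ≤ n, u m = tmk N m a) :
    P N := ⟨u, h⟩

@[simp] theorem proj_mk (u : ∀ n, Trunc N n) (h) (n : ℕ) : proj n (P.mk u h) = u n := rfl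

noncomputable instance : Bracket (P N) (P N) where
  bracket u v := P.mk (fun n => ⁅proj n u, proj n v⁆) (fun n => by
    obtain ⟨a, ha⟩ := u.exists_rep n
    obtain ⟨b, hb⟩ := v.exists_rep n
    exact ⟨⁅a, b⁆, fun m hm => by rw [ha m hm, hb m hm, tmk_lie]⟩)

@[simp] theorem proj_lie (n : ℕ) (u v : P N) : proj n ⁅u, v⁆ = ⁅proj n u, proj n v⁆ := rfl

noncomputable instance : LieRing (P N) where
  add_lie u v w := P.ext fun n => by simp
  lie_add u v w := P.ext fun n => by simp
  lie_self u := P.ext fun n => by simp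
  leibniz_lie u v w := P.ext fun n => by simp

noncomputable instance : LieAlgebra ℂ (P N) where
  lie_smul c u v := P.ext fun n => by simp

/-- The canonical map of the free Lie algebra to `𝔭_N`. -/
noncomputable def incl : FreeL N →ₗ⁅ℂ⁆ P N where
  toFun a := P.mk (fun n => tmk N n a) (fun _ => ⟨a, fun _ _ => rfl⟩)
  map_add' a b := P.ext fun n => by simp
  map_smul' c a := P.ext fun n => by simp
  map_lie' {a b} := P.ext fun n => by simp [tmk_lie]

@[simp] theorem proj_incl (n : ℕ) (a : FreeL N) : proj n (incl a) = tmk N n a := rfl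

/-- The generators of `𝔭_N`. -/
noncomputable def gen (g : Gen N) : P N := incl (FreeLieAlgebra.of ℂ g)

theorem truncIdeal_zero : truncIdeal N 0 = ⊤ := by
  simp [truncIdeal]

theorem truncIdeal_antitone : Antitone (truncIdeal N) := fun _ _ h =>
  sup_le_sup_left (LieModule.antitone_lowerCentralSeries ℂ (FreeL N) (FreeL N) h) _

theorem lie_mem_truncIdeal {n : ℕ} (a : FreeL N) {b : FreeL N} (hb : b ∈ truncIdeal N n) :
    ⁅a, b⁆ ∈ truncIdeal N (n + 1) := by
  obtain ⟨x, hx, y, hy, rfl⟩ := (LieSubmodule.mem_sup _ _ _).1 hb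
  rw [lie_add]
  refine (LieSubmodule.mem_sup _ _ _).2 ⟨_, LieSubmodule.lie_mem _ hx, _, ?_, rfl⟩
  rw [LieModule.lowerCentralSeries_succ]
  exact LieSubmodule.lie_mem_lie (LieSubmodule.mem_top a) hy

variable (N) in
/-- The kernel of the projection to the `n`-th truncation, that is the `n`-th term of the
(completed) lower central series of `𝔭_N`. -/
noncomputable def fil (n : ℕ) : LieIdeal ℂ (P N) where
  __ := LinearMap.ker (proj (N := N) n)
  lie_mem {u v} hv := by
    have hv' : proj n v = 0 := hv
    change proj n ⁅u, v⁆ = 0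
    simp [hv']

theorem mem_fil {n : ℕ} {u : P N} : u ∈ fil N n ↔ proj n u = 0 := Iff.rfl

theorem fil_zero : fil N 0 = ⊤ := by
  refine eq_top_iff.2 fun u _ => mem_fil.2 ?_
  obtain ⟨a, ha⟩ := u.exists_rep 0
  rw [ha 0 le_rfl, tmk_eq_zero, truncIdeal_zero]
  trivial

theorem fil_antitone : Antitone (fil N) := fun m n h u hu => by
  obtain ⟨a, ha⟩ := u.exists_rep n
  rw [mem_fil, ha n le_rfl, tmk_eq_zero] at hu
  rw [mem_fil, ha m h, tmk_eq_zero]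
  exact truncIdeal_antitone h hu

theorem lie_mem_fil {n : ℕ} (u : P N) {v : P N} (hv : v ∈ fil N n) : ⁅u, v⁆ ∈ fil N (n + 1) := by
  obtain ⟨a, ha⟩ := u.exists_rep (n + 1)
  obtain ⟨b, hb⟩ := v.exists_rep (n + 1)
  rw [mem_fil, hb n (Nat.le_succ n), tmk_eq_zero] at hv
  rw [mem_fil, proj_lie, ha _ le_rfl, hb _ le_rfl, ← tmk_lie, tmk_eq_zero]
  exact lie_mem_truncIdeal a hv

theorem incl_mem_fil {n : ℕ} {a : FreeL N} : incl a ∈ fil N n ↔ a ∈ truncIdeal N n := by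
  rw [mem_fil, proj_incl, tmk_eq_zero]

theorem relation : ∑ α : ZMod N × ZMod N, gen (Gen.t α) = ⁅(gen Gen.X : P N), gen Gen.Y⁆ := by
  have h : incl (relator N) = 0 := P.ext fun n => by
    rw [proj_incl, map_zero, tmk_eq_zero]
    exact (LieSubmodule.mem_sup _ _ _).2
      ⟨_, LieSubmodule.subset_lieSpan rfl, 0, zero_mem _, add_zero _⟩
  rw [relator, map_sub, map_sum, LieHom.map_lie, sub_eq_zero] at h
  exact h

/-- The sum of a series in `𝔭_N` whose `m`-th term lies in the `m`-th term of the lower central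
series: modulo the `n`-th term of the lower central series only the first `n` summands matter. -/
noncomputable def psum (u : ℕ → P N) (hu : ∀ m, u m ∈ fil N m) : P N :=
  P.mk (fun n => ∑ m ∈ Finset.range n, proj n (u m)) (fun n => by
    choose a ha using fun m => (u m).exists_rep n
    refine ⟨∑ m ∈ Finset.range n, a m, fun k hk => ?_⟩
    rw [map_sum, ← Finset.sum_subset (Finset.range_mono hk)]
    · exact Finset.sum_congr rfl fun m _ => ha m k hk
    · intro m _ hm
      rw [← ha m k hk]
      exact fil_antitone (by simpa using hm) (hu m))

theorem proj_psum (u : ℕ → P N) (hu : ∀ m, u m ∈ fil N m) (n : ℕ) :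
    proj n (psum u hu) = ∑ m ∈ Finset.range n, proj n (u m) := rfl

theorem ad_pow_mem_fil (x v : P N) (k : ℕ) : ((LieAlgebra.ad ℂ (P N) x) ^ k) v ∈ fil N k := by
  induction k with
  | zero => rw [fil_zero]; trivial
  | succ k ih => rw [pow_succ', Module.End.mul_apply]; exact lie_mem_fil x ih

/-- The action of a power series: `(∑ f_k x^k) · v = ∑ f_k ad_x^k (v)`. -/
noncomputable def serAct (f : ℕ → ℂ) (x : P N) : P N →ₗ[ℂ] P N where
  toFun v := psum (fun k => f k • ((LieAlgebra.ad ℂ (P N) x) ^ k) v)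
    (fun k => (fil N k).smul_mem _ (ad_pow_mem_fil x v k))
  map_add' v w := P.ext fun n => by simp [proj_psum, Finset.sum_add_distrib]
  map_smul' c v := P.ext fun n => by
    simp [proj_psum, Finset.smul_sum, smul_comm c]

theorem proj_serAct (f : ℕ → ℂ) (x v : P N) (n : ℕ) : proj n (serAct f x v) =
    ∑ k ∈ Finset.range n, f k • ((LieAlgebra.ad ℂ (Trunc N n) (proj n x)) ^ k) (proj n v) := by
  have h : ∀ k, proj n (((LieAlgebra.ad ℂ (P N) x) ^ k) v) =
      ((LieAlgebra.ad ℂ (Trunc N n) (proj n x)) ^ k) (proj n v) := by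
    intro k
    induction k with
    | zero => rfl
    | succ k ih => rw [pow_succ', pow_succ', Module.End.mul_apply, Module.End.mul_apply,
        LieAlgebra.ad_apply, LieAlgebra.ad_apply, proj_lie, ih]
  change ∑ k ∈ Finset.range n, _ = _
  simp only [map_smul, h]

/-- The sum of a series of derivations. -/
noncomputable def psumDer (D : ℕ → LieDerivation ℂ (P N) (P N))
    (hD : ∀ m v, D m v ∈ fil N m) : LieDerivation ℂ (P N) (P N) where
  toFun v := psum (fun m => D m v) (fun m => hD m v)
  map_add' v w := P.ext fun n => by simp [proj_psum, Finset.sum_add_distrib]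
  map_smul' c v := P.ext fun n => by simp [proj_psum, Finset.smul_sum]
  leibniz' v w := P.ext fun n => by
    simp [proj_psum, LieDerivation.apply_lie_eq_sub, Finset.sum_sub_distrib, lie_sum]

/-! ### Homomorphisms and derivations with prescribed values on the generators -/

/-- Any continuous linear map on the free Lie algebra extends to `𝔭_N`. -/
noncomputable def extend (f : FreeL N →ₗ[ℂ] P N)
    (hf : ∀ n, ∀ a ∈ truncIdeal N n, f a ∈ fil N n) : P N →ₗ[ℂ] P N where
  toFun v := P.mk
    (fun n => (truncIdeal N n).toSubmodule.liftQ ((proj n).comp f) (hf n) (proj n v)) (fun n => by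
      obtain ⟨a, ha⟩ := v.exists_rep n
      obtain ⟨b, hb⟩ := (f a).exists_rep n
      refine ⟨b, fun m hm => ?_⟩
      rw [ha m hm, ← hb m hm]
      exact Submodule.liftQ_apply _ _ _)
  map_add' v w := P.ext fun n => by simp
  map_smul' c v := P.ext fun n => by simp

theorem proj_extend (f : FreeL N →ₗ[ℂ] P N) (hf) {v : P N} {a : FreeL N} {n : ℕ}
    (h : proj n v = tmk N n a) : proj n (extend f hf v) = proj n (f a) := by
  change (truncIdeal N n).toSubmodule.liftQ ((proj n).comp f) (hf n) (proj n v) = _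
  rw [h]
  exact Submodule.liftQ_apply _ _ _

theorem extend_incl (f : FreeL N →ₗ[ℂ] P N) (hf) (a : FreeL N) :
    extend f hf (incl a) = f a := P.ext fun _ => proj_extend f hf rfl

theorem map_mem_of_filtration {K : Type} [LieRing K] [LieAlgebra ℂ K] (h : FreeL N →ₗ⁅ℂ⁆ K)
    (hr : h (relator N) = 0) (G : ℕ → LieIdeal ℂ K) (hG0 : G 0 = ⊤)
    (hG : ∀ (n : ℕ) (x y : K), y ∈ G n → ⁅x, y⁆ ∈ G (n + 1)) (n : ℕ) (a : FreeL N) (ha : a ∈ truncIdeal N n) :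
    h a ∈ G n := by
  suffices truncIdeal N n ≤ (G n).comap h from LieIdeal.mem_comap.1 (this ha)
  refine sup_le (LieSubmodule.lieSpan_le.2 ?_) ?_
  · rintro _ rfl
    simp [hr]
  · induction n with
    | zero => intro x _; simp [hG0]
    | succ n ih =>
      rw [LieModule.lowerCentralSeries_succ, LieSubmodule.lie_le_iff]
      intro x _ y hy
      have h1 : h y ∈ G n := LieIdeal.mem_comap.1 (ih (truncIdeal_antitone (Nat.le_succ n) ha) hy)
      rw [LieIdeal.mem_comap, LieHom.map_lie]
      exact hG n _ _ h1

theorem lift_mem {K : Type} [LieRing K] [LieAlgebra ℂ K] (f : Gen N → K) (S : LieSubalgebra ℂ K)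
    (h : ∀ g, f g ∈ S) (a : FreeL N) : FreeLieAlgebra.lift ℂ f a ∈ S := by
  have : S.incl.comp (FreeLieAlgebra.lift ℂ fun g => (⟨f g, h g⟩ : S)) =
      FreeLieAlgebra.lift ℂ f := FreeLieAlgebra.hom_ext fun g => by simp
  rw [← this]
  exact Subtype.property _

/-- The continuous endomorphism of `𝔭_N` with given values on the generators. -/
noncomputable def homOfGens (f : Gen N → P N)
    (hf : ∑ α, f (Gen.t α) = ⁅f Gen.X, f Gen.Y⁆) : P N →ₗ⁅ℂ⁆ P N :=
  have hr : FreeLieAlgebra.lift ℂ f (relator N) = 0 := by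
    simp [relator, hf]
  have key := map_mem_of_filtration (FreeLieAlgebra.lift ℂ f) hr (fil N) fil_zero
    (fun _ x _ hy => lie_mem_fil x hy)
  { extend (FreeLieAlgebra.lift ℂ f : FreeL N →ₗ[ℂ] P N) key with
    map_lie' := fun {v w} => P.ext fun n => by
      obtain ⟨a, ha⟩ := v.exists_rep n
      obtain ⟨b, hb⟩ := w.exists_rep n
      have hab : proj n ⁅v, w⁆ = tmk N n ⁅a, b⁆ := by
        rw [proj_lie, ha n le_rfl, hb n le_rfl, tmk_lie]
      have e1 := proj_extend (FreeLieAlgebra.lift ℂ f : FreeL N →ₗ[ℂ] P N) key hab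
      have e2 := proj_extend (FreeLieAlgebra.lift ℂ f : FreeL N →ₗ[ℂ] P N) key (ha n le_rfl)
      have e3 := proj_extend (FreeLieAlgebra.lift ℂ f : FreeL N →ₗ[ℂ] P N) key (hb n le_rfl)
      refine e1.trans ?_
      change _ = ⁅proj n (extend _ key v), proj n (extend _ key w)⁆
      rw [e2, e3]
      simp }

theorem homOfGens_gen (f : Gen N → P N) (hf) (g : Gen N) : homOfGens f hf (gen g) = f g := by
  change extend _ _ (incl _) = _
  rw [extend_incl]
  simp

/-- The Lie algebra `L ⊗ ℂ[ε]` of pairs `a + ε b`. -/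
def Dual (L : Type) : Type := L × L

section Dual
variable (L : Type) [LieRing L] [LieAlgebra ℂ L]
instance : AddCommGroup (Dual L) := inferInstanceAs (AddCommGroup (L × L))
instance : Module ℂ (Dual L) := inferInstanceAs (Module ℂ (L × L))
instance : Bracket (Dual L) (Dual L) where
  bracket u v := (⁅u.1, v.1⁆, ⁅u.1, v.2⁆ + ⁅u.2, v.1⁆)
variable {L}
theorem Dual.ext {u v : Dual L} (h1 : u.1 = v.1) (h2 : u.2 = v.2) : u = v := Prod.ext h1 h2
@[simp] theorem Dual.add_fst (u v : Dual L) : (u + v).1 = u.1 + v.1 := rfl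
@[simp] theorem Dual.add_snd (u v : Dual L) : (u + v).2 = u.2 + v.2 := rfl
@[simp] theorem Dual.zero_fst : (0 : Dual L).1 = 0 := rfl
@[simp] theorem Dual.zero_snd : (0 : Dual L).2 = 0 := rfl
@[simp] theorem Dual.smul_fst (c : ℂ) (u : Dual L) : (c • u).1 = c • u.1 := rfl
@[simp] theorem Dual.smul_snd (c : ℂ) (u : Dual L) : (c • u).2 = c • u.2 := rfl
@[simp] theorem Dual.lie_fst (u v : Dual L) : ⁅u, v⁆.1 = ⁅u.1, v.1⁆ := rfl
@[simp] theorem Dual.lie_snd (u v : Dual L) : ⁅u, v⁆.2 = ⁅u.1, v.2⁆ + ⁅u.2, v.1⁆ := rfl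
instance : LieRing (Dual L) where
  add_lie u v w := Dual.ext (by simp) (by simp; abel)
  lie_add u v w := Dual.ext (by simp) (by simp; abel)
  lie_self u := Dual.ext (by simp) (by
    rw [Dual.lie_snd, ← lie_skew u.1 u.2, neg_add_cancel, Dual.zero_snd])
  leibniz_lie u v w := Dual.ext (by simp) (by
    simp only [Dual.lie_fst, Dual.lie_snd, Dual.add_snd, lie_add, add_lie]
    rw [leibniz_lie u.1 v.1 w.2, leibniz_lie u.1 v.2 w.1, leibniz_lie u.2 v.1 w.1]
    abel)
instance : LieAlgebra ℂ (Dual L) where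
  lie_smul c u v := Dual.ext (by simp) (by simp)
/-- The value at `ε = 0`. -/
def Dual.fst : Dual L →ₗ⁅ℂ⁆ L where
  toFun u := u.1
  map_add' _ _ := rfl
  map_smul' _ _ := rfl
  map_lie' := rfl
/-- The coefficient of `ε`. -/
def Dual.snd : Dual L →ₗ[ℂ] L where
  toFun u := u.2
  map_add' _ _ := rfl
  map_smul' _ _ := rfl
/-- The pairs with both entries in a given ideal. -/
def Dual.ideal (I : LieIdeal ℂ L) : LieIdeal ℂ (Dual L) where
  carrier := {u | u.1 ∈ I ∧ u.2 ∈ I}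
  zero_mem' := ⟨I.zero_mem, I.zero_mem⟩
  add_mem' hu hv := ⟨I.add_mem hu.1 hv.1, I.add_mem hu.2 hv.2⟩
  smul_mem' c _ hu := ⟨I.smul_mem c hu.1, I.smul_mem c hu.2⟩
  lie_mem hv := ⟨I.lie_mem hv.1, I.add_mem (I.lie_mem hv.2) (I.lie_mem hv.1)⟩
/-- The pairs with second entry in a given ideal. -/
def Dual.subalgebra (I : LieIdeal ℂ L) : LieSubalgebra ℂ (Dual L) where
  carrier := {u | u.2 ∈ I}
  zero_mem' := I.zero_mem
  add_mem' hu hv := I.add_mem hu hv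
  smul_mem' c _ hu := I.smul_mem c hu
  lie_mem' {u v} hu hv := by
    refine I.add_mem (I.lie_mem hv) ?_
    rw [← lie_skew]
    exact I.neg_mem (I.lie_mem hu)
end Dual

/-- The homomorphism `a ↦ a + ε D(a)`, where the derivation `D` has given values on the
generators. -/
noncomputable def derLift (f : Gen N → P N) : FreeL N →ₗ⁅ℂ⁆ Dual (P N) :=
  FreeLieAlgebra.lift ℂ fun g => ((gen g, f g) : Dual (P N))

theorem derLift_of (f : Gen N → P N) (g : Gen N) :
    derLift f (FreeLieAlgebra.of ℂ g) = ((gen g, f g) : Dual (P N)) := by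
  exact FreeLieAlgebra.lift_of_apply _ _

theorem derLift_fst (f : Gen N → P N) (a : FreeL N) : (derLift f a).1 = incl a := by
  have : Dual.fst.comp (derLift f) = incl := FreeLieAlgebra.hom_ext fun g => by
    rw [LieHom.comp_apply, derLift_of]; rfl
  exact LieHom.congr_fun this a

theorem derLift_relator (f : Gen N → P N)
    (hf : ∑ α, f (Gen.t α) = ⁅f Gen.X, (gen Gen.Y : P N)⁆ + ⁅(gen Gen.X : P N), f Gen.Y⁆) :
    derLift f (relator N) = 0 := by
  refine Dual.ext ?_ ?_
  · have h := relation (N := N)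
    rw [derLift_fst, relator, map_sub, map_sum, LieHom.map_lie]
    exact sub_eq_zero.2 h
  · change Dual.snd (derLift f (relator N)) = 0
    rw [relator, map_sub, map_sum, LieHom.map_lie, map_sub, map_sum]
    simp only [derLift_of]
    refine sub_eq_zero.2 (Eq.trans hf ?_)
    exact add_comm _ _

/-- The continuous derivation of `𝔭_N` with given values on the generators. -/
noncomputable def derOfGens (f : Gen N → P N)
    (hf : ∑ α, f (Gen.t α) = ⁅f Gen.X, (gen Gen.Y : P N)⁆ + ⁅(gen Gen.X : P N), f Gen.Y⁆) :
    LieDerivation ℂ (P N) (P N) :=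
  have key : ∀ n, ∀ a ∈ truncIdeal N n,
      (Dual.snd.comp (derLift f : FreeL N →ₗ[ℂ] Dual (P N))) a ∈ fil N n := fun n a ha =>
    (map_mem_of_filtration (derLift f) (derLift_relator f hf) (fun n => Dual.ideal (fil N n))
      (by rw [fil_zero]; exact eq_top_iff.2 fun _ _ => ⟨trivial, trivial⟩)
      (fun n x y hy => ⟨lie_mem_fil _ hy.1, (fil N (n + 1)).add_mem (lie_mem_fil _ hy.2)
        (lie_mem_fil _ hy.1)⟩) n a ha).2
  { extend (Dual.snd.comp (derLift f : FreeL N →ₗ[ℂ] Dual (P N))) key with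
    leibniz' := fun v w => P.ext fun n => by
      obtain ⟨a, ha⟩ := v.exists_rep n
      obtain ⟨b, hb⟩ := w.exists_rep n
      have hab : proj n ⁅v, w⁆ = tmk N n ⁅a, b⁆ := by
        rw [proj_lie, ha n le_rfl, hb n le_rfl, tmk_lie]
      have e1 := proj_extend _ key hab
      have e2 := proj_extend _ key (ha n le_rfl)
      have e3 := proj_extend _ key (hb n le_rfl)
      refine e1.trans ?_
      change proj n (derLift f ⁅a, b⁆).2 =
        ⁅proj n v, proj n (extend _ key w)⁆ - ⁅proj n w, proj n (extend _ key v)⁆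
      rw [e2, e3, LieHom.map_lie, Dual.lie_snd, derLift_fst, derLift_fst, map_add, proj_lie,
        proj_lie, proj_incl, proj_incl, ha n le_rfl, hb n le_rfl, sub_eq_add_neg, lie_skew]
      rfl }

theorem derOfGens_gen (f : Gen N → P N) (hf) (g : Gen N) : derOfGens f hf (gen g) = f g := by
  refine (extend_incl _ _ _).trans ?_
  change (derLift f (FreeLieAlgebra.of ℂ g)).2 = _
  rw [derLift_of]

theorem derOfGens_mem_fil (f : Gen N → P N) (hf) (m : ℕ) (h : ∀ g, f g ∈ fil N m) (v : P N) :
    derOfGens f hf v ∈ fil N m := by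
  obtain ⟨a, ha⟩ := v.exists_rep m
  refine mem_fil.2 ((proj_extend _ _ (ha m le_rfl)).trans ?_)
  exact lift_mem _ (Dual.subalgebra (fil N m)) h a

/-! ### Exponentials -/

theorem exp_sum_lie {L : Type} [LieRing L] [LieAlgebra ℂ L] (x : L) (n : ℕ)
    (hx : (LieAlgebra.ad ℂ L x) ^ n = 0) :
    ∃ E : ℂ → L →ₗ[ℂ] L,
      (∀ s v, E s v = ∑ k ∈ Finset.range n, (s ^ k / k.factorial) •
        ((LieAlgebra.ad ℂ L x) ^ k) v) ∧
      (∀ s v w, E s ⁅v, w⁆ = ⁅E s v, E s w⁆) ∧ (∀ s t v, E (s + t) v = E s (E t v)) := by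
  let iQ : Module ℚ L := Module.compHom L (algebraMap ℚ ℂ)
  have hq : ∀ (q : ℚ) (v : L), q • v = (q : ℂ) • v := fun _ _ => rfl
  let iLQ : LieAlgebra ℚ L := { iQ with lie_smul := fun q v w => by simp [hq] }
  have hpow : ∀ s : ℂ, (s • LieAlgebra.ad ℂ L x) ^ n = 0 := fun s => by rw [smul_pow, hx, smul_zero]
  have hD : ∀ s : ℂ, (LieDerivation.ad ℂ L (s • x)).toLinearMap = s • LieAlgebra.ad ℂ L x :=
    fun s => by ext v; simp
  have hn : ∀ s : ℂ, IsNilpotent (LieDerivation.ad ℂ L (s • x)).toLinearMap :=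
    fun s => ⟨n, by rw [hD, hpow]⟩
  have hn' : ∀ s : ℂ, IsNilpotent (s • LieAlgebra.ad ℂ L x) := fun s => ⟨n, hpow s⟩
  refine ⟨fun s => IsNilpotent.exp (s • LieAlgebra.ad ℂ L x), ?_, ?_, ?_⟩
  · intro s v
    beta_reduce
    rw [IsNilpotent.exp_eq_sum (hpow s), LinearMap.sum_apply]
    refine Finset.sum_congr rfl fun k _ => ?_
    rw [LinearMap.smul_apply, hq, smul_pow, LinearMap.smul_apply, smul_smul]
    congr 1
    push_cast
    rw [div_eq_inv_mul]
  · intro s v w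
    have := (LieDerivation.exp (LieDerivation.ad ℂ L (s • x)) (hn s)).map_lie v w
    rw [LieDerivation.exp_map_apply, LieDerivation.exp_map_apply, LieDerivation.exp_map_apply,
      hD] at this
    exact this
  · intro s t v
    beta_reduce
    rw [add_smul, IsNilpotent.exp_add_of_commute _ (hn' s) (hn' t)]
    · rfl
    · exact ((Commute.refl _).smul_left s).smul_right t

theorem ad_trunc_pow (x : P N) (n : ℕ) : (LieAlgebra.ad ℂ (Trunc N n) (proj n x)) ^ n = 0 := by
  ext v
  obtain ⟨a, rfl⟩ := tmk_surjective n v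
  have h : ∀ k, proj n (((LieAlgebra.ad ℂ (P N) x) ^ k) (incl a)) =
      ((LieAlgebra.ad ℂ (Trunc N n) (proj n x)) ^ k) (tmk N n a) := by
    intro k
    induction k with
    | zero => rfl
    | succ k ih => rw [pow_succ', pow_succ', Module.End.mul_apply, Module.End.mul_apply,
        LieAlgebra.ad_apply, LieAlgebra.ad_apply, proj_lie, ih]
  rw [← h]
  exact ad_pow_mem_fil x _ n

theorem serAct_exp_lie (s : ℂ) (x v w : P N) :
    serAct (fun k => s ^ k / k.factorial) x ⁅v, w⁆ =
      ⁅serAct (fun k => s ^ k / k.factorial) x v, serAct (fun k => s ^ k / k.factorial) x w⁆ := by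
  refine P.ext fun n => ?_
  obtain ⟨E, h1, h2, -⟩ := exp_sum_lie (proj n x) n (ad_trunc_pow x n)
  rw [proj_lie, proj_serAct, proj_serAct, proj_serAct, ← h1, ← h1, ← h1, proj_lie, h2]

/-- The automorphism `exp(s x)` of `𝔭_N`, where `x` acts by the adjoint action. -/
noncomputable def expAd (s : ℂ) (x : P N) : P N →ₗ⁅ℂ⁆ P N :=
  { serAct (fun k => s ^ k / k.factorial) x with
    map_lie' := fun {v w} => serAct_exp_lie s x v w }

theorem expAd_apply (s : ℂ) (x v : P N) :
    expAd s x v = serAct (fun k => s ^ k / k.factorial) x v := rfl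

theorem expAd_add (s t : ℂ) (x v : P N) : expAd (s + t) x v = expAd s x (expAd t x v) := by
  refine P.ext fun n => ?_
  obtain ⟨E, h1, -, h3⟩ := exp_sum_lie (proj n x) n (ad_trunc_pow x n)
  simp only [expAd_apply]
  rw [proj_serAct, proj_serAct, ← h1, proj_serAct, ← h1, ← h1, h3]

theorem expAd_zero (x v : P N) : expAd 0 x v = v := by
  refine P.ext fun n => ?_
  rw [expAd_apply, proj_serAct]
  rcases n with _ | n
  · have : ∀ u : P N, proj 0 u = 0 := fun u => mem_fil.1 (by rw [fil_zero]; trivial)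
    simp [this]
  · rw [Finset.sum_eq_single 0] <;> simp +contextual

theorem proj_hom_expAd (f : P N →ₗ⁅ℂ⁆ P N) (hf : ∀ n, ∀ v ∈ fil N n, f v ∈ fil N n) (s r : ℂ)
    (x v : P N) (hx : f x = r • x) : f (expAd s x v) = expAd (s * r) x (f v) := by
  refine P.ext fun n => ?_
  have hk : ∀ k, f (((LieAlgebra.ad ℂ (P N) x) ^ k) v) =
      r ^ k • ((LieAlgebra.ad ℂ (P N) x) ^ k) (f v) := by
    intro k
    induction k with
    | zero => simp
    | succ k ih =>
      rw [pow_succ' (LieAlgebra.ad ℂ (P N) x), Module.End.mul_apply, Module.End.mul_apply,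
        LieAlgebra.ad_apply, LieAlgebra.ad_apply, LieHom.map_lie, ih, hx, lie_smul, smul_lie,
        smul_smul, pow_succ]
  have hsub : expAd s x v - ∑ k ∈ Finset.range n,
      (s ^ k / k.factorial : ℂ) • ((LieAlgebra.ad ℂ (P N) x) ^ k) v ∈ fil N n := by
    rw [mem_fil, map_sub, map_sum, sub_eq_zero]
    rfl
  have h1 := hf n _ hsub
  rw [map_sub, map_sum, mem_fil, map_sub, map_sum, sub_eq_zero] at h1
  rw [h1]
  change _ = ∑ k ∈ Finset.range n, _
  refine Finset.sum_congr rfl fun k _ => ?_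
  rw [_root_.map_smul f, hk, smul_smul]
  beta_reduce
  rw [mul_pow, div_mul_eq_mul_div]

theorem homOfGens_fil (f : Gen N → P N) (hf) (n : ℕ) (v : P N) (hv : v ∈ fil N n) :
    homOfGens f hf v ∈ fil N n := by
  rw [mem_fil] at hv
  have h : proj n v = tmk N n 0 := by rw [hv, map_zero]
  refine mem_fil.2 ((proj_extend _ _ h).trans ?_)
  rw [map_zero, map_zero]

theorem hom_ext_gen (f g : P N →ₗ⁅ℂ⁆ P N) (hf : ∀ n, ∀ v ∈ fil N n, f v ∈ fil N n)
    (hg : ∀ n, ∀ v ∈ fil N n, g v ∈ fil N n) (h : ∀ a, f (gen a) = g (gen a)) (v : P N) :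
    f v = g v := by
  have hi : f.comp incl = g.comp incl := FreeLieAlgebra.hom_ext h
  refine P.ext fun n => ?_
  obtain ⟨a, ha⟩ := v.exists_rep n
  have hm : v - incl a ∈ fil N n := by
    rw [mem_fil, map_sub, ha n le_rfl, proj_incl, sub_self]
  have h1 := hf n _ hm
  have h2 := hg n _ hm
  rw [mem_fil, map_sub, map_sub, sub_eq_zero] at h1 h2
  rw [h1, h2]
  exact congrArg _ (LieHom.congr_fun hi a)

theorem lie_ad_pow_mem_fil (x u : P N) (j : ℕ) {k : ℕ} {w : P N} (hw : w ∈ fil N k) :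
    ⁅((LieAlgebra.ad ℂ (P N) x) ^ j) u, w⁆ ∈ fil N (j + k + 1) := by
  induction j generalizing k w with
  | zero => rw [Nat.zero_add]; exact lie_mem_fil _ hw
  | succ j ih =>
    rw [pow_succ', Module.End.mul_apply, LieAlgebra.ad_apply, lie_lie]
    have h1 := lie_mem_fil x (ih hw)
    have h2 := ih (lie_mem_fil x hw)
    rw [show j + 1 + k + 1 = j + k + 1 + 1 by omega]
    exact (fil N _).sub_mem h1 h2

/-! ### Derivations entering the connection form -/

variable (N) in
/-- The derivation `Y ∂/∂X`. -/
noncomputable def derYdX : LieDerivation ℂ (P N) (P N) :=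
  derOfGens (fun g => match g with
    | .X => gen .Y
    | .Y => 0
    | .t _ => 0) (by simp)

/-- `ad_X^k (t_α)`. -/
noncomputable def adXt (k : ℕ) (α : ZMod N × ZMod N) : P N :=
  ((LieAlgebra.ad ℂ (P N) (gen .X)) ^ k) (gen (.t α))

theorem adXt_succ (k : ℕ) (α : ZMod N × ZMod N) : adXt (k + 1) α = ⁅(gen .X : P N), adXt k α⁆ := by
  rw [adXt, pow_succ', Module.End.mul_apply, LieAlgebra.ad_apply, adXt]

/-- The values of `δ_{m,α}` on the generators. The sum in the value at `Y` runs through the pairs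
`(j, k)` with `j + k = m - 1`, and is zero if `m = 0`. -/
noncomputable def deltaVal (m : ℕ) (α : ZMod N × ZMod N) : Gen N → P N
  | .X => 0
  | .Y => ∑ j ∈ Finset.range m, ∑ β, (-1 : ℂ) ^ j • ⁅adXt j β, adXt (m - 1 - j) (α + β)⁆
  | .t β => ⁅gen (.t β), adXt m (β + α) + (-1 : ℂ) ^ m • adXt m (β - α)⁆

theorem deltaVal_relation (m : ℕ) (α : ZMod N × ZMod N) :
    ∑ β, deltaVal m α (.t β) =
      ⁅deltaVal m α .X, (gen .Y : P N)⁆ + ⁅(gen .X : P N), deltaVal m α .Y⁆ := by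
  have tele : ∀ β, ⁅(gen .X : P N), ∑ j ∈ Finset.range m, (-1 : ℂ) ^ j •
      ⁅adXt j β, adXt (m - 1 - j) (α + β)⁆⁆ =
      ⁅adXt 0 β, adXt m (α + β)⁆ - (-1 : ℂ) ^ m • ⁅adXt m β, adXt 0 (α + β)⁆ := by
    intro β
    have h := Finset.sum_range_sub' (fun j => (-1 : ℂ) ^ j • ⁅adXt j β, adXt (m - j) (α + β)⁆) m
    rw [Nat.sub_zero, Nat.sub_self, pow_zero, one_smul] at h
    rw [← h, lie_sum]
    refine Finset.sum_congr rfl fun j hj => ?_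
    have hj' : m - j = (m - 1 - j) + 1 := by have := Finset.mem_range.1 hj; omega
    have hj2 : m - (j + 1) = m - 1 - j := by omega
    rw [lie_smul, leibniz_lie, ← adXt_succ, ← adXt_succ, ← hj', hj2, pow_succ, smul_add]
    simp only [mul_neg, mul_one, neg_smul, sub_neg_eq_add]
    exact add_comm _ _
  simp only [deltaVal]
  rw [zero_lie, zero_add, Finset.sum_comm, lie_sum]
  simp only [tele, lie_add, lie_smul]
  rw [Finset.sum_add_distrib, Finset.sum_sub_distrib, sub_eq_add_neg]
  congr 1
  · exact Finset.sum_congr rfl fun β _ => by rw [add_comm β α]; rfl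
  · rw [← Finset.sum_neg_distrib, ← Equiv.sum_comp (Equiv.addLeft α)]
    refine Finset.sum_congr rfl fun β _ => ?_
    rw [Equiv.coe_addLeft, add_sub_cancel_left, ← smul_neg, lie_skew]
    rfl

/-- The derivation `δ_{m,α}`. -/
noncomputable def delta (m : ℕ) (α : ZMod N × ZMod N) : LieDerivation ℂ (P N) (P N) :=
  derOfGens (deltaVal m α) (deltaVal_relation m α)

theorem delta_mem_fil (m : ℕ) (α : ZMod N × ZMod N) (v : P N) : delta m α v ∈ fil N m := by
  refine derOfGens_mem_fil _ _ m (fun g => ?_) v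
  match g with
  | .X => exact (fil N m).zero_mem
  | .Y =>
    refine sum_mem fun j hj => sum_mem fun β _ => (fil N m).smul_mem _ ?_
    have := lie_ad_pow_mem_fil (gen .X) (gen (.t β)) j
      (ad_pow_mem_fil (gen .X) (gen (.t (α + β))) (m - 1 - j))
    have hm : j + (m - 1 - j) + 1 = m := by have := Finset.mem_range.1 hj; omega
    rw [hm] at this
    exact this
  | .t β =>
    refine (fil N m).lie_mem ((fil N m).add_mem ?_ ((fil N m).smul_mem _ ?_)) <;>
    exact ad_pow_mem_fil _ _ _

end LieAlgebraP

/-! ### The group `Γ(N) ⋉ ℤ²` and its actions -/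

/-- The underlying set of the semidirect product `Γ(N) ⋉ ℤ²`. -/
@[ext] structure JacobiGroup (N : ℕ) where
  γ : CongruenceSubgroup.Gamma N
  m : ℤ
  n : ℤ

namespace JacobiGroup

variable {N : ℕ}

/-- The upper left entry of the matrix `γ`. -/
def a (g : JacobiGroup N) : ℤ := (g.γ : SL(2, ℤ)) 0 0
/-- The upper right entry of the matrix `γ`. -/
def b (g : JacobiGroup N) : ℤ := (g.γ : SL(2, ℤ)) 0 1
/-- The lower left entry of the matrix `γ`. -/
def c (g : JacobiGroup N) : ℤ := (g.γ : SL(2, ℤ)) 1 0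
/-- The lower right entry of the matrix `γ`. -/
def d (g : JacobiGroup N) : ℤ := (g.γ : SL(2, ℤ)) 1 1

theorem det_eq (g : JacobiGroup N) : g.a * g.d - g.b * g.c = 1 := by
  have := (g.γ : SL(2, ℤ)).det_coe
  rwa [Matrix.det_fin_two] at this

/-- The product `(γ, v)(γ', v') = (γγ', vγ' + v')`, where `v = (m, n)` is a row vector. -/
instance : Mul (JacobiGroup N) where
  mul g h := ⟨g.γ * h.γ, g.m * h.a + g.n * h.c + h.m, g.m * h.b + g.n * h.d + h.n⟩

instance : One (JacobiGroup N) where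
  one := ⟨1, 0, 0⟩

instance : Inv (JacobiGroup N) where
  inv g := ⟨g.γ⁻¹, -(g.m * g.d - g.n * g.c), -(-(g.m * g.b) + g.n * g.a)⟩

@[simp] theorem mul_γ (g h : JacobiGroup N) : (g * h).γ = g.γ * h.γ := rfl
@[simp] theorem mul_m (g h : JacobiGroup N) : (g * h).m = g.m * h.a + g.n * h.c + h.m := rfl
@[simp] theorem mul_n (g h : JacobiGroup N) : (g * h).n = g.m * h.b + g.n * h.d + h.n := rfl
@[simp] theorem one_γ : (1 : JacobiGroup N).γ = 1 := rfl
@[simp] theorem one_m : (1 : JacobiGroup N).m = 0 := rfl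
@[simp] theorem one_n : (1 : JacobiGroup N).n = 0 := rfl
@[simp] theorem inv_γ (g : JacobiGroup N) : g⁻¹.γ = g.γ⁻¹ := rfl
@[simp] theorem inv_m (g : JacobiGroup N) : g⁻¹.m = -(g.m * g.d - g.n * g.c) := rfl
@[simp] theorem inv_n (g : JacobiGroup N) : g⁻¹.n = -(-(g.m * g.b) + g.n * g.a) := rfl

@[simp] theorem mul_a (g h : JacobiGroup N) : (g * h).a = g.a * h.a + g.b * h.c := by
  simp [a, b, c, Matrix.mul_apply, Fin.sum_univ_two]
@[simp] theorem mul_b (g h : JacobiGroup N) : (g * h).b = g.a * h.b + g.b * h.d := by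
  simp [a, b, d, Matrix.mul_apply, Fin.sum_univ_two]
@[simp] theorem mul_c (g h : JacobiGroup N) : (g * h).c = g.c * h.a + g.d * h.c := by
  simp [a, c, d, Matrix.mul_apply, Fin.sum_univ_two]
@[simp] theorem mul_d (g h : JacobiGroup N) : (g * h).d = g.c * h.b + g.d * h.d := by
  simp [b, c, d, Matrix.mul_apply, Fin.sum_univ_two]
@[simp] theorem one_a : (1 : JacobiGroup N).a = 1 := by simp [a]
@[simp] theorem one_b : (1 : JacobiGroup N).b = 0 := by simp [b]
@[simp] theorem one_c : (1 : JacobiGroup N).c = 0 := by simp [c]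
@[simp] theorem one_d : (1 : JacobiGroup N).d = 1 := by simp [d]

instance : Group (JacobiGroup N) :=
  Group.ofLeftAxioms
    (fun g h k => by
      ext1
      · simp [mul_assoc]
      · simp; ring
      · simp; ring)
    (fun g => by ext1 <;> simp)
    (fun g => by
      have h := g.det_eq
      ext1
      · simp
      · simp only [mul_m, inv_m, inv_n, one_m]
        linear_combination (-g.m) * h
      · simp only [mul_n, inv_m, inv_n, one_n]
        linear_combination (-g.n) * h)

/-- The factor `cτ + d`. -/
noncomputable def j (g : JacobiGroup N) (τ : ℍ) : ℂ := g.c * τ + g.d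

theorem j_ne_zero (g : JacobiGroup N) (τ : ℍ) : g.j τ ≠ 0 := by
  intro h
  have him := congrArg Complex.im h
  have hre := congrArg Complex.re h
  simp [j, τ.im_pos.ne'] at him hre
  have hdet := g.det_eq
  rw [him] at hre hdet
  simp at hre
  simp [hre] at hdet

theorem coe_smul (g : JacobiGroup N) (τ : ℍ) :
    ((g.γ • τ : ℍ) : ℂ) = (g.a * τ + g.b) / g.j τ :=
  UpperHalfPlane.coe_specialLinearGroup_apply (R := ℤ) _ τ

theorem j_mul (g h : JacobiGroup N) (τ : ℍ) : (g * h).j τ = g.j (h.γ • τ) * h.j τ := by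
  have h0 := h.j_ne_zero τ
  rw [j, j, coe_smul, mul_c, mul_d]
  field_simp
  rw [j]
  push_cast
  ring

/-- The action of `Γ(N) ⋉ ℤ²` on `ℍ × ℂ`, whose points are written `(τ, z)`. -/
noncomputable instance : MulAction (JacobiGroup N) (ℍ × ℂ) where
  smul g x := (g.γ • x.1, (x.2 + g.m * x.1 + g.n) / g.j x.1)
  one_smul x := Prod.ext (one_smul _ x.1) (by
    change (x.2 + ((0 : ℤ) : ℂ) * x.1 + ((0 : ℤ) : ℂ)) / (1 : JacobiGroup N).j x.1 = x.2
    simp [j])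
  mul_smul g h x := Prod.ext (mul_smul g.γ h.γ x.1) (by
    change (x.2 + ((g * h).m : ℂ) * x.1 + ((g * h).n : ℂ)) / (g * h).j x.1 =
      ((x.2 + h.m * x.1 + h.n) / h.j x.1 + g.m * ((h.γ • x.1 : ℍ) : ℂ) + g.n) / g.j (h.γ • x.1)
    have h0 := h.j_ne_zero x.1
    have h1 := g.j_ne_zero (h.γ • x.1)
    rw [j_mul, coe_smul, ← div_div, div_right_comm]
    congr 1
    field_simp
    rw [mul_m, mul_n, j]
    push_cast
    ring)

theorem smul_fst (g : JacobiGroup N) (x : ℍ × ℂ) : (g • x).1 = g.γ • x.1 := rfl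
theorem smul_snd (g : JacobiGroup N) (x : ℍ × ℂ) :
    (g • x).2 = (x.2 + g.m * x.1 + g.n) / g.j x.1 := rfl

end JacobiGroup

section Automorphy

variable {N : ℕ} [NeZero N]

/-- The automorphism `M_γ(τ)`. -/
noncomputable def autM (g : JacobiGroup N) (τ : ℍ) : P N →ₗ⁅ℂ⁆ P N :=
  homOfGens (fun s => match s with
    | .X => g.j τ • gen .X
    | .Y => (g.j τ)⁻¹ • gen .Y + (g.c / (2 * Real.pi * Complex.I) : ℂ) • gen .X
    | .t α => gen (.t α)) (by
      have h0 := g.j_ne_zero τ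
      simp [relation, smul_smul, h0])

/-- The factor of automorphy, as an endomorphism: `M_γ(τ) ∘ exp(c z X / (cτ + d))` for `γ ∈ Γ(N)`,
`exp(-m X)` for `(m, n) ∈ ℤ²`, and in general the composite for `(γ, (m, n)) = γ · (m, n)`. -/
noncomputable def autHom (g : JacobiGroup N) (x : ℍ × ℂ) : P N →ₗ⁅ℂ⁆ P N :=
  ((autM g x.1).comp (expAd (g.c * (x.2 + g.m * x.1 + g.n) / g.j x.1) (gen .X))).comp
    (expAd (-(g.m : ℂ)) (gen .X))

theorem autM_fil (g : JacobiGroup N) (τ : ℍ) (n : ℕ) (v : P N) (hv : v ∈ fil N n) :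
    autM g τ v ∈ fil N n := homOfGens_fil _ _ n v hv

theorem autM_expAd (g : JacobiGroup N) (τ : ℍ) (s : ℂ) (v : P N) :
    autM g τ (expAd s (gen .X) v) = expAd (s * g.j τ) (gen .X) (autM g τ v) :=
  proj_hom_expAd _ (autM_fil _ _) s _ _ v (homOfGens_gen _ _ _)

theorem autHom_apply (g : JacobiGroup N) (x : ℍ × ℂ) (v : P N) :
    autHom g x v = expAd (g.c * (x.2 + g.n) - g.m * g.d) (gen .X) (autM g x.1 v) := by
  have h0 := g.j_ne_zero x.1
  rw [autHom, LieHom.comp_apply, LieHom.comp_apply, ← expAd_add, autM_expAd]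
  congr 2
  field_simp
  rw [JacobiGroup.j]
  ring

theorem autM_mul (g h : JacobiGroup N) (τ : ℍ) (v : P N) :
    autM (g * h) τ v = autM g (h.γ • τ) (autM h τ v) := by
  have h0 := h.j_ne_zero τ
  have h1 := g.j_ne_zero (h.γ • τ)
  have hpi : (2 * Real.pi * Complex.I : ℂ) ≠ 0 := by simp [Real.pi_ne_zero]
  refine hom_ext_gen (autM (g * h) τ) ((autM g (h.γ • τ)).comp (autM h τ)) (autM_fil _ _)
    (fun n v hv => autM_fil _ _ _ _ (autM_fil _ _ _ _ hv)) (fun s => ?_) v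
  rw [LieHom.comp_apply]
  simp only [autM, homOfGens_gen]
  cases s with
  | X =>
    simp only []
    rw [_root_.map_smul, homOfGens_gen, JacobiGroup.j_mul, smul_smul, mul_comm]
  | Y =>
    simp only []
    rw [_root_.map_add, _root_.map_smul, _root_.map_smul, homOfGens_gen, homOfGens_gen,
      JacobiGroup.j_mul, smul_add, smul_smul, smul_smul, smul_smul, add_assoc, ← add_smul, mul_inv,
      mul_comm (g.j _)⁻¹]
    congr 2
    have hdet : (h.a * h.d - h.b * h.c : ℂ) = 1 := by exact_mod_cast h.det_eq
    have hj : (h.j τ) = h.c * τ + h.d := rfl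
    have hg : g.j (h.γ • τ) = g.c * ((h.a * τ + h.b) / h.j τ) + g.d := by
      rw [← JacobiGroup.coe_smul]; rfl
    rw [hg, JacobiGroup.mul_c]
    field_simp
    push_cast
    rw [hj]
    linear_combination (g.c : ℂ) * hdet
  | t α => simp only []; rw [homOfGens_gen]

theorem autM_one (τ : ℍ) (v : P N) : autM (1 : JacobiGroup N) τ v = v := by
  refine hom_ext_gen (autM (1 : JacobiGroup N) τ) LieHom.id (autM_fil _ _)
    (fun n v hv => hv) (fun s => ?_) v
  simp only [autM, homOfGens_gen]
  cases s <;> simp [JacobiGroup.j]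

theorem autHom_one (x : ℍ × ℂ) (v : P N) : autHom (1 : JacobiGroup N) x v = v := by
  rw [autHom_apply, autM_one]
  simp [expAd_zero]

/-- The cocycle relation of the factors of automorphy. -/
theorem autHom_mul (g h : JacobiGroup N) (x : ℍ × ℂ) (v : P N) :
    autHom (g * h) x v = autHom g (h • x) (autHom h x v) := by
  rw [autHom_apply, autHom_apply, autHom_apply, autM_mul, JacobiGroup.smul_fst, autM_expAd,
    ← expAd_add]
  congr 2
  have h0 := h.j_ne_zero x.1
  have hdet : (h.a * h.d - h.b * h.c : ℂ) = 1 := by exact_mod_cast h.det_eq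
  have hj : (h.j x.1) = h.c * x.1 + h.d := rfl
  have hg : g.j (h.γ • x.1) = g.c * ((h.a * x.1 + h.b) / h.j x.1) + g.d := by
    rw [← JacobiGroup.coe_smul]; rfl
  rw [hg, JacobiGroup.smul_snd, JacobiGroup.mul_c, JacobiGroup.mul_d, JacobiGroup.mul_m,
    JacobiGroup.mul_n]
  field_simp
  push_cast
  rw [hj]
  linear_combination ((g.c : ℂ) * (g.n * (h.c * x.1 + h.d) + x.2 + h.n + h.m * x.1) -
    g.d * g.m * (h.c * x.1 + h.d)) * hdet

/-- The factor of automorphy `M_{γ,(m,n)}(τ, z)`, an automorphism of the Lie algebra `𝔭_N`. -/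
noncomputable def automorphy (g : JacobiGroup N) (x : ℍ × ℂ) : P N ≃ₗ⁅ℂ⁆ P N :=
  { autHom g x with
    invFun := autHom g⁻¹ (g • x)
    left_inv := fun v => by
      change autHom g⁻¹ (g • x) (autHom g x v) = v
      rw [← autHom_mul, inv_mul_cancel, autHom_one]
    right_inv := fun v => by
      change autHom g x (autHom g⁻¹ (g • x) v) = v
      have h := autHom_mul g g⁻¹ (g • x) v
      rw [inv_smul_smul, mul_inv_cancel, autHom_one] at h
      exact h.symm }

end Automorphy

/-- The total space `ℍ × ℂ × 𝔭_N` of the trivial bundle. -/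
structure Total (N : ℕ) [NeZero N] where
  base : ℍ × ℂ
  vec : P N

section Bundle

variable (N : ℕ) [NeZero N]

/-- The action of `Γ(N) ⋉ ℤ²` on the total space given by the factor of automorphy. -/
noncomputable instance : MulAction (JacobiGroup N) (Total N) where
  smul g p := ⟨g • p.base, automorphy g p.base p.vec⟩
  one_smul p := by
    change (⟨(1 : JacobiGroup N) • p.base, autHom 1 p.base p.vec⟩ : Total N) = p
    rw [one_smul, autHom_one]
  mul_smul g h p := by
    change (⟨(g * h) • p.base, autHom (g * h) p.base p.vec⟩ : Total N) =
      ⟨g • h • p.base, autHom g (h • p.base) (autHom h p.base p.vec)⟩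
    rw [mul_smul, autHom_mul]

/-- The universal elliptic curve `ℰ_N`, with the quotient topology. -/
abbrev E : Type := Quotient (MulAction.orbitRel (JacobiGroup N) (ℍ × ℂ))

/-- The total space of the bundle `𝒫_N`. -/
abbrev BundleP : Type := Quotient (MulAction.orbitRel (JacobiGroup N) (Total N))

variable {N} in
/-- The quotient map `ℍ × ℂ → ℰ_N`. -/
noncomputable def toE (x : ℍ × ℂ) : E N := Quotient.mk _ x

variable {N} in
theorem toE_smul (g : JacobiGroup N) (x : ℍ × ℂ) : toE (g • x) = toE (N := N) x :=
  Quotient.sound ⟨g, rfl⟩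

variable {N} in
/-- The projection of `𝒫_N` to `ℰ_N`. -/
noncomputable def BundleP.proj : BundleP N → E N :=
  Quotient.map' (fun p => p.base) fun p q h => by
    obtain ⟨g, rfl⟩ := h
    exact ⟨g, rfl⟩

/-- The preimage `Λ_N` in `ℍ × ℂ` of the set of `N`-torsion sections. -/
def torsionLocus : Set (ℍ × ℂ) :=
  {x | ∃ a b : ℤ, x.2 = (a : ℂ) / N + (b : ℂ) / N * (x.1 : ℂ)}

end Bundle

/-! ### Special functions -/

section Functions

/-- The classical theta function
`θ(z|τ) = ∑ (-1)^n exp(πiτ(n + 1/2)²) exp(z(n + 1/2))`, summed over the integers. -/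
noncomputable def theta (z τ : ℂ) : ℂ :=
  ∑' n : ℤ, (-1 : ℂ) ^ n * Complex.exp (Real.pi * Complex.I * τ * (n + 1 / 2) ^ 2) *
    Complex.exp (z * (n + 1 / 2))

/-- Zagier's Jacobi form `θ'(0|τ) θ(u + v|τ) / (θ(u|τ) θ(v|τ))`. -/
noncomputable def zagierF (τ u v : ℂ) : ℂ :=
  deriv (fun w => theta w τ) 0 * theta (u + v) τ / (theta u τ * theta v τ)

/-- The Jacobi form `F(x, z, τ) = 2πi F^Zag_τ(x, 2πi z)`. -/
noncomputable def jacobiF (x z τ : ℂ) : ℂ :=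
  2 * Real.pi * Complex.I * zagierF τ x (2 * Real.pi * Complex.I * z)

variable {N : ℕ}

/-- A lift to `ℚ ⊆ ℂ` of a coordinate in `N⁻¹ℤ/ℤ ≅ ℤ/N`. -/
noncomputable def coordLift (k : ZMod N) : ℂ := (k.val : ℂ) / N

/-- `h_α(x, z|τ) = exp(-y_α x) F(x, z - x_α - y_α τ, τ) - 2πi/x`, where `α = (x_α, y_α)`. -/
noncomputable def hFun (α : ZMod N × ZMod N) (x z τ : ℂ) : ℂ :=
  Complex.exp (-coordLift α.2 * x) * jacobiF x (z - (coordLift α.1 + coordLift α.2 * τ)) τ -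
    2 * Real.pi * Complex.I / x

/-- `g_α(x, z|τ) = ∂h_α/∂x (x, z|τ)`. -/
noncomputable def gFun (α : ZMod N × ZMod N) (x z τ : ℂ) : ℂ :=
  deriv (fun x' => hFun α x' z τ) x

/-- The `k`-th Taylor coefficient at `0` of a function with a removable singularity at `0`. -/
noncomputable def taylorCoeff (f : ℂ → ℂ) (k : ℕ) : ℂ :=
  iteratedDeriv k (Function.update f 0 (Filter.limUnder (𝓝[≠] 0) f)) 0 / k.factorial

/-- The Taylor coefficients `A_{m,α}(τ)` of `g_α(x, 0|τ)` with respect to `x`, where the value at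
`z = 0` is understood after removal of the singularity at `z = 0`. -/
noncomputable def coeffA (m : ℕ) (α : ZMod N × ZMod N) (τ : ℂ) : ℂ :=
  taylorCoeff (fun x => Filter.limUnder (𝓝[≠] 0) (fun z => gFun α x z τ)) m

end Functions

/-! ### The connection form -/

section Connection

variable (N : ℕ) [NeZero N]

/-- The derivation `½ ∑ A_{m,α}(τ) δ_{m,α}`, the coefficient of `dτ` in `ψ`. -/
noncomputable def psiDer (τ : ℂ) : LieDerivation ℂ (P N) (P N) :=
  psumDer (fun m => (1 / 2 : ℂ) • ∑ α : ZMod N × ZMod N, coeffA m α τ • delta m α) (fun m v => by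
    rw [LieDerivation.smul_apply]
    refine (fil N m).smul_mem _ ?_
    have h : ∀ s : Finset (ZMod N × ZMod N),
        (∑ α ∈ s, coeffA m α τ • delta m α) v ∈ fil N m := by
      intro s
      induction s using Finset.induction_on with
      | empty => exact (fil N m).zero_mem
      | insert α s hα ih =>
        rw [Finset.sum_insert hα, LieDerivation.add_apply, LieDerivation.smul_apply]
        exact (fil N m).add_mem ((fil N m).smul_mem _ (delta_mem_fil m α v)) ih
    exact h _)

/-- The coefficient `∑ g_α(X, z|τ) · t_α` of `dτ` in `ν₁`. -/
noncomputable def nuOne (x : ℍ × ℂ) : P N :=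
  ∑ α : ZMod N × ZMod N,
    serAct (taylorCoeff (fun s => gFun α s x.2 x.1)) (gen .X) (gen (.t α))

/-- The coefficient `2πi Y + ∑ h_α(X, z|τ) · t_α` of `dz` in `ν₂`. -/
noncomputable def nuTwo (x : ℍ × ℂ) : P N :=
  (2 * Real.pi * Complex.I : ℂ) • gen .Y + ∑ α : ZMod N × ZMod N,
    serAct (taylorCoeff (fun s => hFun α s x.2 x.1)) (gen .X) (gen (.t α))

/-- The connection form `Ω_N = 2πi Y ∂/∂X dτ + ψ + ν₁ + ν₂`, evaluated at the point `x` and the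
tangent vector `ξ = (dτ(ξ), dz(ξ))`; elements of `𝔭_N` act by the adjoint action. -/
noncomputable def Omega (x : ℍ × ℂ) (ξ : ℂ × ℂ) : LieDerivation ℂ (P N) (P N) :=
  ξ.1 • ((2 * Real.pi * Complex.I : ℂ) • derYdX N + psiDer N x.1 +
      LieDerivation.ad ℂ (P N) (nuOne N x)) +
    ξ.2 • LieDerivation.ad ℂ (P N) (nuTwo N x)

/-- `Ω_N(x)(ξ)(v)` as a linear function of `ξ`. -/
noncomputable def OmegaApply (x : ℍ × ℂ) (v : P N) : ℂ × ℂ →ₗ[ℂ] P N where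
  toFun ξ := Omega N x ξ v
  map_add' ξ η := by simp [Omega]; module
  map_smul' c ξ := by simp [Omega]; module

end Connection

/-! ### Holomorphic sections, differentials and logarithmic forms -/

section Analysis

variable {N : ℕ} [NeZero N]

/-- The coordinates of a point of `ℍ × ℂ` in `ℂ × ℂ`. -/
noncomputable def coord (x : ℍ × ℂ) : ℂ × ℂ := (x.1, x.2)

/-- A function on `ℍ × ℂ` in terms of the coordinates. -/
noncomputable def inCoord {A : Type} (f : ℍ × ℂ → A) (w : ℂ × ℂ) : A :=
  f (UpperHalfPlane.ofComplex w.1, w.2)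

/-- A scalar function is holomorphic on a set of points of `ℍ × ℂ`. -/
def IsHolFun (W : Set (ℍ × ℂ)) (f : ℍ × ℂ → ℂ) : Prop :=
  ∀ x ∈ W, AnalyticAt ℂ (inCoord f) (coord x)

/-- A `𝔭_N`-valued function is holomorphic on a set: its composites with the linear functionals on
the (finite dimensional) truncations of `𝔭_N` are. -/
def IsHol (W : Set (ℍ × ℂ)) (s : ℍ × ℂ → P N) : Prop :=
  ∀ (n : ℕ) (φ : Trunc N n →ₗ[ℂ] ℂ), IsHolFun W (fun x => φ (proj n (s x)))

/-- `s'` is the differential of the `𝔭_N`-valued function `s` at `x`. -/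
def HasDifferential (s : ℍ × ℂ → P N) (s' : ℂ × ℂ →ₗ[ℂ] P N) (x : ℍ × ℂ) : Prop :=
  ∀ (n : ℕ) (φ : Trunc N n →ₗ[ℂ] ℂ), HasFDerivAt (inCoord fun y => φ (proj n (s y)))
    (LinearMap.toContinuousLinearMap (φ ∘ₗ proj n ∘ₗ s')) (coord x)

open Classical in
/-- The differential of a `𝔭_N`-valued function at `x` (zero if there is none). -/
noncomputable def differential (s : ℍ × ℂ → P N) (x : ℍ × ℂ) : ℂ × ℂ →ₗ[ℂ] P N :=
  if h : ∃ s', HasDifferential s s' x then h.choose else 0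

/-- The covariant derivative `(d + Ω_N) s`. -/
noncomputable def covD (s : ℍ × ℂ → P N) (x : ℍ × ℂ) : ℂ × ℂ →ₗ[ℂ] P N :=
  differential s x + OmegaApply N x (s x)

/-- The action of `g` on sections of the trivial bundle: `(g s)(g x) = M_g(x) s(x)`. -/
noncomputable def pushSection (g : JacobiGroup N) (s : ℍ × ℂ → P N) (y : ℍ × ℂ) : P N :=
  automorphy g (g⁻¹ • y) (s (g⁻¹ • y))

/-- The differential at `x` of the action of `g` on `ℍ × ℂ`. -/
noncomputable def dAct (g : JacobiGroup N) (x : ℍ × ℂ) : ℂ × ℂ →ₗ[ℂ] ℂ × ℂ :=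
  (fderiv ℂ (inCoord fun y => coord (g • y)) (coord x)).toLinearMap

/-- A `𝔭_N`-valued `1`-form on `W` (with values outside `Λ_N` only) is holomorphic outside `Λ_N` and
has at most logarithmic poles along `Λ_N`: near a point of the torsion section
`z = a/N + (b/N) τ` it is, in every truncation, of the form
`p dτ + q dz + r dℓ/ℓ` with `p`, `q`, `r` holomorphic and `ℓ = z - a/N - (b/N) τ`. -/
def IsLogForm (W : Set (ℍ × ℂ)) (ω : ℍ × ℂ → (ℂ × ℂ →ₗ[ℂ] P N)) : Prop :=
  (∀ ξ, IsHol (W \ torsionLocus N) (fun x => ω x ξ)) ∧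
  ∀ x ∈ W, ∀ a b : ℤ, x.2 = (a : ℂ) / N + (b : ℂ) / N * (x.1 : ℂ) → ∀ (n : ℕ) (φ : Trunc N n →ₗ[ℂ] ℂ),
    ∃ p q r : ℂ × ℂ → ℂ, AnalyticAt ℂ p (coord x) ∧ AnalyticAt ℂ q (coord x) ∧
      AnalyticAt ℂ r (coord x) ∧ ∀ᶠ w : ℂ × ℂ in 𝓝 (coord x), w.2 - (a : ℂ) / N - (b : ℂ) / N * w.1 ≠ 0 → ∀ ξ : ℂ × ℂ,
        φ (proj n (inCoord ω w ξ)) = p w * ξ.1 + q w * ξ.2 +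
          r w * ((ξ.2 - (b : ℂ) / N * ξ.1) / (w.2 - (a : ℂ) / N - (b : ℂ) / N * w.1))

/-- The preimage in `ℍ × ℂ` of a subset of `ℰ_N`. -/
def pre (U : TopologicalSpace.Opens (E N)) : Set (ℍ × ℂ) := {x | toE x ∈ U}

/-- The holomorphic functions on an open subset `U` of `ℰ_N`: invariant holomorphic functions on the
preimage of `U`. -/
def IsFunctionOn (U : TopologicalSpace.Opens (E N)) (f : ℍ × ℂ → ℂ) : Prop :=
  IsHolFun (pre U) f ∧ ∀ (g : JacobiGroup N), ∀ x ∈ pre U, f (g • x) = f x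

theorem IsHol.add {W : Set (ℍ × ℂ)} {s t : ℍ × ℂ → P N} (hs : IsHol W s) (ht : IsHol W t) :
    IsHol W (s + t) := fun n φ x hx => by
  have h := (hs n φ x hx).add (ht n φ x hx)
  refine h.congr (Filter.Eventually.of_forall fun w => ?_)
  simp [inCoord]

theorem IsHol.smul {W : Set (ℍ × ℂ)} {s : ℍ × ℂ → P N} (c : ℂ) (hs : IsHol W s) :
    IsHol W (c • s) := fun n φ x hx => by
  have h := (hs n φ x hx).const_smul (c := c)
  refine h.congr (Filter.Eventually.of_forall fun w => ?_)
  simp [inCoord]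

theorem IsHol.zero {W : Set (ℍ × ℂ)} : IsHol W (0 : ℍ × ℂ → P N) := fun n φ x _ => by
  have h : AnalyticAt ℂ (fun _ : ℂ × ℂ => (0 : ℂ)) (coord x) := analyticAt_const
  refine h.congr (Filter.Eventually.of_forall fun w => ?_)
  simp [inCoord]

/-- The holomorphic sections of `𝒫_N` over an open subset `U` of the (orbifold) quotient `ℰ_N`:
equivariant holomorphic `𝔭_N`-valued functions on the preimage of `U`, extended by zero. -/
noncomputable def Sections (U : TopologicalSpace.Opens (E N)) : Submodule ℂ (ℍ × ℂ → P N) where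
  carrier := {s | IsHol (pre U) s ∧
    (∀ (g : JacobiGroup N) (x : ℍ × ℂ), g • (⟨x, s x⟩ : Total N) = ⟨g • x, s (g • x)⟩) ∧
    ∀ x, x ∉ pre U → s x = 0}
  zero_mem' := ⟨IsHol.zero, fun g x => by
    change (⟨g • x, automorphy g x 0⟩ : Total N) = ⟨g • x, 0⟩
    rw [_root_.map_zero], fun _ _ => rfl⟩
  add_mem' {s t} hs ht := ⟨hs.1.add ht.1, fun g x => by
    have h1 : automorphy g x (s x) = s (g • x) := congrArg Total.vec (hs.2.1 g x)
    have h2 : automorphy g x (t x) = t (g • x) := congrArg Total.vec (ht.2.1 g x)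
    change (⟨g • x, automorphy g x (s x + t x)⟩ : Total N) = ⟨g • x, s (g • x) + t (g • x)⟩
    rw [_root_.map_add, h1, h2], fun x hx => by simp [hs.2.2 x hx, ht.2.2 x hx]⟩
  smul_mem' c s hs := ⟨hs.1.smul c, fun g x => by
    have h1 : automorphy g x (s x) = s (g • x) := congrArg Total.vec (hs.2.1 g x)
    change (⟨g • x, automorphy g x (c • s x)⟩ : Total N) = ⟨g • x, c • s (g • x)⟩
    rw [_root_.map_smul, h1], fun x hx => by simp [hs.2.2 x hx]⟩

/-- The section `ℰ_N ⊇ U → 𝒫_N` of the quotient bundle defined by an element of `Sections U` (with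
the value zero outside `U`). -/
noncomputable def toBundle {U : TopologicalSpace.Opens (E N)} (s : Sections U) : E N → BundleP N :=
  Quotient.map' (fun x => (⟨x, s.1 x⟩ : Total N)) fun x y h => by
    obtain ⟨g, rfl⟩ := h
    exact ⟨g, s.2.2.1 g y⟩

theorem proj_toBundle {U : TopologicalSpace.Opens (E N)} (s : Sections U) (e : E N) :
    (toBundle s e).proj = e := by
  induction e using Quotient.inductionOn with
  | h x => rfl

/-- The `𝒫_N`-valued `1`-forms over `U ⊆ ℰ_N` that are holomorphic outside the torsion sections and
have logarithmic poles along them: equivariant logarithmic forms on the preimage of `U`, extended by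
zero. -/
noncomputable def LogForms (U : TopologicalSpace.Opens (E N)) :
    Submodule ℂ (ℍ × ℂ → (ℂ × ℂ →ₗ[ℂ] P N)) where
  carrier := {ω | IsLogForm (pre U) ω ∧
    (∀ (g : JacobiGroup N) (x : ℍ × ℂ) (ξ : ℂ × ℂ),
      ω (g • x) (dAct g x ξ) = automorphy g x (ω x ξ)) ∧
    ∀ x, x ∉ pre U \ torsionLocus N → ω x = 0}
  zero_mem' := ⟨⟨fun _ => IsHol.zero, fun x _ a b _ n φ => ⟨0, 0, 0, analyticAt_const,
      analyticAt_const, analyticAt_const, Filter.Eventually.of_forall fun w _ ξ => by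
        simp [inCoord]⟩⟩, fun g x ξ => by simp, fun _ _ => rfl⟩
  add_mem' {ω η} hω hη := ⟨⟨fun ξ => (hω.1.1 ξ).add (hη.1.1 ξ), fun x hx a b hab n φ => by
      obtain ⟨p, q, r, hp, hq, hr, h⟩ := hω.1.2 x hx a b hab n φ
      obtain ⟨p', q', r', hp', hq', hr', h'⟩ := hη.1.2 x hx a b hab n φ
      refine ⟨p + p', q + q', r + r', hp.add hp', hq.add hq', hr.add hr', ?_⟩
      filter_upwards [h, h'] with w hw hw' hne ξ
      have e : φ (proj n (inCoord (ω + η) w ξ)) =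
          φ (proj n (inCoord ω w ξ)) + φ (proj n (inCoord η w ξ)) := by simp [inCoord]
      rw [e, hw hne, hw' hne]
      simp only [Pi.add_apply]
      ring⟩,
    fun g x ξ => by simp [hω.2.1 g x ξ, hη.2.1 g x ξ],
    fun x hx => by simp [hω.2.2 x hx, hη.2.2 x hx]⟩
  smul_mem' c ω hω := ⟨⟨fun ξ => (hω.1.1 ξ).smul c, fun x hx a b hab n φ => by
      obtain ⟨p, q, r, hp, hq, hr, h⟩ := hω.1.2 x hx a b hab n φ
      refine ⟨c • p, c • q, c • r, hp.const_smul, hq.const_smul, hr.const_smul, ?_⟩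
      filter_upwards [h] with w hw hne ξ
      have e : φ (proj n (inCoord (c • ω) w ξ)) = c * φ (proj n (inCoord ω w ξ)) := by
        simp [inCoord]
      rw [e, hw hne]
      simp only [Pi.smul_apply, smul_eq_mul]
      ring⟩,
    fun g x ξ => by simp [hω.2.1 g x ξ], fun x hx => by simp [hω.2.2 x hx]⟩

/-- A connection on `𝒫_N → ℰ_N` with logarithmic singularities along the torsion sections: for
each open `U ⊆ ℰ_N` a linear map from the sections of `𝒫_N` over `U` to the `𝒫_N`-valued
logarithmic `1`-forms over `U`, compatible with restriction and satisfying the Leibniz rule. -/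
structure LogConnection (N : ℕ) [NeZero N] where
  nabla : ∀ U : TopologicalSpace.Opens (E N), Sections U →ₗ[ℂ] LogForms U
  restrict : ∀ (U V : TopologicalSpace.Opens (E N)), V ≤ U → ∀ (s : Sections U) (t : Sections V),
    (∀ x ∈ pre V, t.1 x = s.1 x) → ∀ x ∈ pre V, (nabla V t).1 x = (nabla U s).1 x
  leibniz : ∀ (U : TopologicalSpace.Opens (E N)) (f : ℍ × ℂ → ℂ), IsFunctionOn U f →
    ∀ s t : Sections U, (∀ x ∈ pre U, t.1 x = f x • s.1 x) →
    ∀ x ∈ pre U \ torsionLocus N, ∀ ξ : ℂ × ℂ,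
      (nabla U t).1 x ξ = fderiv ℂ (inCoord f) (coord x) ξ • s.1 x + f x • (nabla U s).1 x ξ

end Analysis

end KZB

set_option linter.unusedSectionVars false

/-! Everything rests on two rules for Zagier's form F, with j = cτ + d: F(x, z + mτ + n, τ) =
exp(-mx) F(x, z, τ) (`jacobiF_add_lattice`) and F(x/j, z/j, γτ) = j exp(cxz/j) F(x, z, τ)
(`jacobiF_modular`). They are properties of θ, obtained from Liouville's theorem: an entire function
that vanishes at the zeros, all simple, of another one and has multipliers of the same absolute
value is a constant multiple of it (`exists_const_mul_of_quasiPeriodic`). Comparison with an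
infinite product locates the zeros of θ; comparison with its own modular transform gives modularity
up to a constant, which cancels in F.

Invariance. Put κ = 2πi, w = c(z + n) - md and φ_w(X) = (exp(wX) - 1)/X. Since γ ≡ 1 mod N, the
group moves each torsion section α only by a lattice vector, and the two rules combine to h_α(s, gx)
= κφ_w(s) + j exp(ws) h_α(js, x) (`hFun_smul`). Let this act on t_α and sum over α: the relation ∑
t_α = [X, Y] turns φ_w(X)∑ t_α into exp(wX)Y - Y, so the dz-coefficient is carried along by M_g up
to a multiple of X, which is the dz-part of (dM_g)M_g⁻¹ (`nuTwo_smul`). Differentiation in s gives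
the law of the g_α (`nuOne_smul`); its extra term in φ_w(X)Y cancels against the one produced by
conjugating Y∂/∂X with exp(wX) (`der_act_expSer`). Conjugation of Y∂/∂X with M_γ produces the
logarithmic τ-derivative of M_γ (`autM_derYdX`). Finally A_{m,α} has weight m + 2 and δ_{m,α} has
weight m (`coeffA_smul`, `autM_delta`); the coefficient A_{0,0}, excluded from the first statement,
does not matter because δ_{0,0} = 0. The sum of these facts is `Omega_smul`.

Poles. Near z = a/N + (b/N)τ the coefficient of x^k in h_α has at most a simple pole, with residue
ρ(-b/N)^k/k!. Since g_α = ∂h_α/∂x, the residue of its coefficient is -b/N times as large, so the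
polar part of Ω_N is a multiple of (dz - (b/N)dτ)/ℓ = dℓ/ℓ, where ℓ = z - a/N - (b/N)τ
(`exists_pole_hSer`, `exists_pole_Omega`).

Holomorphy is checked in the finite dimensional truncations; Osgood's lemma reduces it to
differentiability in (τ, z). The descent is then formal: d + Ω_N commutes with the group, hence
preserves equivariance, and forms are normalised to vanish on Λ_N, so their values elsewhere
determine the connection. -/

namespace KZB

/-! ### Osgood's lemma and analytic dependence on parameters. -/

section SeveralVariables

open Metric

/-- The coordinate function on a circle, as an element of the algebra of continuous functions. -/
noncomputable def circleCoord (c : ℂ) (R : ℝ) : C(sphere c R, ℂ) := ⟨fun ζ => ζ, by fun_prop⟩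

/-- The Cauchy kernel `ζ ↦ (ζ - x)⁻¹` on a circle. -/
noncomputable def cauchyKernel (c : ℂ) (R : ℝ) (x : ℂ) : C(sphere c R, ℂ) :=
  Ring.inverse (circleCoord c R - algebraMap ℂ _ x)

theorem isUnit_circleCoord_sub {c : ℂ} {R : ℝ} {x : ℂ} (hx : x ∈ ball c R) :
    IsUnit (circleCoord c R - algebraMap ℂ _ x) := by
  rw [ContinuousMap.isUnit_iff_forall_ne_zero]
  intro ζ h
  have h1 : (ζ : ℂ) - x = 0 := h
  have h2 := ζ.2
  rw [sub_eq_zero.1 h1, mem_sphere] at h2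
  rw [mem_ball, h2] at hx
  exact lt_irrefl _ hx

theorem cauchyKernel_apply {c : ℂ} {R : ℝ} {x : ℂ} (hx : x ∈ ball c R) (ζ : sphere c R) :
    cauchyKernel c R x ζ = ((ζ : ℂ) - x)⁻¹ := by
  have h := Ring.mul_inverse_cancel _ (isUnit_circleCoord_sub hx)
  have h1 : ((ζ : ℂ) - x) * cauchyKernel c R x ζ = 1 := congrArg (fun f => f ζ) h
  exact eq_inv_of_mul_eq_one_right h1

/-- Inversion is analytic at the units of a Banach algebra. Regarding the kernel as an inverse in
`C(sphere c R, ℂ)` therefore gives analyticity in the parameter without estimates. -/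
theorem analyticAt_cauchyKernel {c : ℂ} {R : ℝ} {x : ℂ} (hx : x ∈ ball c R) :
    AnalyticAt ℂ (cauchyKernel c R) x := by
  obtain ⟨u, hu⟩ := isUnit_circleCoord_sub hx
  have h1 : AnalyticAt ℂ (Ring.inverse : C(sphere c R, ℂ) → _)
      (circleCoord c R - algebraMap ℂ _ x) := by
    rw [← hu]
    exact analyticAt_inverse u
  have h2 : AnalyticAt ℂ (fun x : ℂ => circleCoord c R - algebraMap ℂ C(sphere c R, ℂ) x) x := by
    refine analyticAt_const.sub ?_
    have := ((ContinuousLinearMap.id ℂ ℂ).smulRight (1 : C(sphere c R, ℂ))).analyticAt x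
    refine this.congr (Filter.Eventually.of_forall fun y => ?_)
    simp [Algebra.algebraMap_eq_smul_one]
  exact AnalyticAt.fun_comp (g := Ring.inverse) h1 h2

/-- Integration along a circle. -/
noncomputable def circleFunctional (c : ℂ) {R : ℝ} (hR : 0 ≤ R) : C(sphere c R, ℂ) →L[ℂ] ℂ :=
  LinearMap.mkContinuous
    { toFun := fun g => ∫ θ in (0 : ℝ)..2 * Real.pi, deriv (circleMap c R) θ *
        g ⟨circleMap c R θ, circleMap_mem_sphere c hR θ⟩
      map_add' := fun g h => by
        rw [← intervalIntegral.integral_add]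
        · simp [mul_add]
        all_goals
          refine Continuous.intervalIntegrable ?_ _ _
          simp only [deriv_circleMap]
          fun_prop
      map_smul' := fun a g => by
        rw [RingHom.id_apply, ← intervalIntegral.integral_smul]
        simp [mul_left_comm] }
    (|R| * |2 * Real.pi - 0|) (fun g => by
      refine (intervalIntegral.norm_integral_le_of_norm_le_const (C := |R| * ‖g‖) ?_).trans
        (le_of_eq (by ring))
      intro θ _
      rw [norm_mul]
      refine mul_le_mul ?_ (g.norm_coe_le_norm _) (norm_nonneg _) (abs_nonneg _)
      simp [deriv_circleMap])

theorem circleFunctional_eq (c : ℂ) {R : ℝ} (hR : 0 ≤ R) (g : C(sphere c R, ℂ)) (f : ℂ → ℂ)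
    (h : ∀ ζ : sphere c R, g ζ = f ζ) : circleFunctional c hR g = ∮ ζ in C(c, R), f ζ := by
  change ∫ θ in (0 : ℝ)..2 * Real.pi, deriv (circleMap c R) θ *
        g ⟨circleMap c R θ, circleMap_mem_sphere c hR θ⟩ = _
  simp only [h]
  rfl

/-- A function of two variables that is continuous on a bidisc and holomorphic in the second
variable, as a holomorphic function with values in the functions of the first variable. -/
theorem exists_analytic_curry {f : ℂ × ℂ → ℂ} {x₀ t₀ : ℂ} {R r : ℝ} (hr : 0 < r)
    (hc : ContinuousOn f (closedBall x₀ R ×ˢ closedBall t₀ r))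
    (hd : ∀ x ∈ closedBall x₀ R, DifferentiableOn ℂ (fun t => f (x, t)) (ball t₀ r)) :
    ∃ Ψ : ℂ → C(sphere x₀ R, ℂ), AnalyticAt ℂ Ψ t₀ ∧
      ∀ t ∈ ball t₀ r, ∀ ζ : sphere x₀ R, Ψ t ζ = f (ζ, t) := by
  classical
  have hcs : Continuous fun p : sphere t₀ r × sphere x₀ R => f (p.2, p.1) := by
    refine hc.comp_continuous (f := fun p : sphere t₀ r × sphere x₀ R => ((p.2 : ℂ), (p.1 : ℂ)))
      (by fun_prop) ?_
    intro p
    exact ⟨sphere_subset_closedBall p.2.2, sphere_subset_closedBall p.1.2⟩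
  let G : C(sphere t₀ r, C(sphere x₀ R, ℂ)) := ContinuousMap.curry ⟨_, hcs⟩
  -- `G` is defined on the circle only; the value zero elsewhere never enters the integral.
  let g : ℂ → C(sphere x₀ R, ℂ) := fun w => if h : w ∈ sphere t₀ r then G ⟨w, h⟩ else 0
  have hgc : ∀ θ, g (circleMap t₀ r θ) = G ⟨circleMap t₀ r θ, circleMap_mem_sphere _ hr.le θ⟩ :=
    fun θ => dif_pos _
  have hg : CircleIntegrable g t₀ r := by
    refine Continuous.intervalIntegrable ?_ _ _
    simp only [hgc]
    exact G.continuous.comp (by fun_prop)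
  let r' : NNReal := ⟨r, hr.le⟩
  -- A Cauchy integral of a Banach-valued function has a power series. Evaluation at a point ζ of
  -- the other circle commutes with the integral and gives back the scalar Cauchy formula for f(ζ,
  -- ·).
  have hps := hasFPowerSeriesOn_cauchy_integral (f := g) (c := t₀) (R := r') hg hr
  refine ⟨_, hps.analyticAt, fun t ht ζ => ?_⟩
  have hdc : DiffContOnCl ℂ (fun t => f (ζ, t)) (ball t₀ r) := by
    refine ⟨hd _ (sphere_subset_closedBall ζ.2), ?_⟩
    rw [closure_ball _ hr.ne']
    refine hc.comp (by fun_prop) fun w hw => ⟨sphere_subset_closedBall ζ.2, hw⟩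
  have key := hdc.two_pi_i_inv_smul_circleIntegral_sub_inv_smul ht
  refine Eq.trans ?_ key
  let ev : C(sphere x₀ R, ℂ) →L[ℂ] ℂ := ContinuousMap.evalCLM ℂ ζ
  have hev : ∀ h, ev h = h ζ := fun _ => rfl
  rw [← hev, map_smul]
  congr 1
  change ev (∫ θ in (0 : ℝ)..2 * Real.pi, _) = ∫ θ in (0 : ℝ)..2 * Real.pi, _
  rw [← ContinuousLinearMap.intervalIntegral_comp_comm]
  · refine intervalIntegral.integral_congr fun θ _ => ?_
    simp only [map_smul]
    congr 2
    change (g (circleMap t₀ r θ)) ζ = _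
    rw [hgc]
    rfl
  · have hne : ∀ θ, circleMap t₀ r θ - t ≠ 0 := by
      intro θ h0
      have h1 := circleMap_mem_sphere t₀ hr.le θ
      rw [sub_eq_zero.1 h0, mem_sphere] at h1
      rw [mem_ball, h1] at ht
      exact lt_irrefl _ ht
    refine Continuous.intervalIntegrable ?_ _ _
    change Continuous fun θ => deriv (circleMap t₀ r) θ • (circleMap t₀ r θ - t)⁻¹ •
      g (circleMap t₀ r θ)
    simp only [hgc, deriv_circleMap]
    have h1 : Continuous fun θ => (circleMap t₀ r θ - t)⁻¹ := Continuous.inv₀ (by fun_prop) hne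
    have h2 : Continuous fun θ =>
        G ⟨circleMap t₀ r θ, circleMap_mem_sphere _ hr.le θ⟩ := G.continuous.comp (by fun_prop)
    have h3 : Continuous fun θ => circleMap 0 r θ * Complex.I := by fun_prop
    exact h3.smul (h1.smul h2)

theorem exists_bidisc_subset {U : Set (ℂ × ℂ)} {p : ℂ × ℂ} (hU : U ∈ 𝓝 p) :
    ∃ R > 0, closedBall p.1 R ×ˢ closedBall p.2 R ⊆ U := by
  obtain ⟨R, hR, h⟩ := Metric.nhds_basis_closedBall.mem_iff.1 hU
  refine ⟨R, hR, ?_⟩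
  rwa [closedBall_prod_same]

/-- Osgood's lemma: a differentiable function of two complex variables is analytic; moreover the
difference quotient in the first variable is analytic. -/
theorem analyticAt_and_dslope {f : ℂ × ℂ → ℂ} {p : ℂ × ℂ}
    (h : ∀ᶠ q in 𝓝 p, DifferentiableAt ℂ f q) :
    AnalyticAt ℂ f p ∧
      AnalyticAt ℂ (fun q : ℂ × ℂ => dslope (fun x => f (x, q.2)) p.1 q.1) p := by
  obtain ⟨x₀, t₀⟩ := p
  obtain ⟨R, hR, hsub⟩ := exists_bidisc_subset h
  have hdiff : ∀ q ∈ closedBall x₀ R ×ˢ closedBall t₀ R, DifferentiableAt ℂ f q :=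
    fun q hq => hsub hq
  obtain ⟨Ψ, hΨ, hΨe⟩ := exists_analytic_curry (f := f) hR
    (fun q hq => (hdiff q hq).continuousAt.continuousWithinAt) (fun x hx t ht => by
      refine DifferentiableAt.differentiableWithinAt ?_
      exact (hdiff (x, t) ⟨hx, ball_subset_closedBall ht⟩).comp t
        (by fun_prop : DifferentiableAt ℂ (fun t : ℂ => (x, t)) t))
  have hx₀ : x₀ ∈ ball x₀ R := mem_ball_self hR
  let a : ℂ := (2 * Real.pi * Complex.I : ℂ)⁻¹
  have hk : AnalyticAt ℂ (fun q : ℂ × ℂ => cauchyKernel x₀ R q.1) (x₀, t₀) :=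
    AnalyticAt.fun_comp (analyticAt_cauchyKernel hx₀) analyticAt_fst
  have hΨ' : AnalyticAt ℂ (fun q : ℂ × ℂ => Ψ q.2) (x₀, t₀) := AnalyticAt.fun_comp hΨ analyticAt_snd
  have hball : ball x₀ R ×ˢ ball t₀ R ∈ 𝓝 (x₀, t₀) :=
    prod_mem_nhds (ball_mem_nhds _ hR) (ball_mem_nhds _ hR)
  have hfx : ∀ t ∈ ball t₀ R, ∀ x ∈ closedBall x₀ R, DifferentiableAt ℂ (fun x => f (x, t)) x :=
    fun t ht x hx => (hdiff (x, t) ⟨hx, ball_subset_closedBall ht⟩).comp x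
      (by fun_prop : DifferentiableAt ℂ (fun x : ℂ => (x, t)) x)
  constructor
  -- The Cauchy formula in the first variable: a continuous linear functional of the product of a
  -- factor analytic in x and a factor analytic in t.
  · have h1 : AnalyticAt ℂ (fun q : ℂ × ℂ => a * circleFunctional x₀ hR.le
        (cauchyKernel x₀ R q.1 * Ψ q.2)) (x₀, t₀) :=
      analyticAt_const.mul (((circleFunctional x₀ hR.le).analyticAt _).fun_comp (hk.mul hΨ'))
    refine h1.congr (Filter.eventually_of_mem hball ?_)
    rintro ⟨x, t⟩ ⟨hx, ht⟩
    dsimp only at hx ht ⊢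
    rw [circleFunctional_eq x₀ hR.le _ (fun ζ => (ζ - x)⁻¹ • f (ζ, t)) fun ζ => by
      rw [ContinuousMap.mul_apply, cauchyKernel_apply hx, hΨe t ht]; rfl]
    have hdc : DiffContOnCl ℂ (fun x => f (x, t)) (ball x₀ R) := by
      refine DifferentiableOn.diffContOnCl ?_
      rw [closure_ball _ hR.ne']
      exact fun x hx => (hfx t ht x hx).differentiableWithinAt
    exact hdc.two_pi_i_inv_smul_circleIntegral_sub_inv_smul hx
  -- The difference quotient is (2πi)⁻¹∮ f(ζ, t)/((ζ - x)(ζ - x₀)) dζ, because the subtracted term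
  -- f(x₀, t)∮ dζ/((ζ - x)(ζ - x₀)) vanishes.
  · have h1 : AnalyticAt ℂ (fun q : ℂ × ℂ => a * circleFunctional x₀ hR.le
        (cauchyKernel x₀ R q.1 * (cauchyKernel x₀ R x₀ * Ψ q.2))) (x₀, t₀) :=
      analyticAt_const.mul (((circleFunctional x₀ hR.le).analyticAt _).fun_comp
        (hk.mul (analyticAt_const.mul hΨ')))
    refine h1.congr (Filter.eventually_of_mem hball ?_)
    rintro ⟨x, t⟩ ⟨hx, ht⟩
    dsimp only at hx ht ⊢
    have hds : DifferentiableOn ℂ (dslope (fun x => f (x, t)) x₀) (closedBall x₀ R) := by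
      rw [Complex.differentiableOn_dslope (closedBall_mem_nhds _ hR)]
      exact fun x hx => (hfx t ht x hx).differentiableWithinAt
    have hdc : DiffContOnCl ℂ (dslope (fun x => f (x, t)) x₀) (ball x₀ R) := by
      refine DifferentiableOn.diffContOnCl ?_
      rwa [closure_ball _ hR.ne']
    rw [← hdc.two_pi_i_inv_smul_circleIntegral_sub_inv_smul hx, smul_eq_mul]
    congr 1
    have hne : ∀ ζ ∈ sphere x₀ R, ∀ y ∈ ball x₀ R, ζ - y ≠ 0 := by
      intro ζ hζ y hy h0
      rw [sub_eq_zero.1 h0, mem_sphere] at hζ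
      rw [mem_ball, hζ] at hy
      exact lt_irrefl _ hy
    rw [circleFunctional_eq x₀ hR.le _ (fun ζ => (ζ - x)⁻¹ • ((ζ - x₀)⁻¹ • f (ζ, t))) fun ζ => by
      rw [ContinuousMap.mul_apply, ContinuousMap.mul_apply, cauchyKernel_apply hx,
        cauchyKernel_apply hx₀, hΨe t ht]; rfl]
    have hsplit : ∀ ζ ∈ sphere x₀ R, (ζ - x)⁻¹ • dslope (fun x => f (x, t)) x₀ ζ =
        (ζ - x)⁻¹ • ((ζ - x₀)⁻¹ • f (ζ, t)) - (ζ - x)⁻¹ • ((ζ - x₀)⁻¹ • f (x₀, t)) := by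
      intro ζ hζ
      have : ζ ≠ x₀ := sub_ne_zero.1 (hne ζ hζ x₀ hx₀)
      rw [dslope_of_ne _ this, slope_def_field, ← smul_sub, ← smul_sub, smul_eq_mul (_ - x₀)⁻¹,
        div_eq_inv_mul]
    rw [circleIntegral.integral_congr hR.le hsplit, circleIntegral.integral_sub]
    -- The residues add up to zero: a double pole if x = x₀, two cancelling simple poles by partial
    -- fractions otherwise.
    · have h0 : (∮ ζ in C(x₀, R), (ζ - x)⁻¹ • ((ζ - x₀)⁻¹ • f (x₀, t))) = 0 := by
        rcases eq_or_ne x x₀ with rfl | hxx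
        · have hz := circleIntegral.integral_sub_zpow_of_ne (n := -2) (by norm_num) x x R
          have : ∀ ζ ∈ sphere x R, (ζ - x)⁻¹ • ((ζ - x)⁻¹ • f (x, t)) =
              (ζ - x) ^ (-2 : ℤ) • f (x, t) := by
            intro ζ _
            rw [smul_smul]; congr 1
            rw [zpow_neg, ← mul_inv]; congr 1
            norm_cast; ring
          rw [circleIntegral.integral_congr hR.le this, circleIntegral.integral_smul_const, hz,
            zero_smul]
        · have e : ∀ ζ ∈ sphere x₀ R, (ζ - x)⁻¹ • ((ζ - x₀)⁻¹ • f (x₀, t)) =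
              ((ζ - x)⁻¹ - (ζ - x₀)⁻¹) • ((x - x₀)⁻¹ * f (x₀, t)) := by
            intro ζ hζ
            have h1 := hne ζ hζ x hx
            have h2 := hne ζ hζ x₀ hx₀
            have h3 := sub_ne_zero.2 hxx
            simp only [smul_eq_mul]
            field_simp
            ring
          rw [circleIntegral.integral_congr hR.le e, circleIntegral.integral_smul_const,
            circleIntegral.integral_sub, circleIntegral.integral_sub_inv_of_mem_ball hx,
            circleIntegral.integral_sub_inv_of_mem_ball hx₀, sub_self, zero_smul]
          all_goals
            refine ContinuousOn.circleIntegrable hR.le (ContinuousOn.inv₀ (by fun_prop) ?_)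
            intro ζ hζ
            exact hne ζ hζ _ ‹_›
      rw [h0, sub_zero]
    · refine ContinuousOn.circleIntegrable hR.le ?_
      refine ContinuousOn.smul (ContinuousOn.inv₀ (by fun_prop) fun ζ hζ => hne ζ hζ x hx)
        (ContinuousOn.smul (ContinuousOn.inv₀ (by fun_prop) fun ζ hζ => hne ζ hζ x₀ hx₀) ?_)
      exact fun ζ hζ => (hfx t ht ζ (sphere_subset_closedBall hζ)).continuousAt.continuousWithinAt
    · refine ContinuousOn.circleIntegrable hR.le ?_
      exact ContinuousOn.smul (ContinuousOn.inv₀ (by fun_prop) fun ζ hζ => hne ζ hζ x hx)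
        (ContinuousOn.smul (ContinuousOn.inv₀ (by fun_prop) fun ζ hζ => hne ζ hζ x₀ hx₀)
          continuousOn_const)

theorem analyticAt_dslope {f : ℂ × ℂ → ℂ} {p : ℂ × ℂ} (h : AnalyticAt ℂ f p) :
    AnalyticAt ℂ (fun q : ℂ × ℂ => dslope (fun x => f (x, q.2)) p.1 q.1) p :=
  (analyticAt_and_dslope (h.eventually_analyticAt.mono fun _ h => h.differentiableAt)).2

/-- The derivatives in the first variable depend analytically on parameters. -/
theorem analyticAt_iteratedDeriv_fst {E : Type*} [NormedAddCommGroup E] [NormedSpace ℂ E]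
    (k : ℕ) {f : ℂ × E → ℂ} {x₀ : ℂ} {p : E} (h : AnalyticAt ℂ f (x₀, p)) :
    AnalyticAt ℂ (fun q => iteratedDeriv k (fun x => f (x, q)) x₀) p := by
  induction k generalizing f with
  | zero =>
    simp only [iteratedDeriv_zero]
    exact h.fun_comp (f := fun q : E => (x₀, q)) (by fun_prop)
  | succ k ih =>
    have h1 : AnalyticAt ℂ (fun y : ℂ × E => fderiv ℂ f y (1, 0)) (x₀, p) :=
      ((ContinuousLinearMap.apply ℂ ℂ ((1, 0) : ℂ × E)).analyticAt _).fun_comp h.fderiv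
    refine (ih h1).congr ?_
    -- The partial derivative must agree with the derivative of the slice for all x near x₀, not
    -- only at x₀, since it is differentiated further in x.
    have h2 : ∀ᶠ q in 𝓝 p, ∀ᶠ x in 𝓝 x₀, DifferentiableAt ℂ f (x, q) :=
      ((continuous_swap.tendsto (p, x₀)).eventually
        (h.eventually_analyticAt.mono fun _ h => h.differentiableAt)).curry_nhds
    filter_upwards [h2] with q hq
    rw [iteratedDeriv_succ']
    refine Filter.EventuallyEq.iteratedDeriv_eq k ?_
    filter_upwards [hq] with x hx
    have h3 := (hx.hasFDerivAt.comp_hasDerivAt x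
      ((hasDerivAt_id x).prodMk (hasDerivAt_const x q))).deriv
    exact h3.symm

end SeveralVariables

/-! ### Taylor series of functions with a removable singularity at 0. -/

section TaylorSeries

open PowerSeries

/-- The Taylor series at `0`. -/
noncomputable def taylorSer (f : ℂ → ℂ) : PowerSeries ℂ :=
  PowerSeries.mk fun k => iteratedDeriv k f 0 / k.factorial

theorem taylorSer_congr {f g : ℂ → ℂ} (h : f =ᶠ[𝓝 0] g) : taylorSer f = taylorSer g := by
  ext k
  simp [taylorSer, h.iteratedDeriv_eq k]

theorem taylorSer_add {f g : ℂ → ℂ} (hf : AnalyticAt ℂ f 0) (hg : AnalyticAt ℂ g 0) :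
    taylorSer (f + g) = taylorSer f + taylorSer g := by
  ext k
  simp [taylorSer, iteratedDeriv_add hf.contDiffAt hg.contDiffAt, add_div]

theorem taylorSer_mul {f g : ℂ → ℂ} (hf : AnalyticAt ℂ f 0) (hg : AnalyticAt ℂ g 0) :
    taylorSer (f * g) = taylorSer f * taylorSer g := by
  ext k
  rw [coeff_mul, Finset.Nat.sum_antidiagonal_eq_sum_range_succ_mk]
  simp only [taylorSer, coeff_mk]
  rw [iteratedDeriv_mul hf.contDiffAt hg.contDiffAt, Finset.sum_div]
  refine Finset.sum_congr rfl fun i hi => ?_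
  have hi' : i ≤ k := Nat.lt_succ_iff.1 (Finset.mem_range.1 hi)
  rw [Nat.cast_choose ℂ hi']
  have h1 : (k.factorial : ℂ) ≠ 0 := Nat.cast_ne_zero.2 k.factorial_ne_zero
  have h2 : (i.factorial : ℂ) ≠ 0 := Nat.cast_ne_zero.2 i.factorial_ne_zero
  have h3 : ((k - i).factorial : ℂ) ≠ 0 := Nat.cast_ne_zero.2 (k - i).factorial_ne_zero
  field_simp

theorem taylorSer_const (c : ℂ) : taylorSer (fun _ => c) = C c := by
  ext k
  rw [coeff_C]
  rcases k with _ | k <;> simp [taylorSer, iteratedDeriv_const]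

theorem taylorSer_id : taylorSer (fun x => x) = X := by
  ext k
  rw [coeff_X]
  simp only [taylorSer, coeff_mk, iteratedDeriv_fun_id_zero]
  split_ifs with h <;> simp [h]

theorem taylorSer_exp (w : ℂ) :
    taylorSer (fun x => Complex.exp (w * x)) = rescale w (PowerSeries.exp ℂ) := by
  ext k
  rw [coeff_rescale, coeff_exp]
  simp [taylorSer, iteratedDeriv_cexp_const_mul, div_eq_mul_inv]

theorem iteratedDeriv_comp_mul_zero (k : ℕ) (c : ℂ) {f : ℂ → ℂ} (hf : AnalyticAt ℂ f 0) :
    iteratedDeriv k (fun x => f (c * x)) 0 = c ^ k * iteratedDeriv k f 0 := by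
  induction k generalizing f with
  | zero => simp
  | succ k ih =>
    rw [iteratedDeriv_succ', iteratedDeriv_succ']
    have hev : ∀ᶠ x in 𝓝 (0 : ℂ), AnalyticAt ℂ f (c * x) := by
      have : Filter.Tendsto (fun x : ℂ => c * x) (𝓝 0) (𝓝 0) := by
        simpa using (continuous_const_mul c).tendsto (0 : ℂ)
      exact this.eventually hf.eventually_analyticAt
    have h1 : deriv (fun x => f (c * x)) =ᶠ[𝓝 0] fun x => c * (deriv f) (c * x) := by
      filter_upwards [hev] with x hx
      have h2 := (HasDerivAt.comp x hx.differentiableAt.hasDerivAt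
        ((hasDerivAt_id x).const_mul c)).deriv
      simp only [mul_one] at h2
      rw [mul_comm c]
      exact h2
    rw [h1.iteratedDeriv_eq k, iteratedDeriv_const_mul_field, ih hf.deriv, pow_succ]
    ring

theorem taylorSer_comp_mul (c : ℂ) {f : ℂ → ℂ} (hf : AnalyticAt ℂ f 0) :
    taylorSer (fun x => f (c * x)) = rescale c (taylorSer f) := by
  ext k
  rw [coeff_rescale]
  simp only [taylorSer, coeff_mk, iteratedDeriv_comp_mul_zero k c hf, mul_div_assoc]

theorem taylorSer_deriv (f : ℂ → ℂ) : taylorSer (deriv f) = derivative ℂ (taylorSer f) := by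
  ext k
  rw [coeff_derivative]
  simp only [taylorSer, coeff_mk, ← iteratedDeriv_succ', Nat.factorial_succ]
  push_cast
  have h1 : (k.factorial : ℂ) ≠ 0 := Nat.cast_ne_zero.2 k.factorial_ne_zero
  have h2 : (k + 1 : ℂ) ≠ 0 := by exact_mod_cast k.succ_ne_zero
  field_simp

/-- `f` has a removable singularity at `0`, and `p` is its Taylor series. -/
def HasSer (f : ℂ → ℂ) (p : PowerSeries ℂ) : Prop :=
  ∃ F, AnalyticAt ℂ F 0 ∧ f =ᶠ[𝓝[≠] 0] F ∧ taylorSer F = p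

theorem AnalyticAt.hasSer {F : ℂ → ℂ} (h : AnalyticAt ℂ F 0) : HasSer F (taylorSer F) :=
  ⟨F, h, Filter.EventuallyEq.rfl, rfl⟩

theorem HasSer.congr {f g : ℂ → ℂ} {p : PowerSeries ℂ} (h : HasSer f p)
    (hfg : f =ᶠ[𝓝[≠] 0] g) : HasSer g p := by
  obtain ⟨F, hF, he, hp⟩ := h
  exact ⟨F, hF, hfg.symm.trans he, hp⟩

theorem HasSer.taylorCoeff_eq {f : ℂ → ℂ} {p : PowerSeries ℂ} (h : HasSer f p) (k : ℕ) :
    taylorCoeff f k = coeff k p := by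
  obtain ⟨F, hF, he, rfl⟩ := h
  have hlim : Filter.limUnder (𝓝[≠] 0) f = F 0 := by
    refine Filter.Tendsto.limUnder_eq ?_
    exact (hF.continuousAt.tendsto.mono_left nhdsWithin_le_nhds).congr' he.symm
  have hu : Function.update f 0 (Filter.limUnder (𝓝[≠] 0) f) =ᶠ[𝓝 0] F := by
    rw [Filter.EventuallyEq, eventually_nhdsWithin_iff] at he
    filter_upwards [he] with x hx
    rcases eq_or_ne x 0 with rfl | h0
    · simp [hlim]
    · simp [h0, hx h0]
  simp [taylorCoeff, taylorSer, hu.iteratedDeriv_eq k]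

/-- This turns an identity of functions on a punctured neighbourhood of 0 into an identity of power
series. -/
theorem HasSer.unique {f : ℂ → ℂ} {p q : PowerSeries ℂ} (hp : HasSer f p) (hq : HasSer f q) :
    p = q := by
  ext k
  rw [← hp.taylorCoeff_eq, hq.taylorCoeff_eq]

theorem HasSer.mk_taylorCoeff {f : ℂ → ℂ} {p : PowerSeries ℂ} (h : HasSer f p) :
    PowerSeries.mk (taylorCoeff f) = p := by
  ext k
  rw [coeff_mk, h.taylorCoeff_eq]

theorem HasSer.add {f g : ℂ → ℂ} {p q : PowerSeries ℂ} (hp : HasSer f p) (hq : HasSer g q) :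
    HasSer (fun x => f x + g x) (p + q) := by
  obtain ⟨F, hF, he, rfl⟩ := hp
  obtain ⟨G, hG, he', rfl⟩ := hq
  exact ⟨F + G, hF.add hG, he.add he', taylorSer_add hF hG⟩

theorem HasSer.mul {f g : ℂ → ℂ} {p q : PowerSeries ℂ} (hp : HasSer f p) (hq : HasSer g q) :
    HasSer (fun x => f x * g x) (p * q) := by
  obtain ⟨F, hF, he, rfl⟩ := hp
  obtain ⟨G, hG, he', rfl⟩ := hq
  exact ⟨F * G, hF.mul hG, he.mul he', taylorSer_mul hF hG⟩

theorem hasSer_const (c : ℂ) : HasSer (fun _ => c) (C c) := by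
  rw [← taylorSer_const]
  exact AnalyticAt.hasSer analyticAt_const

theorem hasSer_id : HasSer (fun x => x) X := by
  rw [← taylorSer_id]
  exact AnalyticAt.hasSer analyticAt_id

theorem hasSer_exp (w : ℂ) :
    HasSer (fun x => Complex.exp (w * x)) (rescale w (PowerSeries.exp ℂ)) := by
  rw [← taylorSer_exp]
  exact AnalyticAt.hasSer (by fun_prop)

theorem HasSer.sub {f g : ℂ → ℂ} {p q : PowerSeries ℂ} (hp : HasSer f p) (hq : HasSer g q) :
    HasSer (fun x => f x - g x) (p - q) := by
  have h := hp.add ((hasSer_const (-1)).mul hq)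
  simp only [map_neg, map_one, neg_mul, one_mul, ← sub_eq_add_neg] at h
  exact h

theorem HasSer.deriv {f : ℂ → ℂ} {p : PowerSeries ℂ} (h : HasSer f p) :
    HasSer (deriv f) (derivative ℂ p) := by
  obtain ⟨F, hF, he, rfl⟩ := h
  refine ⟨_, hF.deriv, ?_, taylorSer_deriv F⟩
  -- Away from 0 the equality holds on a neighbourhood of each point, so it can be differentiated.
  have h1 : ∀ᶠ x in 𝓝[≠] (0 : ℂ), ∀ᶠ y in 𝓝 x, f y = F y := by
    rw [Filter.EventuallyEq, eventually_nhdsWithin_iff] at he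
    rw [eventually_nhdsWithin_iff]
    filter_upwards [he.eventually_nhds] with x hx h0
    filter_upwards [hx, isOpen_ne.mem_nhds h0] with y hy hy0
    exact hy hy0
  filter_upwards [h1] with x hx
  exact Filter.EventuallyEq.deriv_eq hx

theorem HasSer.comp_mul {f : ℂ → ℂ} {p : PowerSeries ℂ} (h : HasSer f p) {c : ℂ} (hc : c ≠ 0) :
    HasSer (fun x => f (c * x)) (rescale c p) := by
  obtain ⟨F, hF, he, rfl⟩ := h
  refine ⟨fun x => F (c * x), ?_, ?_, taylorSer_comp_mul c hF⟩
  · refine AnalyticAt.fun_comp (g := F) ?_ (by fun_prop)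
    simpa using hF
  · have : Filter.Tendsto (fun x : ℂ => c * x) (𝓝[≠] 0) (𝓝[≠] 0) := by
      refine tendsto_nhdsWithin_iff.2 ⟨?_, ?_⟩
      · have := (continuous_const_mul c).tendsto (0 : ℂ)
        rw [mul_zero] at this
        exact this.mono_left nhdsWithin_le_nhds
      · filter_upwards [self_mem_nhdsWithin] with x hx
        exact mul_ne_zero hc hx
    exact this.eventually he

/-- Division by x, realised by the difference quotient at 0. It is needed for h_α, where the poles
of F and of 2πi/x at x = 0 cancel only after multiplication by x. -/
theorem HasSer.of_X_mul {f : ℂ → ℂ} {p : PowerSeries ℂ} (h : HasSer (fun x => x * f x) (X * p)) :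
    HasSer f p := by
  obtain ⟨F, hF, he, hp⟩ := h
  have hF0 : F 0 = 0 := by
    have := congrArg (coeff 0) hp
    simpa [taylorSer] using this
  have hG : AnalyticAt ℂ (dslope F 0) 0 := by
    rw [Complex.analyticAt_iff_eventually_differentiableAt] at hF ⊢
    obtain ⟨U, hU, hUo, h0⟩ := eventually_nhds_iff.1 hF
    have : DifferentiableOn ℂ (dslope F 0) U :=
      (Complex.differentiableOn_dslope (hUo.mem_nhds h0)).2 fun x hx =>
        (hU x hx).differentiableWithinAt
    exact Filter.eventually_of_mem (hUo.mem_nhds h0) fun x hx =>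
      this.differentiableAt (hUo.mem_nhds hx)
  have hFG : ∀ x, F x = x * dslope F 0 x := fun x => by
    have := sub_smul_dslope F 0 x
    rw [hF0, sub_zero, sub_zero, smul_eq_mul] at this
    exact this.symm
  refine ⟨_, hG, ?_, ?_⟩
  · filter_upwards [he, self_mem_nhdsWithin] with x hx h0
    rw [hFG] at hx
    exact mul_left_cancel₀ h0 hx
  · have h1 : taylorSer F = X * taylorSer (dslope F 0) := by
      rw [← taylorSer_id, ← taylorSer_mul (f := fun x => x) analyticAt_id hG]
      exact congrArg _ (funext hFG)
    rw [h1] at hp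
    exact mul_left_cancel₀ X_ne_zero hp

end TaylorSeries

local notation "κ" => (2 * (Real.pi : ℂ) * Complex.I)

/-! ### The theta function: quasi-periodicity and zeros. -/

section Theta

open Complex

theorem kappa_ne_zero : κ ≠ 0 := by simp [Real.pi_ne_zero]

/-- `z` lies in the lattice `ℤ + ℤ τ`. -/
def InLattice (τ z : ℂ) : Prop := ∃ m n : ℤ, z = m * τ + n

/-- In (n + 1/2)² = n² + n + 1/4 the linear term gives the shift τ/2, and (-1)ⁿ = exp(πin) gives the
shift 1/2. -/
theorem theta_eq_jacobiTheta₂ (z τ : ℂ) : theta z τ =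
    cexp (Real.pi * I * τ / 4 + z / 2) * jacobiTheta₂ (z / κ + 1 / 2 + τ / 2) τ := by
  rw [theta, jacobiTheta₂, ← tsum_mul_left]
  refine tsum_congr fun n => ?_
  have h1 : (-1 : ℂ) ^ n = cexp (n * (Real.pi * I)) := by rw [exp_int_mul, exp_pi_mul_I]
  have h2 : (Real.pi : ℂ) ≠ 0 := by exact_mod_cast Real.pi_ne_zero
  rw [h1, jacobiTheta₂_term, ← Complex.exp_add, ← Complex.exp_add, ← Complex.exp_add]
  congr 1
  field_simp [I_ne_zero]
  ring_nf

theorem differentiableAt_theta {p : ℂ × ℂ} (hp : 0 < p.2.im) :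
    DifferentiableAt ℂ (fun p : ℂ × ℂ => theta p.1 p.2) p := by
  simp only [theta_eq_jacobiTheta₂]
  refine DifferentiableAt.mul (by fun_prop) ?_
  have h := (hasFDerivAt_jacobiTheta₂ (p.1 / κ + 1 / 2 + p.2 / 2) hp).differentiableAt
  exact DifferentiableAt.comp (g := fun p : ℂ × ℂ => jacobiTheta₂ p.1 p.2)
    (f := fun p : ℂ × ℂ => (p.1 / κ + 1 / 2 + p.2 / 2, p.2)) p h (by fun_prop)

theorem eventually_im_pos {p : ℂ × ℂ} (hp : 0 < p.2.im) : ∀ᶠ q : ℂ × ℂ in 𝓝 p, 0 < q.2.im :=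
  (isOpen_lt continuous_const (by fun_prop)).mem_nhds hp

theorem analyticAt_theta {p : ℂ × ℂ} (hp : 0 < p.2.im) :
    AnalyticAt ℂ (fun p : ℂ × ℂ => theta p.1 p.2) p :=
  (analyticAt_and_dslope ((eventually_im_pos hp).mono fun _ h => differentiableAt_theta h)).1

theorem differentiable_theta {τ : ℂ} (hτ : 0 < τ.im) : Differentiable ℂ fun z => theta z τ :=
  fun z => DifferentiableAt.comp (g := fun p : ℂ × ℂ => theta p.1 p.2)
    (f := fun z : ℂ => (z, τ)) z (differentiableAt_theta hτ) (by fun_prop)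

theorem theta_neg (z τ : ℂ) : theta (-z) τ = -theta z τ := by
  rw [theta_eq_jacobiTheta₂, theta_eq_jacobiTheta₂, ← jacobiTheta₂_neg_left]
  have h : -(-z / κ + 1 / 2 + τ / 2) + τ + 1 = z / κ + 1 / 2 + τ / 2 := by ring
  have h2 : (Real.pi : ℂ) ≠ 0 := by exact_mod_cast Real.pi_ne_zero
  have e : ∀ w, -cexp w = cexp (Real.pi * I + w) := fun w => by
    rw [Complex.exp_add, exp_pi_mul_I, neg_one_mul]
  rw [← h, jacobiTheta₂_add_left, jacobiTheta₂_add_left', ← mul_assoc, ← neg_mul,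
    ← Complex.exp_add, e]
  congr 1
  rw [exp_eq_exp_iff_exists_int]
  refine ⟨-1, ?_⟩
  push_cast
  field_simp [I_ne_zero]
  ring

theorem theta_zero (τ : ℂ) : theta 0 τ = 0 := by
  have h := theta_neg 0 τ
  rw [neg_zero] at h
  exact self_eq_neg.1 h

theorem theta_add_one (z τ : ℂ) : theta (κ * (z + 1)) τ = -theta (κ * z) τ := by
  have h2 : (Real.pi : ℂ) ≠ 0 := by exact_mod_cast Real.pi_ne_zero
  rw [theta_eq_jacobiTheta₂, theta_eq_jacobiTheta₂, mul_div_cancel_left₀ _ kappa_ne_zero,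
    mul_div_cancel_left₀ _ kappa_ne_zero,
    show z + 1 + 1 / 2 + τ / 2 = (z + 1 / 2 + τ / 2) + 1 by ring, jacobiTheta₂_add_left,
    ← neg_mul, ← neg_one_mul (cexp _), ← exp_pi_mul_I, ← Complex.exp_add]
  ring_nf

theorem theta_add_tau (z τ : ℂ) : theta (κ * (z + τ)) τ =
    -cexp (-(Real.pi * I * τ) - κ * z) * theta (κ * z) τ := by
  rw [theta_eq_jacobiTheta₂, theta_eq_jacobiTheta₂, mul_div_cancel_left₀ _ kappa_ne_zero,
    mul_div_cancel_left₀ _ kappa_ne_zero,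
    show z + τ + 1 / 2 + τ / 2 = (z + 1 / 2 + τ / 2) + τ by ring, jacobiTheta₂_add_left',
    ← mul_assoc, ← mul_assoc, ← Complex.exp_add, ← neg_one_mul (cexp _), ← exp_pi_mul_I,
    ← Complex.exp_add, ← Complex.exp_add]
  congr 1
  rw [exp_eq_exp_iff_exists_int]
  exact ⟨-1, by push_cast; ring⟩

/-- Integration over a real period kills every Fourier term except n = 0, whose integral is 1; for
the zero function the result would be 0. -/
theorem exists_theta_ne_zero {τ : ℂ} (hτ : 0 < τ.im) : ∃ z, theta z τ ≠ 0 := by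
  by_contra! h
  have h0 : ∀ x : ℂ, jacobiTheta₂ x τ = 0 := by
    intro x
    have := h (κ * (x - 1 / 2 - τ / 2))
    rw [theta_eq_jacobiTheta₂, mul_div_cancel_left₀ _ kappa_ne_zero,
      show x - 1 / 2 - τ / 2 + 1 / 2 + τ / 2 = x by ring] at this
    exact (mul_eq_zero.1 this).resolve_left (Complex.exp_ne_zero _)
  have hnorm : ∀ (n : ℤ) (x : ℝ), ‖jacobiTheta₂_term n x τ‖ = ‖jacobiTheta₂_term n 0 τ‖ := by
    intro n x
    rw [norm_jacobiTheta₂_term, norm_jacobiTheta₂_term]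
    simp
  have hsum : Summable fun n : ℤ => ‖jacobiTheta₂_term n 0 τ‖ :=
    ((summable_jacobiTheta₂_term_iff 0 τ).2 hτ).norm
  have hcont : ∀ n : ℤ, Continuous fun x : ℝ => jacobiTheta₂_term n x τ := by
    intro n
    unfold jacobiTheta₂_term
    fun_prop
  have key := intervalIntegral.hasSum_integral_of_dominated_convergence (a := 0) (b := 1)
    (μ := MeasureTheory.volume) (F := fun (n : ℤ) (x : ℝ) => jacobiTheta₂_term n x τ)
    (f := fun x : ℝ => jacobiTheta₂ x τ)
    (fun n _ => ‖jacobiTheta₂_term n 0 τ‖) (fun n => (hcont n).aestronglyMeasurable)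
    (fun n => Filter.Eventually.of_forall fun x _ => (hnorm n x).le)
    (Filter.Eventually.of_forall fun x _ => hsum) (by simp)
    (Filter.Eventually.of_forall fun x _ => hasSum_jacobiTheta₂_term _ hτ)
  simp only [h0, intervalIntegral.integral_zero] at key
  have hint : ∀ n : ℤ, n ≠ 0 → ∫ x in (0 : ℝ)..1, jacobiTheta₂_term n x τ = 0 := by
    intro n hn
    have hc : (2 * Real.pi * I * n : ℂ) ≠ 0 := mul_ne_zero kappa_ne_zero (by exact_mod_cast hn)
    unfold jacobiTheta₂_term
    simp only [Complex.exp_add]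
    rw [intervalIntegral.integral_mul_const, integral_exp_mul_complex hc]
    have : cexp (2 * Real.pi * I * n * ((1 : ℝ) : ℂ)) = 1 := by
      rw [exp_eq_one_iff]; exact ⟨n, by push_cast; ring⟩
    rw [this]
    simp
  have := (hasSum_single 0 hint).unique key
  simp [jacobiTheta₂_term] at this

theorem norm_add_lattice {f : ℂ → ℂ} {τ : ℂ} (h1 : ∀ z, ‖f (z + 1)‖ = ‖f z‖)
    (h2 : ∀ z, ‖f (z + τ)‖ = ‖f z‖) (m n : ℤ) (z : ℂ) : ‖f (z + (m * τ + n))‖ = ‖f z‖ := by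
  have e1 : ∀ (n : ℤ) (z : ℂ), ‖f (z + n)‖ = ‖f z‖ := by
    intro n z
    induction n using Int.induction_on with
    | zero => simp
    | succ k ih => rw [← ih, ← h1 (z + ((k : ℤ) : ℂ))]; congr 2; push_cast; ring
    | pred k ih => rw [← ih, ← h1 (z + ((-(k : ℤ) - 1 : ℤ) : ℂ))]; congr 2; push_cast; ring
  have e2 : ∀ (m : ℤ) (z : ℂ), ‖f (z + m * τ)‖ = ‖f z‖ := by
    intro m z
    induction m using Int.induction_on with
    | zero => simp
    | succ k ih => rw [← ih, ← h2 (z + ((k : ℤ) : ℂ) * τ)]; congr 2; push_cast; ring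
    | pred k ih => rw [← ih, ← h2 (z + ((-(k : ℤ) - 1 : ℤ) : ℂ) * τ)]; congr 2; push_cast; ring
  rw [← add_assoc, e1, e2]

/-- Liouville's theorem for entire functions with doubly periodic absolute value. -/
theorem exists_const_of_norm_periodic {f : ℂ → ℂ} (hf : Differentiable ℂ f) {τ : ℂ}
    (hτ : 0 < τ.im) (h1 : ∀ z, ‖f (z + 1)‖ = ‖f z‖) (h2 : ∀ z, ‖f (z + τ)‖ = ‖f z‖) :
    ∃ c, ∀ z, f z = c := by
  refine hf.exists_const_forall_eq_of_bounded ?_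
  let φ : ℝ × ℝ → ℂ := fun p => p.1 * τ + p.2
  have hφ : Continuous φ := by fun_prop
  have hK : IsCompact ((fun p => f (φ p)) '' (Set.Icc 0 1 ×ˢ Set.Icc 0 1)) :=
    (isCompact_Icc.prod isCompact_Icc).image (hf.continuous.comp hφ)
  obtain ⟨C, hC⟩ := hK.isBounded.exists_norm_le
  refine isBounded_iff_forall_norm_le.2 ⟨C, ?_⟩
  rintro _ ⟨z, rfl⟩
  -- The real coordinates of z in the basis τ, 1; their fractional parts move z into a compact
  -- parallelogram.
  set s := z.im / τ.im with hs
  set t := z.re - s * τ.re with ht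
  have hz : z = s * τ + t := by
    apply Complex.ext
    · simp [ht]
    · simp [hs, hτ.ne']
  have hz' : z = φ (Int.fract s, Int.fract t) + (⌊s⌋ * τ + ⌊t⌋) := by
    conv_lhs => rw [hz]
    simp only [φ]
    rw [← Int.self_sub_floor, ← Int.self_sub_floor]
    push_cast
    ring
  rw [hz', norm_add_lattice h1 h2]
  refine hC _ ⟨_, ⟨⟨Int.fract_nonneg s, (Int.fract_lt_one s).le⟩,
    ⟨Int.fract_nonneg t, (Int.fract_lt_one t).le⟩⟩, rfl⟩

/-- Near a simple zero of `T` the quotient f/T equals the quotient of the two difference quotients,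
so the singularity is removable with value f'/T'. -/
theorem exists_entire_quotient {f T : ℂ → ℂ} (hf : Differentiable ℂ f) (hT : Differentiable ℂ T)
    (h : ∀ z, T z = 0 → f z = 0 ∧ deriv T z ≠ 0) :
    ∃ r : ℂ → ℂ, Differentiable ℂ r ∧ ∀ z, f z = r z * T z := by
  classical
  refine ⟨fun z => if T z = 0 then deriv f z / deriv T z else f z / T z, fun z => ?_, fun z => ?_⟩
  · have hds : ∀ g : ℂ → ℂ, Differentiable ℂ g → Differentiable ℂ (dslope g z) := fun g hg =>
      differentiableOn_univ.1 ((Complex.differentiableOn_dslope Filter.univ_mem).2 hg.differentiableOn)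
    by_cases hz : T z = 0
    · have hT' : dslope T z z ≠ 0 := by rw [dslope_same]; exact (h z hz).2
      have hd : DifferentiableAt ℂ (fun w => dslope f z w / dslope T z w) z :=
        ((hds f hf) z).div ((hds T hT) z) hT'
      refine hd.congr_of_eventuallyEq ?_
      filter_upwards [(hds T hT).continuous.continuousAt.eventually_ne hT'] with w hw
      rcases eq_or_ne w z with rfl | hwz
      · simp [hz]
      · have e : ∀ g : ℂ → ℂ, g z = 0 → g w = (w - z) * dslope g z w := fun g hg => by
          have := sub_smul_dslope g z w
          rw [hg, sub_zero, smul_eq_mul] at this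
          exact this.symm
        have hw0 := sub_ne_zero.2 hwz
        have : T w ≠ 0 := by rw [e T hz]; exact mul_ne_zero hw0 hw
        rw [if_neg this, e T hz, e f (h z hz).1, mul_div_mul_left _ _ hw0]
    · refine ((hf z).div (hT z) hz).congr_of_eventuallyEq ?_
      filter_upwards [hT.continuous.continuousAt.eventually_ne hz] with w hw
      rw [if_neg hw]; rfl
  · by_cases hz : T z = 0
    · simp [hz, (h z hz).1]
    · simp [hz]

/-- The product `∏ (1 - qⁿ⁺¹ ζ)`. -/
noncomputable def qProd (q ζ : ℂ) : ℂ := ∏' n : ℕ, (1 + -(q ^ (n + 1) * ζ))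

theorem summable_qProd {q : ℂ} (hq : ‖q‖ < 1) (ζ : ℂ) :
    Summable fun n : ℕ => ‖-(q ^ (n + 1) * ζ)‖ := by
  simp only [norm_neg, norm_mul, norm_pow]
  exact ((summable_nat_add_iff 1).2 (summable_geometric_of_lt_one (norm_nonneg _) hq)).mul_right _

theorem differentiable_qProd {q : ℂ} (hq : ‖q‖ < 1) : Differentiable ℂ (qProd q) := by
  intro ζ
  let K := Metric.ball (0 : ℂ) (‖ζ‖ + 1)
  have h : HasProdLocallyUniformlyOn (fun (n : ℕ) ζ => 1 + -(q ^ (n + 1) * ζ)) (qProd q) K := by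
    refine Summable.hasProdLocallyUniformlyOn_nat_one_add (u := fun n => ‖q‖ ^ (n + 1) * (‖ζ‖ + 1))
      Metric.isOpen_ball ?_ ?_ ?_
    · exact ((summable_nat_add_iff 1).2
        (summable_geometric_of_lt_one (norm_nonneg _) hq)).mul_right _
    · refine Filter.Eventually.of_forall fun n x hx => ?_
      rw [norm_neg, norm_mul, norm_pow]
      exact mul_le_mul_of_nonneg_left (mem_ball_zero_iff.1 hx).le (by positivity)
    · intro n
      fun_prop
  have hd : DifferentiableOn ℂ (qProd q) K := by
    refine TendstoLocallyUniformlyOn.differentiableOn h (Filter.Eventually.of_forall fun s => ?_)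
      Metric.isOpen_ball
    simpa [Finset.prod_fn] using DifferentiableOn.finsetProd (fun _ _ => by fun_prop)
  exact hd.differentiableAt (Metric.isOpen_ball.mem_nhds (by simp))

theorem qProd_eq {q : ℂ} (hq : ‖q‖ < 1) (ζ : ℂ) : qProd q ζ = (1 - q * ζ) * qProd q (q * ζ) := by
  rw [qProd, tprod_eq_zero_mul', qProd]
  · congr 1
    · ring
    · refine tprod_congr fun n => ?_
      ring
  · refine multipliable_one_add_of_summable ?_
    exact (summable_nat_add_iff 1).2 (summable_qProd hq ζ)

theorem qProd_ne_zero {q : ℂ} (hq : ‖q‖ < 1) {ζ : ℂ} (h : ∀ n : ℕ, q ^ (n + 1) * ζ ≠ 1) :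
    qProd q ζ ≠ 0 := by
  refine tprod_one_add_ne_zero_of_summable (fun n h0 => h n ?_) (summable_qProd hq ζ)
  linear_combination -h0

/-- The product side of the Jacobi triple product, up to a factor depending on `τ`. -/
noncomputable def thetaProd (τ z : ℂ) : ℂ :=
  2 * I * sin (Real.pi * z) * qProd (cexp (κ * τ)) (cexp (κ * z)) *
    qProd (cexp (κ * τ)) (cexp (-(κ * z)))

theorem norm_exp_kappa {τ : ℂ} (hτ : 0 < τ.im) : ‖cexp (κ * τ)‖ < 1 := by
  rw [norm_exp, Real.exp_lt_one_iff]
  simp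
  positivity

theorem differentiable_thetaProd {τ : ℂ} (hτ : 0 < τ.im) : Differentiable ℂ (thetaProd τ) := by
  have h := differentiable_qProd (norm_exp_kappa hτ)
  unfold thetaProd
  exact ((by fun_prop : Differentiable ℂ fun z : ℂ => 2 * I * sin (Real.pi * z)).mul
    (h.comp (by fun_prop : Differentiable ℂ fun z : ℂ => cexp (κ * z)))).mul
    (h.comp (by fun_prop : Differentiable ℂ fun z : ℂ => cexp (-(κ * z))))

theorem two_I_sin (z : ℂ) : 2 * I * sin (Real.pi * z) =
    cexp (Real.pi * I * z) * (1 - cexp (-(κ * z))) := by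
  have h := two_sin (Real.pi * z)
  have h1 : cexp (-(κ * z)) = cexp (-(Real.pi * z) * I) * cexp (-(Real.pi * z) * I) := by
    rw [← Complex.exp_add]; congr 1; ring
  have h2 : cexp (Real.pi * z * I) * cexp (-(Real.pi * z) * I) = 1 := by
    rw [← Complex.exp_add]; simp
  have h3 : cexp (Real.pi * I * z) = cexp (Real.pi * z * I) := by congr 1; ring
  rw [h1, h3]
  linear_combination I * h + (cexp (-(Real.pi * z) * I) - cexp (Real.pi * z * I)) * I_mul_I +
    cexp (-(Real.pi * z) * I) * h2

theorem thetaProd_add_one (τ z : ℂ) : thetaProd τ (z + 1) = -thetaProd τ z := by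
  have h1 : cexp (κ * (z + 1)) = cexp (κ * z) := by
    rw [mul_add, mul_one, Complex.exp_add, exp_two_pi_mul_I, mul_one]
  have h2 : cexp (-(κ * (z + 1))) = cexp (-(κ * z)) := by rw [exp_neg, h1, exp_neg]
  rw [thetaProd, thetaProd, h1, h2, mul_add, mul_one, sin_add_pi]
  ring

/-- With ζ = exp(κz), the first product loses its factor 1 - qζ, the second gains 1 - ζ⁻¹, and in
the sine 1 - ζ⁻¹ becomes 1 - (qζ)⁻¹; the quotient of what remains is a monomial in q and ζ. -/
theorem thetaProd_add_tau {τ : ℂ} (hτ : 0 < τ.im) (z : ℂ) : thetaProd τ (z + τ) =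
    -cexp (-(Real.pi * I * τ) - κ * z) * thetaProd τ z := by
  have hq := norm_exp_kappa hτ
  rw [thetaProd, thetaProd, two_I_sin, two_I_sin]
  set q := cexp (κ * τ) with hqd
  set ζ := cexp (κ * z) with hζ
  set p := cexp (Real.pi * I * τ) with hp
  have hq0 : q ≠ 0 := exp_ne_zero _
  have hζ0 : ζ ≠ 0 := exp_ne_zero _
  have hp0 : p ≠ 0 := exp_ne_zero _
  have hpq : p ^ 2 = q := by rw [hp, hqd, ← Complex.exp_nat_mul]; congr 1; push_cast; ring
  have e1 : cexp (κ * (z + τ)) = q * ζ := by rw [mul_add, Complex.exp_add, mul_comm]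
  have e2 : cexp (-(κ * (z + τ))) = q⁻¹ * ζ⁻¹ := by rw [exp_neg, e1, mul_inv]
  have e3 : cexp (-(κ * z)) = ζ⁻¹ := exp_neg _
  have e4 : cexp (Real.pi * I * (z + τ)) = cexp (Real.pi * I * z) * p := by
    rw [mul_add, Complex.exp_add]
  have e5 : cexp (-(Real.pi * I * τ) - κ * z) = p⁻¹ * ζ⁻¹ := by
    rw [sub_eq_add_neg, Complex.exp_add, exp_neg, e3]
  have h1 := qProd_eq hq ζ
  have h2 := qProd_eq hq (q⁻¹ * ζ⁻¹)
  rw [mul_inv_cancel_left₀ hq0] at h2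
  rw [e1, e2, e3, e4, e5, h1, h2]
  rw [← hpq]
  field_simp
  ring

/-- An absolutely convergent product vanishes only if a factor does, and each factor, like the sine,
vanishes only at lattice points. -/
theorem thetaProd_eq_zero {τ : ℂ} (hτ : 0 < τ.im) {z : ℂ} (h : thetaProd τ z = 0) :
    InLattice τ z := by
  have hq := norm_exp_kappa hτ
  by_contra hl
  have key : ∀ n : ℕ, cexp (κ * τ) ^ (n + 1) * cexp (κ * z) ≠ 1 := by
    intro n h1
    rw [← Complex.exp_nat_mul, ← Complex.exp_add, exp_eq_one_iff] at h1
    obtain ⟨k, hk⟩ := h1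
    refine hl ⟨-(n + 1), k, mul_left_cancel₀ kappa_ne_zero ?_⟩
    push_cast at hk ⊢
    linear_combination hk
  have key' : ∀ n : ℕ, cexp (κ * τ) ^ (n + 1) * cexp (-(κ * z)) ≠ 1 := by
    intro n h1
    rw [← Complex.exp_nat_mul, ← Complex.exp_add, exp_eq_one_iff] at h1
    obtain ⟨k, hk⟩ := h1
    refine hl ⟨n + 1, -k, mul_left_cancel₀ kappa_ne_zero ?_⟩
    push_cast at hk ⊢
    linear_combination -hk
  refine mul_ne_zero (mul_ne_zero (mul_ne_zero (by simp) ?_) (qProd_ne_zero hq key))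
    (qProd_ne_zero hq key') h
  intro hs
  obtain ⟨k, hk⟩ := sin_eq_zero_iff.1 hs
  have h2 : (Real.pi : ℂ) ≠ 0 := by exact_mod_cast Real.pi_ne_zero
  refine hl ⟨0, k, mul_left_cancel₀ h2 ?_⟩
  push_cast
  linear_combination hk

theorem deriv_thetaProd_zero {τ : ℂ} (hτ : 0 < τ.im) : deriv (thetaProd τ) 0 ≠ 0 := by
  have hq := norm_exp_kappa hτ
  have hd := differentiable_qProd hq
  have h1 : HasDerivAt (fun z : ℂ => 2 * I * sin (Real.pi * z)) (2 * I * Real.pi) 0 := by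
    have := (((hasDerivAt_id (0 : ℂ)).const_mul (Real.pi : ℂ)).csin).const_mul (2 * I)
    simpa using this
  have h2 : DifferentiableAt ℂ (fun z : ℂ => qProd (cexp (κ * τ)) (cexp (κ * z)) *
      qProd (cexp (κ * τ)) (cexp (-(κ * z)))) 0 :=
    ((hd.comp (by fun_prop : Differentiable ℂ fun z : ℂ => cexp (κ * z))).mul
    (hd.comp (by fun_prop : Differentiable ℂ fun z : ℂ => cexp (-(κ * z))))) 0
  have h3 := (h1.mul h2.hasDerivAt).deriv
  have h4 : thetaProd τ = (fun z : ℂ => 2 * I * sin (Real.pi * z)) *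
      fun z => qProd (cexp (κ * τ)) (cexp (κ * z)) * qProd (cexp (κ * τ)) (cexp (-(κ * z))) := by
    funext z
    simp [thetaProd, mul_assoc]
  have h5 : qProd (cexp (κ * τ)) 1 ≠ 0 := by
    refine qProd_ne_zero hq fun n h => ?_
    have := congrArg norm h
    rw [mul_one, norm_pow, norm_one] at this
    exact absurd this (pow_lt_one₀ (norm_nonneg _) hq (by simp)).ne
  rw [h4, h3]
  simp [h5, Real.pi_ne_zero]

/-- Stated for an arbitrary function because it serves both θ and the product `thetaProd`. -/
theorem quasiPeriodic_add_lattice {f : ℂ → ℂ} {τ : ℂ} (h1 : ∀ z, f (z + 1) = -f z)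
    (h2 : ∀ z, f (z + τ) = -cexp (-(Real.pi * I * τ) - κ * z) * f z) (m n : ℤ) (z : ℂ) :
    f (z + (m * τ + n)) = cexp (Real.pi * I * (m + n - m ^ 2 * τ) - κ * m * z) * f z := by
  have e1 : ∀ (n : ℤ) (z : ℂ), f (z + n) = cexp (Real.pi * I * n) * f z := by
    intro n z
    have hs : ∀ n : ℤ, cexp (Real.pi * I * ((n + 1 : ℤ) : ℂ)) = -cexp (Real.pi * I * n) := by
      intro n
      push_cast
      rw [mul_add, mul_one, Complex.exp_add, exp_pi_mul_I, mul_neg_one]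
    induction n using Int.induction_on with
    | zero => simp
    | succ k ih =>
      rw [hs, neg_mul, ← ih, ← h1]
      congr 1; push_cast; ring
    | pred k ih =>
      have h3 := hs (-(k : ℤ) - 1)
      have h4 := h1 (z + ((-(k : ℤ) - 1 : ℤ) : ℂ))
      rw [sub_add_cancel] at h3
      rw [show z + ((-(k : ℤ) - 1 : ℤ) : ℂ) + 1 = z + ((-(k : ℤ) : ℤ) : ℂ) by push_cast; ring, ih,
        h3] at h4
      linear_combination h4
  have e2 : ∀ (m : ℤ) (z : ℂ), f (z + m * τ) =
      cexp (Real.pi * I * (m - m ^ 2 * τ) - κ * m * z) * f z := by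
    intro m z
    have hs : ∀ m : ℤ, cexp (Real.pi * I * ((m + 1 : ℤ) - ((m + 1 : ℤ) : ℂ) ^ 2 * τ) -
        κ * (m + 1 : ℤ) * z) = -cexp (-(Real.pi * I * τ) - κ * (z + m * τ)) *
        cexp (Real.pi * I * (m - m ^ 2 * τ) - κ * m * z) := by
      intro m
      rw [← neg_one_mul (cexp (-(Real.pi * I * τ) - κ * (z + m * τ))), ← exp_pi_mul_I,
        ← Complex.exp_add, ← Complex.exp_add]
      congr 1
      push_cast
      ring
    induction m using Int.induction_on with
    | zero => simp
    | succ k ih =>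
      rw [hs, mul_assoc, ← ih, ← h2]
      congr 1; push_cast; ring
    | pred k ih =>
      have h3 := hs (-(k : ℤ) - 1)
      have h4 := h2 (z + ((-(k : ℤ) - 1 : ℤ) : ℂ) * τ)
      rw [sub_add_cancel] at h3
      rw [show z + ((-(k : ℤ) - 1 : ℤ) : ℂ) * τ + τ = z + ((-(k : ℤ) : ℤ) : ℂ) * τ by
        push_cast; ring, ih, h3, mul_assoc] at h4
      exact (mul_left_cancel₀ (neg_ne_zero.2 (exp_ne_zero _)) h4).symm
  rw [← add_assoc, e1, e2, ← mul_assoc, ← Complex.exp_add]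
  congr 2
  ring

theorem theta_add_lattice (z τ : ℂ) (m n : ℤ) : theta (κ * (z + (m * τ + n))) τ =
    cexp (Real.pi * I * (m + n - m ^ 2 * τ) - κ * m * z) * theta (κ * z) τ :=
  quasiPeriodic_add_lattice (f := fun z => theta (κ * z) τ) (fun z => theta_add_one z τ)
    (fun z => theta_add_tau z τ) m n z

theorem theta_lattice (τ : ℂ) (m n : ℤ) : theta (κ * (m * τ + n)) τ = 0 := by
  have := theta_add_lattice 0 τ m n
  rwa [mul_zero κ, theta_zero, mul_zero, zero_add] at this

/-- Differentiating the functional equation at 0, where f vanishes, leaves only the multiplier times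
f'(0): a simple zero at 0 is carried to every lattice point. -/
theorem deriv_ne_zero_of_quasiPeriodic {f : ℂ → ℂ} {τ : ℂ} (hf : Differentiable ℂ f)
    (h1 : ∀ z, f (z + 1) = -f z)
    (h2 : ∀ z, f (z + τ) = -cexp (-(Real.pi * I * τ) - κ * z) * f z) (h0 : f 0 = 0)
    (hd : deriv f 0 ≠ 0) {z : ℂ} (hz : InLattice τ z) : f z = 0 ∧ deriv f z ≠ 0 := by
  obtain ⟨m, n, rfl⟩ := hz
  set l : ℂ := m * τ + n with hl
  have key := quasiPeriodic_add_lattice h1 h2 m n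
  have hz : f l = 0 := by
    have := key 0
    rwa [h0, mul_zero, zero_add] at this
  refine ⟨hz, ?_⟩
  have h3 : HasDerivAt (fun z => f (z + l)) (deriv f l) 0 := by
    have h4 : HasDerivAt f (deriv f l) (0 + l) := by rw [zero_add]; exact (hf l).hasDerivAt
    exact h4.comp_add_const 0 l
  have h4 : HasDerivAt (fun z => cexp (Real.pi * I * (m + n - m ^ 2 * τ) - κ * m * z) * f z)
      (cexp (Real.pi * I * (m + n - m ^ 2 * τ)) * deriv f 0) 0 := by
    have h5 : DifferentiableAt ℂ
        (fun z => cexp (Real.pi * I * (m + n - m ^ 2 * τ) - κ * m * z)) 0 := by fun_prop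
    exact (h5.hasDerivAt.mul (hf 0).hasDerivAt).congr_deriv (by simp [h0])
  have h6 := h3.unique (h4.congr_of_eventuallyEq (Filter.Eventually.of_forall key))
  rw [h6]
  exact mul_ne_zero (exp_ne_zero _) hd

/-- Two entire functions with the same zeros (all simple for the second one) and with the same
quasi-periodicity up to constants of absolute value one are proportional. -/
theorem exists_const_mul_of_quasiPeriodic {f T : ℂ → ℂ} (hf : Differentiable ℂ f)
    (hT : Differentiable ℂ T) (h : ∀ z, T z = 0 → f z = 0 ∧ deriv T z ≠ 0) {τ : ℂ}
    (hτ : 0 < τ.im)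
    (h1 : ∀ z, ∃ u v : ℂ, ‖u‖ = ‖v‖ ∧ v ≠ 0 ∧ f (z + 1) = u * f z ∧ T (z + 1) = v * T z)
    (h2 : ∀ z, ∃ u v : ℂ, ‖u‖ = ‖v‖ ∧ v ≠ 0 ∧ f (z + τ) = u * f z ∧ T (z + τ) = v * T z) :
    ∃ c, ∀ z, f z = c * T z := by
  obtain ⟨r, hr, hrT⟩ := exists_entire_quotient hf hT h
  have hper : ∀ l : ℂ, (∀ z, ∃ u v : ℂ, ‖u‖ = ‖v‖ ∧ v ≠ 0 ∧ f (z + l) = u * f z ∧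
      T (z + l) = v * T z) → ∀ z, ‖r (z + l)‖ = ‖r z‖ := by
    intro l hl z
    -- Where `T` vanishes it cannot be divided out; those points are reached by continuity
    -- afterwards.
    have hgen : ∀ z, T z ≠ 0 → ‖r (z + l)‖ = ‖r z‖ := by
      intro z hz
      obtain ⟨u, v, huv, hv, h3, h4⟩ := hl z
      rw [hrT, hrT z, h4] at h3
      have h5 := congrArg norm h3
      rw [norm_mul, norm_mul, norm_mul, norm_mul, huv] at h5
      refine mul_right_cancel₀ (mul_ne_zero (norm_ne_zero_iff.2 hv) (norm_ne_zero_iff.2 hz)) ?_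
      linear_combination h5
    have hc := hr.continuous
    have han : AnalyticAt ℂ T z := hT.analyticAt z
    -- If `T` vanished near z, its derivative would vanish at a zero, contrary to simplicity.
    have h0 : ∀ᶠ w in 𝓝[≠] z, T w ≠ 0 := by
      rcases han.eventually_eq_zero_or_eventually_ne_zero with h0 | h0
      · exact absurd (Filter.EventuallyEq.deriv_eq h0) (by
          simpa using (h z h0.self_of_nhds).2)
      · exact h0
    refine tendsto_nhds_unique_of_eventuallyEq (f := fun w => ‖r (w + l)‖) (g := fun w => ‖r w‖)
      ((by fun_prop : Continuous fun w => ‖r (w + l)‖).continuousAt.tendsto.mono_left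
        (nhdsWithin_le_nhds (s := {z}ᶜ)))
      (hc.norm.continuousAt.tendsto.mono_left (nhdsWithin_le_nhds (s := {z}ᶜ))) ?_
    filter_upwards [h0] with w hw
    exact hgen w hw
  obtain ⟨c, hc⟩ := exists_const_of_norm_periodic hr hτ (hper 1 h1) (hper τ h2)
  exact ⟨c, fun z => by rw [hrT, hc]⟩

/-- A form of the Jacobi triple product in which the constant is not evaluated: both functions have
the same multipliers, and θ vanishes at the simple zeros of `thetaProd`. It shows that θ has no
zeros besides the lattice points and that these are simple. -/
theorem exists_theta_eq_thetaProd {τ : ℂ} (hτ : 0 < τ.im) :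
    ∃ c : ℂ, c ≠ 0 ∧ ∀ z, theta (κ * z) τ = c * thetaProd τ z := by
  have hT := differentiable_thetaProd hτ
  have hθ : Differentiable ℂ fun z => theta (κ * z) τ :=
    (differentiable_theta hτ).comp (by fun_prop : Differentiable ℂ fun z : ℂ => κ * z)
  have hT0 : thetaProd τ 0 = 0 := by simp [thetaProd]
  obtain ⟨c, hc⟩ := exists_const_mul_of_quasiPeriodic hθ hT (fun z hz => by
    have hz' := thetaProd_eq_zero hτ hz
    refine ⟨?_, (deriv_ne_zero_of_quasiPeriodic hT (thetaProd_add_one τ) (thetaProd_add_tau hτ) hT0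
      (deriv_thetaProd_zero hτ) hz').2⟩
    obtain ⟨m, n, rfl⟩ := hz'
    exact theta_lattice τ m n) hτ
    (fun z => ⟨-1, -1, rfl, by simp, by rw [theta_add_one]; ring, by rw [thetaProd_add_one]; ring⟩)
    (fun z => ⟨_, _, rfl, neg_ne_zero.2 (exp_ne_zero _), theta_add_tau z τ, thetaProd_add_tau hτ z⟩)
  refine ⟨c, ?_, hc⟩
  rintro rfl
  obtain ⟨z, hz⟩ := exists_theta_ne_zero hτ
  refine hz ?_
  have := hc (z / κ)
  rwa [mul_div_cancel₀ _ kappa_ne_zero, zero_mul] at this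

theorem theta_eq_zero_iff {τ : ℂ} (hτ : 0 < τ.im) (z : ℂ) :
    theta (κ * z) τ = 0 ↔ InLattice τ z := by
  constructor
  · intro h
    obtain ⟨c, hc, he⟩ := exists_theta_eq_thetaProd hτ
    rw [he] at h
    exact thetaProd_eq_zero hτ ((mul_eq_zero.1 h).resolve_left hc)
  · rintro ⟨m, n, rfl⟩
    exact theta_lattice τ m n

theorem deriv_theta_mul (τ : ℂ) (hτ : 0 < τ.im) (a z : ℂ) :
    deriv (fun z => theta (a * z) τ) z = a * deriv (fun z => theta z τ) (a * z) := by
  have h := HasDerivAt.comp z (differentiable_theta hτ (a * z)).hasDerivAt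
    ((hasDerivAt_id z).const_mul a)
  rw [mul_one, mul_comm] at h
  exact h.deriv

theorem deriv_theta_zero_ne {τ : ℂ} (hτ : 0 < τ.im) : deriv (fun z => theta z τ) 0 ≠ 0 := by
  obtain ⟨c, hc, he⟩ := exists_theta_eq_thetaProd hτ
  have h1 := deriv_theta_mul τ hτ κ 0
  rw [funext he, deriv_const_mul _ (differentiable_thetaProd hτ 0), mul_zero] at h1
  intro h
  rw [h, mul_zero] at h1
  exact mul_ne_zero hc (deriv_thetaProd_zero hτ) h1

end Theta

/-! ### Elliptic and modular transformation of the Jacobi form. -/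

section JacobiForm

open Complex

theorem jacobiF_def (x z τ : ℂ) : jacobiF x z τ = κ *
    (deriv (fun w => theta w τ) 0 * theta (x + κ * z) τ / (theta x τ * theta (κ * z) τ)) := rfl

/-- The multipliers of θ(x + κz) and θ(κz) differ by the factor exp(-mx); the rest cancels in the
quotient. -/
theorem jacobiF_add_lattice (x z τ : ℂ) (m n : ℤ) :
    jacobiF x (z + (m * τ + n)) τ = cexp (-(m * x)) * jacobiF x z τ := by
  have h1 : x + κ * (z + (m * τ + n)) = κ * (x / κ + z + (m * τ + n)) := by
    rw [add_assoc (x / κ) z, mul_add κ (x / κ), mul_div_cancel₀ _ kappa_ne_zero]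
  have h2 : κ * (x / κ + z) = x + κ * z := by
    rw [mul_add, mul_div_cancel₀ _ kappa_ne_zero]
  rw [jacobiF_def, jacobiF_def, h1, theta_add_lattice, theta_add_lattice, h2]
  set A := cexp (Real.pi * I * (m + n - m ^ 2 * τ) - κ * m * z) with hA
  have h3 : cexp (Real.pi * I * (m + n - m ^ 2 * τ) - κ * m * (x / κ + z)) =
      cexp (-(m * x)) * A := by
    rw [hA, ← Complex.exp_add]
    congr 1
    have h4 : κ * m * (x / κ + z) = m * (κ * (x / κ + z)) := by ring
    rw [h4, h2]
    ring
  have hA0 : A ≠ 0 := exp_ne_zero _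
  rw [h3]
  have h5 : deriv (fun w => theta w τ) 0 * (cexp (-(m * x)) * A * theta (x + κ * z) τ) /
      (theta x τ * (A * theta (κ * z) τ)) = (cexp (-(m * x)) *
      (deriv (fun w => theta w τ) 0 * theta (x + κ * z) τ)) / (theta x τ * theta (κ * z) τ) := by
    rw [← mul_div_mul_left _ (theta x τ * theta (κ * z) τ) hA0]
    congr 1 <;> ring_nf
  rw [h5]
  ring

variable {a b c d : ℤ} {τ : ℂ}

/-- Multiplied by a Gaussian, θ(κz/j | γτ) has zeros at the lattice points of τ and, up to signs,
the multipliers of θ(κz | τ), so Liouville's theorem applies. The constant need not be known: F is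
homogeneous of degree zero in θ. -/
theorem theta_modular (hdet : a * d - b * c = 1) (hτ : 0 < τ.im) (hj : (c * τ + d : ℂ) ≠ 0)
    (hτ' : 0 < ((a * τ + b) / (c * τ + d)).im) : ∃ C : ℂ, C ≠ 0 ∧ ∀ u,
      theta (u / (c * τ + d)) ((a * τ + b) / (c * τ + d)) =
        C * cexp (c * u ^ 2 / (2 * κ * (c * τ + d))) * theta u τ := by
  set j : ℂ := c * τ + d with hjd
  set τ' := (a * τ + b) / j with hτd
  have hdetC : (a * d - b * c : ℂ) = 1 := by exact_mod_cast hdet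
  have hπ : (Real.pi : ℂ) ≠ 0 := by exact_mod_cast Real.pi_ne_zero
  let f : ℂ → ℂ := fun z => cexp (-(Real.pi * I * c * z ^ 2 / j)) * theta (κ * (z / j)) τ'
  have hf : Differentiable ℂ f := by
    have h : Differentiable ℂ fun z => theta (κ * (z / j)) τ' :=
      (differentiable_theta hτ').comp (by fun_prop : Differentiable ℂ fun z : ℂ => κ * (z / j))
    exact Differentiable.mul (by fun_prop) h
  have hT : Differentiable ℂ fun z => theta (κ * z) τ :=
    (differentiable_theta hτ).comp (by fun_prop : Differentiable ℂ fun z : ℂ => κ * z)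
  have hjτ : j * τ' = a * τ + b := mul_div_cancel₀ _ hj
  -- Determinant one gives 1/j = a - cτ' and τ/j = dτ' - b: division by j maps the lattice of τ to
  -- that of τ'.
  have e1 : ∀ z, (z + 1) / j = z / j + ((-c : ℤ) * τ' + a) := by
    intro z
    field_simp
    push_cast
    linear_combination c * hjτ - hdetC - a * hjd
  have e2 : ∀ z, (z + τ) / j = z / j + ((d : ℤ) * τ' + (-b : ℤ)) := by
    intro z
    field_simp
    push_cast
    linear_combination -d * hjτ - τ * hdetC + b * hjd
  have f1 : ∀ z, f (z + 1) = cexp (Real.pi * I * (-c + a - c * a)) * f z := by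
    intro z
    simp only [f]
    rw [e1, theta_add_lattice, ← mul_assoc, ← mul_assoc, ← Complex.exp_add, ← Complex.exp_add]
    congr 2
    push_cast
    field_simp
    linear_combination -c ^ 2 * hjτ + c * hdetC + c * a * hjd
  have f2 : ∀ z, f (z + τ) = cexp (Real.pi * I * (d - b - b * d) - (Real.pi * I * τ) - κ * z) *
      f z := by
    intro z
    simp only [f]
    rw [e2, theta_add_lattice, ← mul_assoc, ← mul_assoc, ← Complex.exp_add, ← Complex.exp_add]
    congr 2
    push_cast
    field_simp
    linear_combination -d ^ 2 * hjτ - d * τ * hdetC + (b * d + τ + 2 * z) * hjd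
  -- The multipliers agree only up to such signs, which is why the comparison theorem asks for equal
  -- absolute values.
  have hsign : ∀ n : ℤ, ‖cexp (Real.pi * I * n)‖ = 1 := by
    intro n
    have := norm_exp_ofReal_mul_I (Real.pi * n)
    rw [← this]
    congr 2
    push_cast
    ring
  obtain ⟨C, hC⟩ := exists_const_mul_of_quasiPeriodic hf hT (fun z hz => by
    obtain ⟨m, n, rfl⟩ := (theta_eq_zero_iff hτ z).1 hz
    have h0 : deriv (fun z => theta (κ * z) τ) 0 ≠ 0 := by
      rw [deriv_theta_mul τ hτ, mul_zero]
      exact mul_ne_zero kappa_ne_zero (deriv_theta_zero_ne hτ)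
    refine ⟨?_, (deriv_ne_zero_of_quasiPeriodic hT (fun z => theta_add_one z τ)
      (fun z => theta_add_tau z τ) (by simp [theta_zero]) h0 ⟨m, n, rfl⟩).2⟩
    have h1 : ((m * τ + n : ℂ)) / j = ((m * d - n * c : ℤ) : ℂ) * τ' + ((n * a - m * b : ℤ) : ℂ) := by
      field_simp
      push_cast
      linear_combination (n * c - m * d) * hjτ - (m * τ + n) * hdetC + (m * b - n * a) * hjd
    simp only [f]
    rw [h1, theta_lattice, mul_zero]) hτ
    (fun z => ⟨_, -1, by simpa using hsign (-c + a - c * a), by simp, f1 z, by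
      rw [theta_add_one]; ring⟩)
    (fun z => ⟨_, _, by
      rw [show Real.pi * I * (d - b - b * d) - Real.pi * I * τ - κ * z =
        Real.pi * I * (d - b - b * d) + (-(Real.pi * I * τ) - κ * z) by ring, Complex.exp_add,
        norm_mul, norm_neg]
      have := hsign (d - b - b * d)
      push_cast at this
      rw [this, one_mul], neg_ne_zero.2 (exp_ne_zero _), f2 z, theta_add_tau z τ⟩)
  have hmain : ∀ u, theta (u / j) τ' = C * cexp (c * u ^ 2 / (2 * κ * j)) * theta u τ := by
    intro u
    have h := hC (u / κ)
    simp only [f] at h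
    rw [mul_div_cancel₀ _ kappa_ne_zero, div_right_comm, mul_div_cancel₀ _ kappa_ne_zero] at h
    have h3 : -(Real.pi * I * c * (u / κ) ^ 2 / j) = -(c * u ^ 2 / (2 * κ * j)) := by
      field_simp [I_ne_zero]
    rw [h3] at h
    have h4 := exp_ne_zero (c * u ^ 2 / (2 * κ * j))
    rw [exp_neg] at h
    field_simp at h
    rw [h]
    ring
  refine ⟨C, ?_, hmain⟩
  rintro rfl
  obtain ⟨z, hz⟩ := exists_theta_ne_zero hτ'
  have := hmain (z * j)
  rw [mul_div_cancel_right₀ _ hj, zero_mul, zero_mul] at this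
  exact hz this

/-- The Gaussians combine through (x + κz)² - x² - (κz)² = 2κxz, the constants `C` cancel, and the
factor j comes from θ'(0), where the argument of θ is scaled. -/
theorem jacobiF_modular (hdet : a * d - b * c = 1) (hτ : 0 < τ.im) (hj : (c * τ + d : ℂ) ≠ 0)
    (hτ' : 0 < ((a * τ + b) / (c * τ + d)).im) (x z : ℂ) :
    jacobiF (x / (c * τ + d)) (z / (c * τ + d)) ((a * τ + b) / (c * τ + d)) =
      (c * τ + d) * cexp (c * x * z / (c * τ + d)) * jacobiF x z τ := by
  obtain ⟨C, hC, h⟩ := theta_modular hdet hτ hj hτ'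
  set j : ℂ := c * τ + d with hjd
  set τ' := (a * τ + b) / j with hτd
  have hder : deriv (fun w => theta w τ') 0 = j * (C * deriv (fun w => theta w τ) 0) := by
    have h1 := deriv_theta_mul τ' hτ' j⁻¹ 0
    have h2 : (fun u => theta (j⁻¹ * u) τ') =
        fun u => C * cexp (c * u ^ 2 / (2 * κ * j)) * theta u τ :=
      funext fun u => by rw [← h, div_eq_inv_mul]
    rw [h2, mul_zero] at h1
    have h3 : DifferentiableAt ℂ (fun u => C * cexp (c * u ^ 2 / (2 * κ * j))) 0 := by fun_prop
    have h4 := (h3.hasDerivAt.mul (differentiable_theta hτ 0).hasDerivAt).deriv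
    have h5 : deriv (fun u => C * cexp (c * u ^ 2 / (2 * κ * j)) * theta u τ) 0 =
        C * deriv (fun w => theta w τ) 0 := h4.trans (by simp [theta_zero])
    rw [h5] at h1
    rw [h1, mul_inv_cancel_left₀ hj]
  have e1 : x / j + κ * (z / j) = (x + κ * z) / j := by ring
  have e2 : κ * (z / j) = (κ * z) / j := by ring
  rw [jacobiF_def, jacobiF_def, e1, e2, h, h, h, hder]
  have e3 : cexp (c * (x + κ * z) ^ 2 / (2 * κ * j)) = cexp (c * x * z / j) *
      (cexp (c * x ^ 2 / (2 * κ * j)) * cexp (c * (κ * z) ^ 2 / (2 * κ * j))) := by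
    rw [← Complex.exp_add, ← Complex.exp_add]
    congr 1
    have := kappa_ne_zero
    generalize κ = k at *
    field_simp
    ring
  rw [e3]
  have h1 := exp_ne_zero (c * x ^ 2 / (2 * κ * j))
  have h2 := exp_ne_zero (c * (κ * z) ^ 2 / (2 * κ * j))
  set A := cexp (c * x ^ 2 / (2 * κ * j))
  set B := cexp (c * (κ * z) ^ 2 / (2 * κ * j))
  have h3 : C * A * theta x τ * (C * B * theta (κ * z) τ) =
      (C * A * (C * B)) * (theta x τ * theta (κ * z) τ) := by ring
  have h4 : j * (C * deriv (fun w => theta w τ) 0) * (C * (cexp (c * x * z / j) * (A * B)) *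
      theta (x + κ * z) τ) = (C * A * (C * B)) * (j * cexp (c * x * z / j) *
      (deriv (fun w => theta w τ) 0 * theta (x + κ * z) τ)) := by ring
  rw [h3, h4, mul_div_mul_left _ _ (mul_ne_zero (mul_ne_zero hC h1) (mul_ne_zero hC h2))]
  ring

end JacobiForm

/-! ### Expansion of F in x, and its pole in the second variable. -/

section Coefficients

open Complex

attribute [local fun_prop] analyticAt_fst analyticAt_snd

/-- The entire function `θ(x|τ) / x`. -/
noncomputable def thetaQuot (p : ℂ × ℂ) : ℂ := dslope (fun x => theta x p.2) 0 p.1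

theorem mul_thetaQuot (p : ℂ × ℂ) : p.1 * thetaQuot p = theta p.1 p.2 := by
  have := sub_smul_dslope (fun x => theta x p.2) 0 p.1
  rwa [theta_zero, sub_zero, sub_zero, smul_eq_mul] at this

theorem thetaQuot_zero (τ : ℂ) : thetaQuot (0, τ) = deriv (fun x => theta x τ) 0 :=
  dslope_same _ _

theorem analyticAt_thetaQuot {p : ℂ × ℂ} (hp : 0 < p.2.im) : AnalyticAt ℂ thetaQuot p := by
  by_cases h0 : p.1 = 0
  · have := analyticAt_dslope (analyticAt_theta hp)
    rw [h0] at this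
    exact this
  · have h1 : AnalyticAt ℂ (fun p : ℂ × ℂ => theta p.1 p.2 / p.1) p :=
      (analyticAt_theta hp).div analyticAt_fst h0
    refine h1.congr ?_
    filter_upwards [continuousAt_fst.eventually_ne h0] with q hq
    rw [← mul_thetaQuot, mul_div_cancel_left₀ _ hq]

theorem thetaQuot_ne_zero {x τ : ℂ} (hτ : 0 < τ.im) (h : x = 0 ∨ ¬ InLattice τ (x / κ)) :
    thetaQuot (x, τ) ≠ 0 := by
  rcases h with rfl | h
  · rw [thetaQuot_zero]; exact deriv_theta_zero_ne hτ
  · intro h0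
    have := mul_thetaQuot (x, τ)
    rw [h0, mul_zero] at this
    refine h ((theta_eq_zero_iff hτ _).1 ?_)
    rw [mul_div_cancel₀ _ kappa_ne_zero]
    exact this.symm

theorem thetaQuot_kappa_ne_zero {l τ : ℂ} (hτ : 0 < τ.im) (h : l = 0 ∨ ¬ InLattice τ l) :
    thetaQuot (κ * l, τ) ≠ 0 := by
  refine thetaQuot_ne_zero hτ ?_
  rw [mul_div_cancel_left₀ _ kappa_ne_zero]
  refine h.imp (fun h => by rw [h, mul_zero]) id

/-- The function `x l exp(-yx) F(x, l, τ)`, with removable singularities removed. -/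
noncomputable def jacobiD (y x l τ : ℂ) : ℂ :=
  cexp (-y * x) * (thetaQuot (0, τ) * theta (x + κ * l) τ /
    (thetaQuot (x, τ) * thetaQuot (κ * l, τ)))

theorem jacobiD_eq (y x l τ : ℂ) (hx : x ≠ 0) (hl : l ≠ 0) :
    jacobiD y x l τ = x * l * (cexp (-y * x) * jacobiF x l τ) := by
  rw [jacobiD, jacobiF_def, ← thetaQuot_zero, ← mul_thetaQuot (x, τ), ← mul_thetaQuot (κ * l, τ)]
  have := kappa_ne_zero
  dsimp only
  generalize κ = k at *
  generalize thetaQuot (x, τ) = A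
  generalize thetaQuot (k * l, τ) = B
  rw [show x * A * (k * l * B) = (x * l * k) * (A * B) by ring, ← div_div]
  field_simp

theorem analyticAt_jacobiD (y : ℂ) {x l τ : ℂ} (hτ : 0 < τ.im) (hx : x = 0 ∨ ¬ InLattice τ (x / κ))
    (hl : l = 0 ∨ ¬ InLattice τ l) :
    AnalyticAt ℂ (fun p : ℂ × (ℂ × ℂ) => jacobiD y p.1 p.2.1 p.2.2) (x, (l, τ)) := by
  unfold jacobiD
  have h1 : AnalyticAt ℂ (fun p : ℂ × (ℂ × ℂ) => thetaQuot (0, p.2.2)) (x, (l, τ)) :=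
    AnalyticAt.fun_comp (g := thetaQuot) (f := fun p : ℂ × (ℂ × ℂ) => ((0 : ℂ), p.2.2))
      (analyticAt_thetaQuot hτ) (by fun_prop)
  have h2 : AnalyticAt ℂ (fun p : ℂ × (ℂ × ℂ) => theta (p.1 + κ * p.2.1) p.2.2) (x, (l, τ)) :=
    AnalyticAt.fun_comp (g := fun p : ℂ × ℂ => theta p.1 p.2)
      (f := fun p : ℂ × (ℂ × ℂ) => (p.1 + κ * p.2.1, p.2.2))
      (analyticAt_theta hτ) (by fun_prop)
  have h3 : AnalyticAt ℂ (fun p : ℂ × (ℂ × ℂ) => thetaQuot (p.1, p.2.2)) (x, (l, τ)) :=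
    AnalyticAt.fun_comp (g := thetaQuot) (f := fun p : ℂ × (ℂ × ℂ) => (p.1, p.2.2))
      (analyticAt_thetaQuot hτ) (by fun_prop)
  have h4 : AnalyticAt ℂ (fun p : ℂ × (ℂ × ℂ) => thetaQuot (κ * p.2.1, p.2.2)) (x, (l, τ)) :=
    AnalyticAt.fun_comp (g := thetaQuot) (f := fun p : ℂ × (ℂ × ℂ) => (κ * p.2.1, p.2.2))
      (analyticAt_thetaQuot hτ) (by fun_prop)
  refine AnalyticAt.mul (by fun_prop) ((h1.mul h2).div (h3.mul h4) ?_)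
  exact mul_ne_zero (thetaQuot_ne_zero hτ hx) (thetaQuot_kappa_ne_zero hτ hl)

theorem analyticAt_jacobiD_fst (y : ℂ) {x l τ : ℂ} (hτ : 0 < τ.im)
    (hx : x = 0 ∨ ¬ InLattice τ (x / κ)) (hl : l = 0 ∨ ¬ InLattice τ l) :
    AnalyticAt ℂ (fun x => jacobiD y x l τ) x :=
  AnalyticAt.fun_comp (g := fun p : ℂ × (ℂ × ℂ) => jacobiD y p.1 p.2.1 p.2.2)
    (f := fun x : ℂ => (x, (l, τ))) (analyticAt_jacobiD y hτ hx hl) (by fun_prop)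

/-- The coefficient of `x ^ k` of `jacobiD`. -/
noncomputable def dCoef (y : ℂ) (k : ℕ) (p : ℂ × ℂ) : ℂ :=
  PowerSeries.coeff k (taylorSer fun x => jacobiD y x p.1 p.2)

theorem analyticAt_dCoef (y : ℂ) (k : ℕ) {l τ : ℂ} (hτ : 0 < τ.im) (hl : l = 0 ∨ ¬ InLattice τ l) :
    AnalyticAt ℂ (dCoef y k) (l, τ) := by
  have h := analyticAt_iteratedDeriv_fst k (analyticAt_jacobiD y hτ (Or.inl rfl) hl)
  have h2 := h.mul (analyticAt_const (v := (k.factorial : ℂ)⁻¹))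
  refine h2.congr (Filter.Eventually.of_forall fun p => ?_)
  simp [dCoef, taylorSer, div_eq_mul_inv]

theorem jacobiD_zero_right (y : ℂ) {τ : ℂ} (hτ : 0 < τ.im) {x : ℂ}
    (hx : x = 0 ∨ ¬ InLattice τ (x / κ)) : jacobiD y x 0 τ = cexp (-y * x) * x := by
  have h1 := thetaQuot_ne_zero hτ hx
  have h2 := thetaQuot_ne_zero hτ (Or.inl (rfl : (0 : ℂ) = 0))
  rw [jacobiD, mul_zero, add_zero, ← mul_thetaQuot (x, τ)]
  dsimp only
  field_simp

theorem eventually_not_inLattice {τ : ℂ} (hτ : 0 < τ.im) :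
    ∀ᶠ x in 𝓝 (0 : ℂ), x = 0 ∨ ¬ InLattice τ (x / κ) := by
  have h : ContinuousAt (fun x => thetaQuot (x, τ)) 0 :=
    ContinuousAt.comp (g := thetaQuot) (f := fun x : ℂ => (x, τ))
      (analyticAt_thetaQuot (p := (0, τ)) hτ).continuousAt (by fun_prop)
  filter_upwards [h.eventually_ne (thetaQuot_ne_zero hτ (Or.inl rfl))] with x hx
  by_cases h0 : x = 0
  · exact Or.inl h0
  · right
    intro h1
    have h2 := (theta_eq_zero_iff hτ _).2 h1
    rw [mul_div_cancel₀ _ kappa_ne_zero] at h2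
    have := mul_thetaQuot (x, τ)
    rw [h2] at this
    exact mul_ne_zero h0 hx this

/-- At l = 0 the function x l exp(-yx)F reduces to x exp(-yx). These values are the residues of the
Taylor coefficients of h_α along a torsion section. -/
theorem dCoef_succ_zero (y : ℂ) (k : ℕ) {τ : ℂ} (hτ : 0 < τ.im) :
    dCoef y (k + 1) (0, τ) = (-y) ^ k / k.factorial := by
  have h1 : taylorSer (fun x => jacobiD y x 0 τ) =
      PowerSeries.rescale (-y) (PowerSeries.exp ℂ) * PowerSeries.X := by
    rw [← taylorSer_exp, ← taylorSer_id, ← taylorSer_mul (g := fun x => x) (by fun_prop)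
      analyticAt_id]
    refine taylorSer_congr ?_
    filter_upwards [eventually_not_inLattice hτ] with x hx
    exact jacobiD_zero_right y hτ hx
  rw [dCoef, h1, PowerSeries.coeff_succ_mul_X, PowerSeries.coeff_rescale, PowerSeries.coeff_exp]
  simp [div_eq_mul_inv]

/-- Divided by l this is κ, exactly what the term 2πi/x in h_α removes. -/
theorem dCoef_zero (y : ℂ) {l τ : ℂ} (hτ : 0 < τ.im) (hl : l = 0 ∨ ¬ InLattice τ l) :
    dCoef y 0 (l, τ) = κ * l := by
  have h1 := thetaQuot_kappa_ne_zero hτ hl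
  have h2 := thetaQuot_ne_zero hτ (Or.inl (rfl : (0 : ℂ) = 0))
  simp only [dCoef, taylorSer, PowerSeries.coeff_mk, iteratedDeriv_zero, Nat.factorial_zero,
    Nat.cast_one, div_one, jacobiD, mul_zero, Complex.exp_zero, one_mul, zero_add]
  rw [← mul_thetaQuot (κ * l, τ)]
  dsimp only
  field_simp

/-- The function `exp(-yx) F(x, l, τ) - 2πi/x`. -/
noncomputable def hGen (y x l τ : ℂ) : ℂ := cexp (-y * x) * jacobiF x l τ - κ / x

/-- A lattice translation is absorbed into y. Hence every h_α with a pole along z = a/N + (b/N)τ can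
be rewritten with y = b/N and l = z - a/N - (b/N)τ. -/
theorem hGen_add_lattice (y x l τ : ℂ) (m n : ℤ) :
    hGen y x (l + (m * τ + n)) τ = hGen (y + m) x l τ := by
  rw [hGen, jacobiF_add_lattice, ← mul_assoc, ← Complex.exp_add, hGen]
  congr 3
  ring

theorem ne_zero_of_not_inLattice {l τ : ℂ} (h : ¬ InLattice τ l) : l ≠ 0 := by
  rintro rfl
  exact h ⟨0, 0, by simp⟩

theorem hasSer_hGen (y : ℂ) {l τ : ℂ} (hτ : 0 < τ.im) (hl : ¬ InLattice τ l) :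
    HasSer (fun x => hGen y x l τ) (PowerSeries.mk fun k => dCoef y (k + 1) (l, τ) / l) := by
  have hl0 := ne_zero_of_not_inLattice hl
  refine HasSer.of_X_mul ?_
  have h1 : HasSer (fun x => jacobiD y x l τ) (taylorSer fun x => jacobiD y x l τ) :=
    AnalyticAt.hasSer (analyticAt_jacobiD_fst y hτ (Or.inl rfl) (Or.inr hl))
  have h2 := ((hasSer_const l⁻¹).mul h1).sub (hasSer_const κ)
  have h3 : PowerSeries.C l⁻¹ * (taylorSer fun x => jacobiD y x l τ) - PowerSeries.C κ =
      PowerSeries.X * PowerSeries.mk fun k => dCoef y (k + 1) (l, τ) / l := by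
    ext k
    rw [map_sub, PowerSeries.coeff_C_mul]
    rcases k with _ | k
    · have := dCoef_zero y hτ (Or.inr hl)
      rw [dCoef] at this
      rw [PowerSeries.coeff_zero_X_mul, this, PowerSeries.coeff_C, if_pos rfl]
      field_simp
      ring
    · rw [PowerSeries.coeff_succ_X_mul, PowerSeries.coeff_mk, PowerSeries.coeff_C,
        if_neg k.succ_ne_zero, sub_zero, div_eq_inv_mul, dCoef]
  rw [h3] at h2
  refine h2.congr ?_
  filter_upwards [self_mem_nhdsWithin] with x hx
  have hx0 : x ≠ 0 := hx
  rw [jacobiD_eq y x l τ hx0 hl0, hGen]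
  field_simp

/-- The regular part of a coefficient near `l = 0`. -/
noncomputable def dReg (y : ℂ) (k : ℕ) (p : ℂ × ℂ) : ℂ :=
  dslope (fun l => dCoef y k (l, p.2)) 0 p.1

theorem analyticAt_dReg (y : ℂ) (k : ℕ) {τ : ℂ} (hτ : 0 < τ.im) :
    AnalyticAt ℂ (dReg y k) (0, τ) :=
  analyticAt_dslope (f := dCoef y k) (p := (0, τ)) (analyticAt_dCoef y k hτ (Or.inl rfl))

theorem dCoef_div_eq (y : ℂ) (k : ℕ) {l τ : ℂ} (hl : l ≠ 0) :
    dCoef y k (l, τ) / l = dCoef y k (0, τ) / l + dReg y k (l, τ) := by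
  have h := sub_smul_dslope (fun l => dCoef y k (l, τ)) 0 l
  rw [sub_zero, smul_eq_mul] at h
  rw [dReg]
  field_simp
  linear_combination -h

theorem tendsto_dCoef_div (y : ℂ) (k : ℕ) {τ : ℂ} (hτ : 0 < τ.im) (h0 : dCoef y k (0, τ) = 0) :
    Filter.Tendsto (fun l => dCoef y k (l, τ) / l) (𝓝[≠] 0) (𝓝 (dReg y k (0, τ))) := by
  have h : ContinuousAt (fun l => dReg y k (l, τ)) 0 :=
    ContinuousAt.comp (g := dReg y k) (f := fun l : ℂ => (l, τ))
      (analyticAt_dReg y k hτ).continuousAt (by fun_prop)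
  refine (h.tendsto.mono_left nhdsWithin_le_nhds).congr' ?_
  filter_upwards [self_mem_nhdsWithin] with l hl
  rw [dCoef_div_eq y k hl, h0, zero_div, zero_add]

theorem analyticAt_hGen (y : ℂ) {x l τ : ℂ} (hτ : 0 < τ.im) (hx0 : x ≠ 0)
    (hx : ¬ InLattice τ (x / κ)) (hl : ¬ InLattice τ l) :
    AnalyticAt ℂ (fun p : ℂ × ℂ => hGen y p.1 p.2 τ) (x, l) := by
  have hl0 := ne_zero_of_not_inLattice hl
  have h1 : AnalyticAt ℂ (fun p : ℂ × ℂ => jacobiD y p.1 p.2 τ) (x, l) :=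
    AnalyticAt.fun_comp (g := fun p : ℂ × (ℂ × ℂ) => jacobiD y p.1 p.2.1 p.2.2)
      (f := fun p : ℂ × ℂ => (p.1, (p.2, τ))) (analyticAt_jacobiD y hτ (Or.inr hx) (Or.inr hl))
      (by fun_prop)
  have h2 : AnalyticAt ℂ (fun p : ℂ × ℂ => jacobiD y p.1 p.2 τ / (p.1 * p.2) - κ / p.1) (x, l) :=
    (h1.div (analyticAt_fst.mul analyticAt_snd) (mul_ne_zero hx0 hl0)).sub
      (analyticAt_const.div analyticAt_fst hx0)
  refine h2.congr ?_
  filter_upwards [continuousAt_fst.eventually_ne hx0, continuousAt_snd.eventually_ne hl0]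
    with p hp1 hp2
  rw [jacobiD_eq y _ _ τ hp1 hp2, hGen, mul_div_cancel_left₀ _ (mul_ne_zero hp1 hp2)]

theorem eventually_good {τ : ℂ} (hτ : 0 < τ.im) :
    ∀ᶠ x in 𝓝[≠] (0 : ℂ), x ≠ 0 ∧ ¬ InLattice τ (x / κ) := by
  filter_upwards [(eventually_not_inLattice hτ).filter_mono nhdsWithin_le_nhds,
    self_mem_nhdsWithin] with x hx h0
  exact ⟨h0, hx.resolve_left h0⟩

/-- The limit at `l₀` of the `x`-derivative of `hGen` at a point that is not a pole. -/
theorem limUnder_deriv_hGen (y l₀ : ℂ) {x τ : ℂ} (hτ : 0 < τ.im) (hx0 : x ≠ 0)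
    (hx : ¬ InLattice τ (x / κ)) (hl : ¬ InLattice τ l₀) :
    Filter.limUnder (𝓝[≠] 0) (fun z => deriv (fun x => hGen y x (z + l₀) τ) x) =
      deriv (fun x => hGen y x l₀ τ) x := by
  have h := analyticAt_iteratedDeriv_fst 1 (analyticAt_hGen y hτ hx0 hx hl)
  simp only [iteratedDeriv_one] at h
  have h2 : Filter.Tendsto (fun z : ℂ => z + l₀) (𝓝[≠] 0) (𝓝 l₀) := by
    have : Filter.Tendsto (fun z : ℂ => z + l₀) (𝓝 0) (𝓝 (0 + l₀)) :=
      (continuous_add_const l₀).tendsto 0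
    rw [zero_add] at this
    exact this.mono_left nhdsWithin_le_nhds
  exact (h.continuousAt.tendsto.comp h2).limUnder_eq

theorem hasSer_limUnder_regular (y l₀ : ℂ) {τ : ℂ} (hτ : 0 < τ.im) (hl : ¬ InLattice τ l₀) :
    HasSer (fun x => Filter.limUnder (𝓝[≠] 0) (fun z => deriv (fun x => hGen y x (z + l₀) τ) x))
      (PowerSeries.derivative ℂ (PowerSeries.mk fun k => dCoef y (k + 1) (l₀, τ) / l₀)) := by
  refine (hasSer_hGen y hτ hl).deriv.congr ?_
  filter_upwards [eventually_good hτ] with x hx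
  exact (limUnder_deriv_hGen y l₀ hτ hx.1 hx.2 hl).symm

/-- The difference quotient of `jacobiD` in the variable `l`. -/
noncomputable def jacobiDReg (τ : ℂ) (p : ℂ × ℂ) : ℂ := dslope (fun l => jacobiD 0 p.1 l τ) 0 p.2

theorem jacobiD_eq_add {x τ : ℂ} (hτ : 0 < τ.im) (hx : x = 0 ∨ ¬ InLattice τ (x / κ)) (l : ℂ) :
    jacobiD 0 x l τ = x + l * jacobiDReg τ (x, l) := by
  have h := sub_smul_dslope (fun l => jacobiD 0 x l τ) 0 l
  rw [sub_zero, smul_eq_mul, jacobiD_zero_right 0 hτ hx] at h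
  rw [jacobiDReg]
  simp at h
  linear_combination -h

theorem analyticAt_jacobiDReg {x τ : ℂ} (hτ : 0 < τ.im) (hx : x = 0 ∨ ¬ InLattice τ (x / κ)) :
    AnalyticAt ℂ (jacobiDReg τ) (x, 0) := by
  have h1 : AnalyticAt ℂ (fun p : ℂ × ℂ => jacobiD 0 p.2 p.1 τ) (0, x) :=
    AnalyticAt.fun_comp (g := fun p : ℂ × (ℂ × ℂ) => jacobiD 0 p.1 p.2.1 p.2.2)
      (f := fun p : ℂ × ℂ => (p.2, (p.1, τ))) (analyticAt_jacobiD 0 hτ hx (Or.inl rfl))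
      (by fun_prop)
  exact AnalyticAt.fun_comp (f := fun p : ℂ × ℂ => (p.2, p.1)) (x := (x, (0 : ℂ)))
    (analyticAt_dslope h1) (by fun_prop)

/-- Two operations are interchanged, division by l after subtraction of the value at l = 0 and
extraction of a coefficient in x. For l ≠ 0 this is algebra; both sides are continuous in l, which
gives l = 0. -/
theorem coeff_jacobiDReg {τ : ℂ} (hτ : 0 < τ.im) (k : ℕ) :
    PowerSeries.coeff k (taylorSer fun x => jacobiDReg τ (x, 0)) = dReg 0 k (0, τ) := by
  have han := analyticAt_jacobiDReg hτ (Or.inl (rfl : (0 : ℂ) = 0))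
  have h1 : ContinuousAt (fun l => PowerSeries.coeff k (taylorSer fun x => jacobiDReg τ (x, l))) 0 := by
    have h := (analyticAt_iteratedDeriv_fst k han).mul
      (analyticAt_const (v := (k.factorial : ℂ)⁻¹))
    refine h.continuousAt.congr (Filter.Eventually.of_forall fun p => ?_)
    simp [taylorSer, div_eq_mul_inv]
  have h2 : ContinuousAt (fun l => dReg 0 k (l, τ)) 0 :=
    ContinuousAt.comp (g := dReg 0 k) (f := fun l : ℂ => (l, τ))
      (analyticAt_dReg 0 k hτ).continuousAt (by fun_prop)
  refine tendsto_nhds_unique_of_eventuallyEq (h1.tendsto.mono_left nhdsWithin_le_nhds)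
    (h2.tendsto.mono_left (nhdsWithin_le_nhds (s := {0}ᶜ))) ?_
  have h3 : ∀ᶠ l in 𝓝 (0 : ℂ), AnalyticAt ℂ (jacobiDReg τ) (0, l) := by
    have : Filter.Tendsto (fun l : ℂ => ((0 : ℂ), l)) (𝓝 0) (𝓝 (0, 0)) :=
      Continuous.tendsto' (by fun_prop) _ _ rfl
    exact this.eventually han.eventually_analyticAt
  have h4 : ∀ l, AnalyticAt ℂ (jacobiDReg τ) (0, l) → dCoef 0 k (l, τ) =
      PowerSeries.coeff k PowerSeries.X +
        l * PowerSeries.coeff k (taylorSer fun x => jacobiDReg τ (x, l)) := by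
    intro l hl
    have hl' : AnalyticAt ℂ (fun x => jacobiDReg τ (x, l)) 0 :=
      AnalyticAt.fun_comp (g := jacobiDReg τ) (f := fun x : ℂ => (x, l)) hl (by fun_prop)
    have h5 : taylorSer (fun x => jacobiD 0 x l τ) =
        PowerSeries.X + PowerSeries.C l * taylorSer (fun x => jacobiDReg τ (x, l)) := by
      rw [← taylorSer_id, ← taylorSer_const, ← taylorSer_mul (f := fun _ => l) analyticAt_const hl',
        ← taylorSer_add (f := fun x => x) analyticAt_id (analyticAt_const.mul hl')]
      refine taylorSer_congr ?_
      filter_upwards [eventually_not_inLattice hτ] with x hx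
      exact jacobiD_eq_add hτ hx l
    rw [dCoef, h5, map_add, PowerSeries.coeff_C_mul]
  have h0 : dCoef 0 k (0, τ) = PowerSeries.coeff k PowerSeries.X := by
    rw [h4 0 han, zero_mul, add_zero]
  filter_upwards [h3.filter_mono nhdsWithin_le_nhds, self_mem_nhdsWithin] with l hl hl0
  have hl0' : l ≠ 0 := hl0
  have h5 := h4 l hl
  have h6 := dCoef_div_eq 0 k (τ := τ) hl0'
  rw [h5, h0, add_div, add_right_inj, mul_div_cancel_left₀ _ hl0'] at h6
  exact h6

/-- For y = 0 the residue at z = 0 is the constant 1: h = 1/z + (`jacobiDReg` - κ)/x. The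
x-derivative kills the pole, so the limit exists. -/
theorem hasSer_limUnder_pole {τ : ℂ} (hτ : 0 < τ.im) :
    HasSer (fun x => Filter.limUnder (𝓝[≠] 0) (fun z => deriv (fun x => hGen 0 x z τ) x))
      (PowerSeries.derivative ℂ (PowerSeries.mk fun k => dReg 0 (k + 1) (0, τ))) := by
  have h1 : HasSer (fun x => jacobiDReg τ (x, 0)) (taylorSer fun x => jacobiDReg τ (x, 0)) := by
    refine AnalyticAt.hasSer (AnalyticAt.fun_comp (g := jacobiDReg τ)
      (f := fun x : ℂ => (x, (0 : ℂ))) (analyticAt_jacobiDReg hτ (Or.inl rfl)) (by fun_prop))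
  have hz : dReg 0 0 (0, τ) = κ := by
    have h : HasDerivAt (fun l : ℂ => κ * l) κ 0 := by
      simpa using (hasDerivAt_id (0 : ℂ)).const_mul κ
    rw [dReg, dslope_same]
    refine (h.congr_of_eventuallyEq ?_).deriv
    have hev := eventually_not_inLattice hτ
    have h3 : Filter.Tendsto (fun l : ℂ => κ * l) (𝓝 0) (𝓝 0) :=
      Continuous.tendsto' (by fun_prop) _ _ (by simp)
    filter_upwards [h3.eventually hev] with l hl
    refine dCoef_zero 0 hτ ?_
    rw [mul_div_cancel_left₀ _ kappa_ne_zero] at hl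
    exact hl.imp_left fun h => (mul_eq_zero.1 h).resolve_left kappa_ne_zero
  have h2 : HasSer (fun x => (jacobiDReg τ (x, 0) - κ) / x)
      (PowerSeries.mk fun k => dReg 0 (k + 1) (0, τ)) := by
    refine HasSer.of_X_mul ?_
    have h3 := h1.sub (hasSer_const κ)
    have h4 : (taylorSer fun x => jacobiDReg τ (x, 0)) - PowerSeries.C κ =
        PowerSeries.X * PowerSeries.mk fun k => dReg 0 (k + 1) (0, τ) := by
      ext k
      rw [map_sub, coeff_jacobiDReg hτ]
      rcases k with _ | k
      · rw [PowerSeries.coeff_zero_X_mul, hz, PowerSeries.coeff_C, if_pos rfl, sub_self]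
      · rw [PowerSeries.coeff_succ_X_mul, PowerSeries.coeff_mk, PowerSeries.coeff_C,
          if_neg k.succ_ne_zero, sub_zero]
    rw [h4] at h3
    refine h3.congr ?_
    filter_upwards [self_mem_nhdsWithin] with x hx
    have hx0 : x ≠ 0 := hx
    field_simp
  refine h2.deriv.congr ?_
  filter_upwards [eventually_good hτ] with x hx
  symm
  refine Filter.Tendsto.limUnder_eq ?_
  have han := analyticAt_jacobiDReg hτ (Or.inr hx.2)
  have h3 : AnalyticAt ℂ (fun p : ℂ × ℂ => (jacobiDReg τ p - κ) / p.1) (x, 0) :=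
    (han.sub analyticAt_const).div analyticAt_fst hx.1
  have h4 := analyticAt_iteratedDeriv_fst 1 h3
  simp only [iteratedDeriv_one] at h4
  refine (h4.continuousAt.tendsto.mono_left (nhdsWithin_le_nhds (s := {0}ᶜ))).congr' ?_
  filter_upwards [self_mem_nhdsWithin] with z hz0
  have hz' : z ≠ 0 := hz0
  have h5 : (fun x => hGen 0 x z τ) =ᶠ[𝓝 x] fun x => 1 / z + (jacobiDReg τ (x, z) - κ) / x := by
    have hD : ContinuousAt (fun x => thetaQuot (x, τ)) x :=
      ContinuousAt.comp (g := thetaQuot) (f := fun x : ℂ => (x, τ))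
        (analyticAt_thetaQuot (p := (x, τ)) hτ).continuousAt (by fun_prop)
    filter_upwards [isOpen_ne.mem_nhds hx.1,
      hD.eventually_ne (thetaQuot_ne_zero hτ (Or.inr hx.2))] with u hu hu'
    have hu0 : u ≠ 0 := hu
    have hgood : u = 0 ∨ ¬ InLattice τ (u / κ) := by
      right
      intro h1
      have h2 := (theta_eq_zero_iff hτ _).2 h1
      rw [mul_div_cancel₀ _ kappa_ne_zero] at h2
      have := mul_thetaQuot (u, τ)
      rw [h2] at this
      exact mul_ne_zero hu0 hu' this
    have h6 := jacobiD_eq 0 u z τ hu0 hz'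
    rw [jacobiD_eq_add hτ hgood] at h6
    rw [hGen]
    generalize cexp (-0 * u) * jacobiF u z τ = G at *
    generalize κ = k at *
    field_simp
    linear_combination -h6
  rw [h5.deriv_eq, deriv_const_add]

end Coefficients

/-! ### The coefficients of h_α and g_α and the functions A_{m,α}: holomorphy, residues and limits.
-/

section Coefficients

open Complex

attribute [local fun_prop] analyticAt_fst analyticAt_snd

variable {N : ℕ}

/-- The torsion section with index `α`. -/
noncomputable def torsionPt (α : ZMod N × ZMod N) (τ : ℂ) : ℂ :=
  coordLift α.1 + coordLift α.2 * τ

theorem hFun_eq (α : ZMod N × ZMod N) (x z τ : ℂ) :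
    hFun α x z τ = hGen (coordLift α.2) x (z - torsionPt α τ) τ := rfl

theorem gFun_eq (α : ZMod N × ZMod N) (x z τ : ℂ) :
    gFun α x z τ = deriv (fun x => hGen (coordLift α.2) x (z - torsionPt α τ) τ) x := rfl

/-- The Taylor series of `h_α` in `x`. -/
noncomputable def hSer (α : ZMod N × ZMod N) (z τ : ℂ) : PowerSeries ℂ :=
  PowerSeries.mk (taylorCoeff fun s => hFun α s z τ)

/-- The Taylor series of `g_α` in `x`. -/
noncomputable def gSer (α : ZMod N × ZMod N) (z τ : ℂ) : PowerSeries ℂ :=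
  PowerSeries.mk (taylorCoeff fun s => gFun α s z τ)

variable {α : ZMod N × ZMod N} {z τ : ℂ}

theorem hSer_eq (hτ : 0 < τ.im) (hl : ¬ InLattice τ (z - torsionPt α τ)) : hSer α z τ =
    PowerSeries.mk fun k => dCoef (coordLift α.2) (k + 1) (z - torsionPt α τ, τ) /
      (z - torsionPt α τ) :=
  (hasSer_hGen (coordLift α.2) hτ hl).mk_taylorCoeff

theorem hasSer_hFun (hτ : 0 < τ.im) (hl : ¬ InLattice τ (z - torsionPt α τ)) :
    HasSer (fun s => hFun α s z τ) (hSer α z τ) := by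
  rw [hSer_eq hτ hl]
  exact hasSer_hGen (coordLift α.2) hτ hl

theorem gSer_eq (hτ : 0 < τ.im) (hl : ¬ InLattice τ (z - torsionPt α τ)) :
    gSer α z τ = PowerSeries.derivative ℂ (hSer α z τ) :=
  (hasSer_hFun hτ hl).deriv.mk_taylorCoeff

theorem coeff_gSer (hτ : 0 < τ.im) (hl : ¬ InLattice τ (z - torsionPt α τ)) (k : ℕ) :
    PowerSeries.coeff k (gSer α z τ) = PowerSeries.coeff (k + 1) (hSer α z τ) * (k + 1) := by
  rw [gSer_eq hτ hl, PowerSeries.coeff_derivative]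

/-- Lying off the lattice means that θ does not vanish, which is an open condition in both
variables. -/
theorem eventually_not_inLattice_of_not {l τ : ℂ} (hτ : 0 < τ.im) (hl : ¬ InLattice τ l) :
    ∀ᶠ p : ℂ × ℂ in 𝓝 (l, τ), 0 < p.2.im ∧ ¬ InLattice p.2 p.1 := by
  have h : ContinuousAt (fun p : ℂ × ℂ => theta (κ * p.1) p.2) (l, τ) :=
    ContinuousAt.comp (g := fun p : ℂ × ℂ => theta p.1 p.2)
      (f := fun p : ℂ × ℂ => (κ * p.1, p.2)) (analyticAt_theta hτ).continuousAt (by fun_prop)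
  filter_upwards [eventually_im_pos (p := (l, τ)) hτ,
    h.eventually_ne fun h0 => hl ((theta_eq_zero_iff hτ l).1 h0)] with p hp h0
  exact ⟨hp, fun h1 => h0 ((theta_eq_zero_iff hp _).2 h1)⟩

/-- Near (0, τ) the only lattice point is 0, because θ(x)/x does not vanish there. -/
theorem eventually_not_inLattice_zero {τ : ℂ} (hτ : 0 < τ.im) :
    ∀ᶠ p : ℂ × ℂ in 𝓝 (0, τ), 0 < p.2.im ∧ (p.1 = 0 ∨ ¬ InLattice p.2 p.1) := by
  have h : ContinuousAt (fun p : ℂ × ℂ => thetaQuot (κ * p.1, p.2)) (0, τ) :=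
    ContinuousAt.comp (g := thetaQuot)
      (f := fun p : ℂ × ℂ => (κ * p.1, p.2)) (analyticAt_thetaQuot hτ).continuousAt (by fun_prop)
  filter_upwards [eventually_im_pos (p := (0, τ)) hτ,
    h.eventually_ne (thetaQuot_kappa_ne_zero hτ (Or.inl rfl))] with p hp h0
  refine ⟨hp, ?_⟩
  by_cases hp0 : p.1 = 0
  · exact Or.inl hp0
  · right
    intro h1
    have h2 := (theta_eq_zero_iff hp _).2 h1
    have := mul_thetaQuot (κ * p.1, p.2)
    rw [h2] at this
    exact mul_ne_zero (mul_ne_zero kappa_ne_zero hp0) h0 this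

theorem analyticAt_torsionPt (α : ZMod N × ZMod N) (w : ℂ × ℂ) :
    AnalyticAt ℂ (fun w : ℂ × ℂ => (w.2 - torsionPt α w.1, w.1)) w := by
  unfold torsionPt
  fun_prop

theorem analyticAt_coeff_hSer {w : ℂ × ℂ} (hτ : 0 < w.1.im)
    (hl : ¬ InLattice w.1 (w.2 - torsionPt α w.1)) (k : ℕ) :
    AnalyticAt ℂ (fun w : ℂ × ℂ => PowerSeries.coeff k (hSer α w.2 w.1)) w := by
  have h1 : AnalyticAt ℂ (fun p : ℂ × ℂ => dCoef (coordLift α.2) (k + 1) p / p.1)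
      (w.2 - torsionPt α w.1, w.1) :=
    (analyticAt_dCoef _ _ hτ (Or.inr hl)).div analyticAt_fst (ne_zero_of_not_inLattice hl)
  have h2 := analyticAt_torsionPt α w
  refine (AnalyticAt.fun_comp (f := fun w : ℂ × ℂ => (w.2 - torsionPt α w.1, w.1)) h1 h2).congr ?_
  filter_upwards [h2.continuousAt.eventually (eventually_not_inLattice_of_not hτ hl)] with v hv
  rw [hSer_eq hv.1 hv.2, PowerSeries.coeff_mk]

theorem eventually_coeff_gSer {w : ℂ × ℂ} (hτ : 0 < w.1.im)
    (hl : ¬ InLattice w.1 (w.2 - torsionPt α w.1)) (k : ℕ) :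
    ∀ᶠ v : ℂ × ℂ in 𝓝 w, PowerSeries.coeff k (gSer α v.2 v.1) =
      PowerSeries.coeff (k + 1) (hSer α v.2 v.1) * (k + 1) := by
  filter_upwards [(analyticAt_torsionPt α w).continuousAt.eventually
    (eventually_not_inLattice_of_not hτ hl)] with v hv
  exact coeff_gSer hv.1 hv.2 k

theorem analyticAt_coeff_gSer {w : ℂ × ℂ} (hτ : 0 < w.1.im)
    (hl : ¬ InLattice w.1 (w.2 - torsionPt α w.1)) (k : ℕ) :
    AnalyticAt ℂ (fun w : ℂ × ℂ => PowerSeries.coeff k (gSer α w.2 w.1)) w :=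
  ((analyticAt_coeff_hSer hτ hl (k + 1)).mul analyticAt_const).congr
    ((eventually_coeff_gSer hτ hl k).mono fun _ h => h.symm)

theorem coordLift_eq (k : ZMod N) : (coordLift k : ℂ) = (((k.val : ℝ) / N : ℝ) : ℂ) := by
  rw [coordLift]; push_cast; rfl

theorem eq_of_add_mul_eq {τ : ℂ} (hτ : 0 < τ.im) {a b c d : ℝ} (h : (a + b * τ : ℂ) = c + d * τ) :
    a = c ∧ b = d := by
  have h1 := congrArg Complex.im h
  have h2 := congrArg Complex.re h
  simp at h1 h2
  rcases h1 with h1 | h1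
  · subst h1
    exact ⟨by linarith, rfl⟩
  · exact absurd h1 hτ.ne'

/-- Near a torsion section the Taylor coefficients of `h_α` and `g_α` have simple poles with the
indicated residues. -/
theorem exists_pole_hSer [NeZero N] {w : ℂ × ℂ} (hτ : 0 < w.1.im) (a b : ℤ)
    (hw : w.2 = (a : ℂ) / N + (b : ℂ) / N * w.1) (α : ZMod N × ZMod N) :
    ∃ ρ : ℂ, ∀ k : ℕ, ∃ q : ℂ × ℂ → ℂ, AnalyticAt ℂ q w ∧ ∀ᶠ v : ℂ × ℂ in 𝓝 w,
      v.2 - (a : ℂ) / N - (b : ℂ) / N * v.1 ≠ 0 →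
        PowerSeries.coeff k (hSer α v.2 v.1) = ρ * ((-((b : ℂ) / N)) ^ k / k.factorial) /
          (v.2 - (a : ℂ) / N - (b : ℂ) / N * v.1) + q v ∧
        PowerSeries.coeff k (gSer α v.2 v.1) =
          PowerSeries.coeff (k + 1) (hSer α v.2 v.1) * (k + 1) := by
  -- Either the given section is a lattice translate of the section α, and the residue factor is 1,
  -- or h_α is regular at `w` and it is 0.
  by_cases hl : InLattice w.1 (w.2 - torsionPt α w.1)
  · obtain ⟨m, n, hmn⟩ := hl
    have hcoef : (a : ℂ) / N = coordLift α.1 + n ∧ (b : ℂ) / N = coordLift α.2 + m := by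
      rw [coordLift_eq, coordLift_eq]
      -- All coefficients are real, and 1, τ are independent over ℝ, so an equality at the single
      -- point `w` identifies the two sections for all τ.
      have h1 : ((((a : ℝ) / N : ℝ) : ℂ) + (((b : ℝ) / N : ℝ) : ℂ) * w.1) =
          (((α.1.val : ℝ) / N + n : ℝ) : ℂ) + (((α.2.val : ℝ) / N + m : ℝ) : ℂ) * w.1 := by
        rw [hw, torsionPt, coordLift_eq, coordLift_eq] at hmn
        push_cast at hmn ⊢
        linear_combination hmn
      obtain ⟨h2, h3⟩ := eq_of_add_mul_eq hτ h1
      have h2' := congrArg (fun x : ℝ => (x : ℂ)) h2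
      have h3' := congrArg (fun x : ℝ => (x : ℂ)) h3
      push_cast at h2' h3' ⊢
      exact ⟨h2', h3'⟩
    obtain ⟨hc1, hc2⟩ := hcoef
    have hshift : ∀ v : ℂ × ℂ, v.2 - torsionPt α v.1 =
        (v.2 - (a : ℂ) / N - (b : ℂ) / N * v.1) + (m * v.1 + n) := by
      intro v
      rw [torsionPt, hc1, hc2]
      ring
    have hfun : ∀ v : ℂ × ℂ, (fun s => hFun α s v.2 v.1) = fun s =>
        hGen ((b : ℂ) / N) s (v.2 - (a : ℂ) / N - (b : ℂ) / N * v.1) v.1 := by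
      intro v
      funext s
      rw [hFun_eq, hshift, hGen_add_lattice, hc2]
    have hL : AnalyticAt ℂ (fun v : ℂ × ℂ => (v.2 - (a : ℂ) / N - (b : ℂ) / N * v.1, v.1)) w := by
      fun_prop
    have hL0 : (w.2 - (a : ℂ) / N - (b : ℂ) / N * w.1, w.1) = ((0 : ℂ), w.1) := by
      rw [hw]; congr 1; ring
    have hLt : Filter.Tendsto (fun v : ℂ × ℂ => (v.2 - (a : ℂ) / N - (b : ℂ) / N * v.1, v.1))
        (𝓝 w) (𝓝 (0, w.1)) := hL0 ▸ hL.continuousAt.tendsto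
    have hev := hLt.eventually (eventually_not_inLattice_zero hτ)
    refine ⟨1, fun k => ⟨fun v => dReg ((b : ℂ) / N) (k + 1)
      (v.2 - (a : ℂ) / N - (b : ℂ) / N * v.1, v.1), ?_, ?_⟩⟩
    · refine AnalyticAt.fun_comp (g := dReg ((b : ℂ) / N) (k + 1)) ?_ hL
      rw [hL0]
      exact analyticAt_dReg _ _ hτ
    · filter_upwards [hev] with v hv hne
      have hv' := hv.2.resolve_left hne
      have hs := hasSer_hGen ((b : ℂ) / N) hv.1 hv'
      constructor
      · rw [hSer, hfun, hs.mk_taylorCoeff, PowerSeries.coeff_mk, dCoef_div_eq _ _ hne,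
          dCoef_succ_zero _ _ hv.1, one_mul]
      · have h1 : gSer α v.2 v.1 = PowerSeries.mk (taylorCoeff (deriv fun s => hFun α s v.2 v.1)) :=
          rfl
        rw [h1, hSer, hfun, hs.deriv.mk_taylorCoeff, hs.mk_taylorCoeff, PowerSeries.coeff_derivative]
  · refine ⟨0, fun k => ⟨_, analyticAt_coeff_hSer hτ hl k, ?_⟩⟩
    filter_upwards [eventually_coeff_gSer hτ hl k] with v hv _
    exact ⟨by rw [zero_mul, zero_div, zero_add], hv⟩

theorem not_inLattice_neg_torsionPt [NeZero N] (hτ : 0 < τ.im) (hα : α ≠ 0) :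
    ¬ InLattice τ (-torsionPt α τ) := by
  rintro ⟨m, n, h⟩
  apply hα
  have hN : (0 : ℝ) < N := by exact_mod_cast Nat.pos_of_ne_zero (NeZero.ne N)
  rw [torsionPt, coordLift_eq, coordLift_eq] at h
  have h1 : (((α.1.val : ℝ) / N : ℝ) : ℂ) + (((α.2.val : ℝ) / N : ℝ) : ℂ) * τ =
      ((-n : ℝ) : ℂ) + ((-m : ℝ) : ℂ) * τ := by
    push_cast at h ⊢
    linear_combination -h
  obtain ⟨h2, h3⟩ := eq_of_add_mul_eq hτ h1
  have key : ∀ (k : ZMod N) (n : ℤ), (k.val : ℝ) / N = -n → k = 0 := by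
    intro k n hk
    rw [div_eq_iff hN.ne'] at hk
    have hk' : (k.val : ℤ) = -n * N := by exact_mod_cast hk
    have h4 : ((k.val : ℤ) : ZMod N) = 0 := by rw [hk']; simp
    rw [← ZMod.natCast_zmod_val k]
    exact_mod_cast h4
  exact Prod.ext (key _ _ h2) (key _ _ h3)

theorem coordLift_zero : (coordLift (0 : ZMod N) : ℂ) = 0 := by simp [coordLift]

theorem torsionPt_zero (τ : ℂ) : torsionPt (0 : ZMod N × ZMod N) τ = 0 := by
  simp [torsionPt, coordLift]

theorem coeffA_of_ne [NeZero N] (hτ : 0 < τ.im) (hα : α ≠ 0) (m : ℕ) :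
    coeffA m α τ = PowerSeries.coeff m (gSer α 0 τ) := by
  have hl := not_inLattice_neg_torsionPt hτ hα
  have hl' : ¬ InLattice τ (0 - torsionPt α τ) := by rwa [zero_sub]
  have h := hasSer_limUnder_regular (coordLift α.2) (-torsionPt α τ) hτ hl
  rw [gSer_eq hτ hl', hSer_eq hτ hl', zero_sub, ← h.taylorCoeff_eq, coeffA]
  congr 1

/-- The index rises by one in dividing by x and by one more in differentiating, which also gives the
factor m + 1. -/
theorem coeffA_zero (hτ : 0 < τ.im) (m : ℕ) :
    coeffA m (0 : ZMod N × ZMod N) τ = dReg 0 (m + 2) (0, τ) * (m + 1) := by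
  have h := (hasSer_limUnder_pole hτ).taylorCoeff_eq m
  rw [PowerSeries.coeff_derivative, PowerSeries.coeff_mk] at h
  rw [← h, coeffA]
  simp only [gFun_eq, torsionPt_zero, sub_zero, Prod.snd_zero, coordLift_zero]

theorem analyticAt_coeffA [NeZero N] (hτ : 0 < τ.im) (m : ℕ) (α : ZMod N × ZMod N) :
    AnalyticAt ℂ (coeffA m α) τ := by
  have hev : ∀ᶠ t in 𝓝 τ, 0 < t.im := (isOpen_lt continuous_const (by fun_prop)).mem_nhds hτ
  by_cases hα : α = 0
  · subst hα
    have h1 : AnalyticAt ℂ (fun t => dReg 0 (m + 2) (0, t) * (m + 1 : ℂ)) τ :=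
      (AnalyticAt.fun_comp (g := dReg 0 (m + 2)) (f := fun t : ℂ => ((0 : ℂ), t))
        (analyticAt_dReg 0 (m + 2) hτ) (by fun_prop)).mul analyticAt_const
    refine h1.congr ?_
    filter_upwards [hev] with t ht
    rw [coeffA_zero ht]
  · have hl : ¬ InLattice τ (0 - torsionPt α τ) := by
      rw [zero_sub]; exact not_inLattice_neg_torsionPt hτ hα
    have h1 : AnalyticAt ℂ (fun t => PowerSeries.coeff m (gSer α 0 t)) τ :=
      AnalyticAt.fun_comp (g := fun w : ℂ × ℂ => PowerSeries.coeff m (gSer α w.2 w.1))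
        (f := fun t : ℂ => (t, (0 : ℂ)))
        (analyticAt_coeff_gSer (w := (τ, 0)) hτ hl m) (by fun_prop)
    refine h1.congr ?_
    filter_upwards [hev] with t ht
    rw [coeffA_of_ne ht hα]

theorem eventually_not_inLattice_torsion [NeZero N] (hτ : 0 < τ.im) (α : ZMod N × ZMod N) :
    ∀ᶠ z in 𝓝[≠] (0 : ℂ), ¬ InLattice τ (z - torsionPt α τ) := by
  by_cases hα : α = 0
  · subst hα
    have h : Filter.Tendsto (fun l : ℂ => (l, τ)) (𝓝 0) (𝓝 (0, τ)) :=
      Continuous.tendsto' (by fun_prop) _ _ rfl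
    filter_upwards [(h.eventually (eventually_not_inLattice_zero hτ)).filter_mono
      nhdsWithin_le_nhds, self_mem_nhdsWithin] with z hz h0
    rw [torsionPt_zero, sub_zero]
    exact hz.2.resolve_left h0
  · have h : Filter.Tendsto (fun l : ℂ => (l - torsionPt α τ, τ)) (𝓝 0) (𝓝 (-torsionPt α τ, τ)) :=
      Continuous.tendsto' (by fun_prop) _ _ (by simp)
    filter_upwards [(h.eventually (eventually_not_inLattice_of_not hτ
      (not_inLattice_neg_torsionPt hτ hα))).filter_mono nhdsWithin_le_nhds] with z hz
    exact hz.2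

/-- Taking Taylor coefficients in x commutes with z → 0. This lets the modularity of A_{m,α} be read
off from that of h_α; for α = 0 it holds because the positive coefficients of h_0 have no pole at z
= 0. -/
theorem tendsto_coeff_gSer [NeZero N] (hτ : 0 < τ.im) (α : ZMod N × ZMod N) (m : ℕ) :
    Filter.Tendsto (fun z => PowerSeries.coeff m (gSer α z τ)) (𝓝[≠] 0) (𝓝 (coeffA m α τ)) := by
  by_cases hα : α = 0
  · subst hα
    rw [coeffA_zero hτ]
    have h0 : dCoef 0 (m + 2) (0, τ) = 0 := by
      rw [dCoef_succ_zero 0 (m + 1) hτ]; simp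
    refine ((tendsto_dCoef_div 0 (m + 2) hτ h0).mul_const ((m : ℂ) + 1)).congr' ?_
    filter_upwards [eventually_not_inLattice_torsion hτ (0 : ZMod N × ZMod N)] with z hz
    rw [coeff_gSer hτ hz, hSer_eq hτ hz, PowerSeries.coeff_mk, torsionPt_zero, sub_zero,
      Prod.snd_zero, coordLift_zero]
  · rw [coeffA_of_ne hτ hα]
    have hl : ¬ InLattice τ (0 - torsionPt α τ) := by
      rw [zero_sub]; exact not_inLattice_neg_torsionPt hτ hα
    have h1 : ContinuousAt (fun z => PowerSeries.coeff m (gSer α z τ)) 0 :=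
      ContinuousAt.comp (g := fun w : ℂ × ℂ => PowerSeries.coeff m (gSer α w.2 w.1))
        (f := fun z : ℂ => (τ, z))
        (analyticAt_coeff_gSer (w := (τ, 0)) hτ hl m).continuousAt (by fun_prop)
    exact h1.tendsto.mono_left nhdsWithin_le_nhds

/-- The limit is the residue at z = 0. Only α = 0 has a pole there, with residue series exp(0·x) =
1, hence only in the constant coefficient. -/
theorem tendsto_mul_coeff_hSer [NeZero N] (hτ : 0 < τ.im) (α : ZMod N × ZMod N) (k : ℕ) :
    ∃ L : ℂ, Filter.Tendsto (fun z => z * PowerSeries.coeff k (hSer α z τ)) (𝓝[≠] 0) (𝓝 L) ∧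
      (¬ (k = 0 ∧ α = 0) → L = 0) := by
  by_cases hα : α = 0
  · subst hα
    refine ⟨dCoef 0 (k + 1) (0, τ), ?_, fun hk => ?_⟩
    · have h1 : ContinuousAt (fun z => dCoef 0 (k + 1) (z, τ)) 0 :=
        ContinuousAt.comp (g := dCoef 0 (k + 1)) (f := fun z : ℂ => (z, τ))
          (analyticAt_dCoef 0 (k + 1) hτ (Or.inl rfl)).continuousAt (by fun_prop)
      refine (h1.tendsto.mono_left (nhdsWithin_le_nhds (s := {0}ᶜ))).congr' ?_
      filter_upwards [eventually_not_inLattice_torsion hτ (0 : ZMod N × ZMod N),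
        self_mem_nhdsWithin] with z hz h0
      have h0' : z ≠ 0 := h0
      rw [hSer_eq hτ hz, PowerSeries.coeff_mk, torsionPt_zero, sub_zero, Prod.snd_zero,
        coordLift_zero]
      field_simp
    · rw [dCoef_succ_zero 0 k hτ]
      have : k ≠ 0 := fun h => hk ⟨h, rfl⟩
      simp [this]
  · refine ⟨0, ?_, fun _ => rfl⟩
    have hl : ¬ InLattice τ (0 - torsionPt α τ) := by
      rw [zero_sub]; exact not_inLattice_neg_torsionPt hτ hα
    have h1 : ContinuousAt (fun z => PowerSeries.coeff k (hSer α z τ)) 0 :=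
      ContinuousAt.comp (g := fun w : ℂ × ℂ => PowerSeries.coeff k (hSer α w.2 w.1))
        (f := fun z : ℂ => (τ, z))
        (analyticAt_coeff_hSer (w := (τ, 0)) hτ hl k).continuousAt (by fun_prop)
    have h3 : Filter.Tendsto (fun z => z * PowerSeries.coeff k (hSer α z τ)) (𝓝[≠] 0)
        (𝓝 (0 * PowerSeries.coeff k (hSer α 0 τ))) :=
      (continuousAt_id.mul h1).tendsto.mono_left nhdsWithin_le_nhds
    rwa [zero_mul] at h3

end Coefficients

/-! ### Transformation of h_α and A_{m,α} under the group. -/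

section Modularity

open Complex

variable {N : ℕ}

/-- The exponent `w` of the factor `exp(w X)` of `M_g`. -/
noncomputable def JacobiGroup.expo (g : JacobiGroup N) (z : ℂ) : ℂ := g.c * (z + g.n) - g.m * g.d

theorem JacobiGroup.det_complex (g : JacobiGroup N) : (g.a * g.d - g.b * g.c : ℂ) = 1 := by
  exact_mod_cast g.det_eq

theorem JacobiGroup.coe_smul_fst (g : JacobiGroup N) (x : ℍ × ℂ) :
    ((g • x).1 : ℂ) = (g.a * x.1 + g.b) / g.j x.1 := by
  rw [JacobiGroup.smul_fst, JacobiGroup.coe_smul]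

/-- Since γ ≡ 1 mod N, the vector (y_α, x_α)(γ - 1) is integral; this is where the level enters. The
integers also take in the translation (m, n). -/
theorem exists_torsionPt_smul [NeZero N] (g : JacobiGroup N) (α : ZMod N × ZMod N) :
    ∃ p r : ℤ, (p : ℂ) = coordLift α.1 * g.d + coordLift α.2 * g.b - g.n - coordLift α.1 ∧
      (r : ℂ) = coordLift α.1 * g.c + coordLift α.2 * g.a - g.m - coordLift α.2 := by
  have hN : (N : ℂ) ≠ 0 := Nat.cast_ne_zero.2 (NeZero.ne N)
  obtain ⟨ha, hb, hc, hd⟩ := CongruenceSubgroup.Gamma_mem.1 g.γ.2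
  have ha' : ((g.a - 1 : ℤ) : ZMod N) = 0 := by push_cast; exact sub_eq_zero.2 ha
  have hd' : ((g.d - 1 : ℤ) : ZMod N) = 0 := by push_cast; exact sub_eq_zero.2 hd
  obtain ⟨a', ha'⟩ := (ZMod.intCast_zmod_eq_zero_iff_dvd _ _).1 ha'
  obtain ⟨b', hb'⟩ := (ZMod.intCast_zmod_eq_zero_iff_dvd g.b _).1 hb
  obtain ⟨c', hc'⟩ := (ZMod.intCast_zmod_eq_zero_iff_dvd g.c _).1 hc
  obtain ⟨d', hd'⟩ := (ZMod.intCast_zmod_eq_zero_iff_dvd _ _).1 hd'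
  have ha2 : (g.a : ℂ) = 1 + N * a' := by rw [← sub_eq_iff_eq_add']; exact_mod_cast ha'
  have hd2 : (g.d : ℂ) = 1 + N * d' := by rw [← sub_eq_iff_eq_add']; exact_mod_cast hd'
  have hb2 : (g.b : ℂ) = N * b' := by exact_mod_cast hb'
  have hc2 : (g.c : ℂ) = N * c' := by exact_mod_cast hc'
  refine ⟨α.1.val * d' + α.2.val * b' - g.n, α.1.val * c' + α.2.val * a' - g.m, ?_, ?_⟩
  · rw [hd2, hb2, coordLift, coordLift]
    push_cast
    field_simp
    ring
  · rw [hc2, ha2, coordLift, coordLift]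
    push_cast
    field_simp
    ring

/-- The position of `g x` relative to the torsion section `α`, up to lattice translations. -/
theorem sub_torsionPt_smul (g : JacobiGroup N) (x : ℍ × ℂ) (α : ZMod N × ZMod N) {p r : ℤ}
    (hp : (p : ℂ) = coordLift α.1 * g.d + coordLift α.2 * g.b - g.n - coordLift α.1)
    (hr : (r : ℂ) = coordLift α.1 * g.c + coordLift α.2 * g.a - g.m - coordLift α.2) :
    (g • x).2 - torsionPt α (g • x).1 =
      ((x.2 - torsionPt α x.1) + (((-r : ℤ) : ℂ) * x.1 + ((-p : ℤ) : ℂ))) / g.j x.1 := by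
  have h0 := g.j_ne_zero x.1
  rw [torsionPt, torsionPt, JacobiGroup.coe_smul_fst, JacobiGroup.smul_snd]
  push_cast
  rw [hp, hr]
  field_simp
  rw [JacobiGroup.j]
  ring

theorem not_inLattice_smul [NeZero N] (g : JacobiGroup N) (x : ℍ × ℂ) (α : ZMod N × ZMod N)
    (h : ¬ InLattice x.1 (x.2 - torsionPt α x.1)) :
    ¬ InLattice (g • x).1 ((g • x).2 - torsionPt α (g • x).1) := by
  obtain ⟨p, r, hp, hr⟩ := exists_torsionPt_smul g α
  rw [sub_torsionPt_smul g x α hp hr]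
  rintro ⟨m, n, hmn⟩
  refine h ⟨m * g.a + n * g.c + r, m * g.b + n * g.d + p, ?_⟩
  have h0 := g.j_ne_zero x.1
  rw [JacobiGroup.coe_smul_fst] at hmn
  field_simp at hmn
  rw [JacobiGroup.j] at hmn
  push_cast at hmn ⊢
  linear_combination hmn

/-- The exponents from the modular rule, from the lattice translation and from the prefactor
exp(-y_α s) add up to ws - y_α js by the formulas for `p`, `r` and the determinant. The subtracted
terms leave κ(exp(ws) - 1)/s, as jκ/(js) = κ/s. -/
theorem hFun_smul [NeZero N] (g : JacobiGroup N) (x : ℍ × ℂ) (α : ZMod N × ZMod N) {s : ℂ}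
    (hs : s ≠ 0) : hFun α s (g • x).2 (g • x).1 =
      κ * (cexp (g.expo x.2 * s) - 1) / s +
        g.j x.1 * cexp (g.expo x.2 * s) * hFun α (g.j x.1 * s) x.2 x.1 := by
  obtain ⟨p, r, hp, hr⟩ := exists_torsionPt_smul g α
  have h0 := g.j_ne_zero x.1
  have him : 0 < (((g.a : ℂ) * x.1 + g.b) / (g.c * x.1 + g.d)).im := by
    have := (g • x).1.im_pos
    rwa [← UpperHalfPlane.coe_im, JacobiGroup.coe_smul_fst] at this
  have hmod := jacobiF_modular g.det_eq x.1.im_pos h0 him (g.j x.1 * s)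
    ((x.2 - torsionPt α x.1) + (((-r : ℤ) : ℂ) * x.1 + ((-p : ℤ) : ℂ)))
  rw [jacobiF_add_lattice] at hmod
  change jacobiF (g.j x.1 * s / g.j x.1) (_ / g.j x.1) (_ / g.j x.1) = g.j x.1 *
    cexp (g.c * (g.j x.1 * s) * _ / g.j x.1) * _ at hmod
  rw [mul_div_cancel_left₀ _ h0, ← JacobiGroup.coe_smul_fst, ← sub_torsionPt_smul g x α hp hr]
    at hmod
  rw [hFun_eq, hFun_eq, hGen, hGen, hmod]
  generalize jacobiF (g.j x.1 * s) (x.2 - torsionPt α x.1) x.1 = J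
  have he : cexp (-coordLift α.2 * s) * (g.j x.1 * cexp (g.c * (g.j x.1 * s) *
      (x.2 - torsionPt α x.1 + (((-r : ℤ) : ℂ) * x.1 + ((-p : ℤ) : ℂ))) / g.j x.1) *
      (cexp (-(((-r : ℤ) : ℂ) * (g.j x.1 * s))) * J)) =
      g.j x.1 * (cexp (g.expo x.2 * s) * cexp (-coordLift α.2 * (g.j x.1 * s))) * J := by
    rw [← Complex.exp_add]
    have : g.expo x.2 * s + -coordLift α.2 * (g.j x.1 * s) = -coordLift α.2 * s +
      (g.c * (g.j x.1 * s) * (x.2 - torsionPt α x.1 + (((-r : ℤ) : ℂ) * x.1 + ((-p : ℤ) : ℂ))) /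
        g.j x.1 + -(((-r : ℤ) : ℂ) * (g.j x.1 * s))) := by
      have e1 : ∀ u : ℂ, g.c * (g.j x.1 * s) * u / g.j x.1 = g.c * s * u := fun u => by field_simp
      rw [e1]
      push_cast
      rw [hp, hr, JacobiGroup.expo, torsionPt, JacobiGroup.j]
      linear_combination (-coordLift α.2 * s) * g.det_complex
    rw [this, Complex.exp_add, Complex.exp_add]
    ring
  rw [he]
  field_simp
  ring

open PowerSeries in
theorem hSer_smul [NeZero N] (g : JacobiGroup N) (x : ℍ × ℂ) (α : ZMod N × ZMod N)
    (h : ¬ InLattice x.1 (x.2 - torsionPt α x.1)) :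
    X * hSer α (g • x).2 (g • x).1 =
      C κ * (rescale (g.expo x.2) (PowerSeries.exp ℂ) - 1) +
        X * (C (g.j x.1) * rescale (g.expo x.2) (PowerSeries.exp ℂ) *
          rescale (g.j x.1) (hSer α x.2 x.1)) := by
  have h1 := hasSer_id.mul (hasSer_hFun (g • x).1.im_pos (not_inLattice_smul g x α h))
  have h2 := ((hasSer_const κ).mul ((hasSer_exp (g.expo x.2)).sub (hasSer_const 1))).add
    (hasSer_id.mul (((hasSer_const (g.j x.1)).mul (hasSer_exp (g.expo x.2))).mul
      ((hasSer_hFun x.1.im_pos h).comp_mul (g.j_ne_zero x.1))))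
  rw [map_one] at h2
  refine (h1.congr ?_).unique h2
  filter_upwards [self_mem_nhdsWithin] with s hs
  have hs' : s ≠ 0 := hs
  rw [hFun_smul g x α hs']
  field_simp

open PowerSeries in
theorem coeff_succ_hSer_smul [NeZero N] (g : JacobiGroup N) (x : ℍ × ℂ) (α : ZMod N × ZMod N)
    (h : ¬ InLattice x.1 (x.2 - torsionPt α x.1)) (k : ℕ) :
    coeff k (hSer α (g • x).2 (g • x).1) = κ * (g.expo x.2 ^ (k + 1) / (k + 1).factorial) +
      g.j x.1 * ∑ i ∈ Finset.HasAntidiagonal.antidiagonal k, g.expo x.2 ^ i.1 / i.1.factorial *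
        (g.j x.1 ^ i.2 * coeff i.2 (hSer α x.2 x.1)) := by
  have h1 := congrArg (coeff (k + 1)) (hSer_smul g x α h)
  rw [coeff_succ_X_mul, map_add, coeff_succ_X_mul, coeff_C_mul, map_sub, coeff_rescale, coeff_exp,
    coeff_one, if_neg (Nat.succ_ne_zero k), sub_zero, mul_assoc (C _), coeff_C_mul, coeff_mul] at h1
  rw [h1]
  simp [div_eq_mul_inv]

/-- Modularity of the coefficients `A_{k,α}`. -/
theorem coeffA_smul [NeZero N] (g : JacobiGroup N) (τ : ℍ) (α : ZMod N × ZMod N) (k : ℕ)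
    (hk : ¬ (k = 0 ∧ α = 0)) :
    coeffA k α ((g.γ • τ : ℍ) : ℂ) = g.j τ ^ (k + 2) * coeffA k α τ := by
  -- Translations do not affect A_{k,α}; without them z → 0 corresponds to z/j → 0.
  let g₀ : JacobiGroup N := ⟨g.γ, 0, 0⟩
  have h0 := g.j_ne_zero τ
  have hfst : ∀ z : ℂ, (g₀ • ((τ, z) : ℍ × ℂ)).1 = g.γ • τ := fun z => rfl
  have hsnd : ∀ z : ℂ, (g₀ • ((τ, z) : ℍ × ℂ)).2 = z / g.j τ := fun z => by
    rw [JacobiGroup.smul_snd]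
    change (z + ((0 : ℤ) : ℂ) * τ + ((0 : ℤ) : ℂ)) / g.j τ = _
    simp
  have hexp : ∀ z : ℂ, g₀.expo z = g.c * z := fun z => by
    change (g.c : ℂ) * (z + ((0 : ℤ) : ℂ)) - ((0 : ℤ) : ℂ) * g.d = _
    simp
  have hdiv : Filter.Tendsto (fun z : ℂ => z / g.j τ) (𝓝[≠] 0) (𝓝[≠] 0) := by
    refine tendsto_nhdsWithin_iff.2 ⟨?_, ?_⟩
    · exact (Continuous.tendsto' (by fun_prop) _ _ (by simp)).mono_left nhdsWithin_le_nhds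
    · filter_upwards [self_mem_nhdsWithin] with z hz
      exact div_ne_zero hz h0
  have hl := (tendsto_coeff_gSer (g.γ • τ).im_pos α k).comp hdiv
  -- the right-hand side
  have hterm : ∀ i ∈ Finset.HasAntidiagonal.antidiagonal (k + 1), Filter.Tendsto (fun z : ℂ =>
      (g.c * z) ^ i.1 / (i.1.factorial : ℂ) * (g.j τ ^ i.2 *
        PowerSeries.coeff i.2 (hSer α z τ)) * (k + 1)) (𝓝[≠] 0)
      (𝓝 (if i = (0, k + 1) then g.j τ ^ (k + 1) * coeffA k α τ else 0)) := by
    rintro ⟨p, q⟩ hi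
    rw [Finset.HasAntidiagonal.mem_antidiagonal] at hi
    rcases p with _ | p
    · obtain rfl : q = k + 1 := by simpa using hi
      rw [if_pos rfl]
      refine ((tendsto_coeff_gSer τ.im_pos α k).const_mul (g.j τ ^ (k + 1))).congr' ?_
      filter_upwards [eventually_not_inLattice_torsion τ.im_pos α] with z hz
      rw [coeff_gSer τ.im_pos hz]
      simp
      ring
    · rw [if_neg (by simp)]
      obtain ⟨L, hL, hL0⟩ := tendsto_mul_coeff_hSer τ.im_pos α q
      have h1 : Filter.Tendsto (fun z : ℂ => z ^ p) (𝓝[≠] 0) (𝓝 (0 ^ p)) :=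
        (Continuous.tendsto' (by fun_prop) _ _ rfl).mono_left nhdsWithin_le_nhds
      have hz : (0 : ℂ) ^ p * L = 0 := by
        rcases p with _ | p
        -- The only critical term: a single factor z meets the coefficient of x^k in h_α, whose
        -- residue at z = 0 vanishes except for k = 0, α = 0.
        · obtain rfl : q = k := by simp at hi; omega
          rw [hL0 hk, mul_zero]
        · simp
      have h2 := (h1.mul hL).const_mul (g.c ^ (p + 1) / ((p + 1).factorial : ℂ) * g.j τ ^ q * (k + 1))
      rw [hz, mul_zero] at h2
      refine h2.congr fun z => ?_
      rw [mul_pow, pow_succ z]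
      ring
  have hsum := (tendsto_finsetSum _ hterm).const_mul (g.j τ)
  have hw : Filter.Tendsto (fun z : ℂ => κ * ((g.c * z) ^ (k + 2) / ((k + 2).factorial : ℂ)) *
      (k + 1)) (𝓝[≠] 0) (𝓝 0) :=
    (Continuous.tendsto' (by fun_prop) _ _ (by simp)).mono_left nhdsWithin_le_nhds
  have hr := hw.add hsum
  rw [Finset.sum_ite_eq' , if_pos (by simp), zero_add] at hr
  have heq := tendsto_nhds_unique_of_eventuallyEq hl hr (by
    filter_upwards [eventually_not_inLattice_torsion τ.im_pos α] with z hz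
    have h1 := not_inLattice_smul g₀ ((τ, z) : ℍ × ℂ) α hz
    have h2 := coeff_gSer (g₀ • ((τ, z) : ℍ × ℂ)).1.im_pos h1 k
    have h3 := coeff_succ_hSer_smul g₀ ((τ, z) : ℍ × ℂ) α hz (k + 1)
    rw [h3, hexp, hfst, hsnd] at h2
    refine h2.trans ?_
    rw [add_mul, mul_assoc (g₀.j _), Finset.sum_mul]
    rfl)
  rw [heq]
  ring

end Modularity

/-! ### Power series in ad X acting on the completed Lie algebra. -/

section SeriesAction

variable {N : ℕ} [NeZero N]

/-- A linear map that preserves the filtration. -/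
def FilPres (f : P N →ₗ[ℂ] P N) : Prop := ∀ n, ∀ v ∈ fil N n, f v ∈ fil N n

theorem FilPres.proj_eq {f : P N →ₗ[ℂ] P N} (hf : FilPres f) {n : ℕ} {u v : P N}
    (h : proj n u = proj n v) : proj n (f u) = proj n (f v) := by
  have h1 := hf n (u - v) (by rw [mem_fil, map_sub, h, sub_self])
  rw [mem_fil, map_sub, map_sub, sub_eq_zero] at h1
  exact h1

theorem filPres_homOfGens (f : Gen N → P N) (hf) :
    FilPres (homOfGens f hf : P N →ₗ[ℂ] P N) := fun n v hv => homOfGens_fil f hf n v hv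

theorem filPres_derOfGens (f : Gen N → P N) (hf) :
    FilPres (derOfGens f hf : P N →ₗ[ℂ] P N) := fun n v hv => by
  have h : proj n v = tmk N n 0 := by rw [map_zero]; exact hv
  refine mem_fil.2 ((proj_extend _ _ h).trans ?_)
  rw [map_zero, map_zero]

theorem FilPres.proj_psum {f : P N →ₗ[ℂ] P N} (hf : FilPres f) (u : ℕ → P N) (hu) (n : ℕ) :
    proj n (f (psum u hu)) = ∑ m ∈ Finset.range n, proj n (f (u m)) := by
  rw [← map_sum, ← map_sum]
  refine hf.proj_eq ?_
  rw [KZB.proj_psum, map_sum]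

/-- The action of a power series in `X`. -/
noncomputable def act (f : PowerSeries ℂ) : P N →ₗ[ℂ] P N :=
  serAct (fun k => PowerSeries.coeff k f) (gen .X)

theorem act_mk (f : ℕ → ℂ) : act (N := N) (PowerSeries.mk f) = serAct f (gen .X) := by
  simp [act]

theorem FilPres.proj_act {f : P N →ₗ[ℂ] P N} (hf : FilPres f) (p : PowerSeries ℂ) (v : P N)
    (n : ℕ) : proj n (f (act p v)) = ∑ k ∈ Finset.range n, PowerSeries.coeff k p •
      proj n (f (((LieAlgebra.ad ℂ (P N) (gen .X)) ^ k) v)) := by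
  refine (hf.proj_psum _ (fun k => (fil N k).smul_mem _ (ad_pow_mem_fil _ _ k)) n).trans
    (Finset.sum_congr rfl fun k _ => ?_)
  rw [_root_.map_smul, _root_.map_smul]

theorem proj_act (p : PowerSeries ℂ) (v : P N) (n : ℕ) : proj n (act p v) =
    ∑ k ∈ Finset.range n, PowerSeries.coeff k p •
      proj n (((LieAlgebra.ad ℂ (P N) (gen .X)) ^ k) v) :=
  FilPres.proj_act (f := LinearMap.id) (fun _ _ h => h) p v n

theorem filPres_act (p : PowerSeries ℂ) : FilPres (act (N := N) p) := fun n v hv => by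
  rw [mem_fil, act, proj_serAct, mem_fil.1 hv]
  simp

/-- A continuous map that intertwines ad_X with c·ad_X rescales the variable of every power series.
It is used with c = j for M_γ and with c = 1 for maps commuting with ad_X. -/
theorem act_apply_of_lie {f : P N →ₗ[ℂ] P N} (hf : FilPres f) {c : ℂ}
    (h : ∀ v, f ⁅(gen .X : P N), v⁆ = c • ⁅(gen .X : P N), f v⁆) (p : PowerSeries ℂ) (v : P N) :
    f (act p v) = act (PowerSeries.rescale c p) (f v) := by
  have hk : ∀ k, f (((LieAlgebra.ad ℂ (P N) (gen .X)) ^ k) v) =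
      c ^ k • ((LieAlgebra.ad ℂ (P N) (gen .X)) ^ k) (f v) := by
    intro k
    induction k with
    | zero => simp
    | succ k ih =>
      rw [pow_succ' (LieAlgebra.ad ℂ (P N) _), Module.End.mul_apply, Module.End.mul_apply,
        LieAlgebra.ad_apply, LieAlgebra.ad_apply, h, ih, lie_smul, smul_smul, pow_succ']
  refine P.ext fun n => ?_
  rw [hf.proj_act, proj_act]
  refine Finset.sum_congr rfl fun k _ => ?_
  rw [hk, _root_.map_smul, smul_smul, PowerSeries.coeff_rescale, mul_comm]

theorem act_add (p q : PowerSeries ℂ) (v : P N) : act (p + q) v = act p v + act q v :=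
  P.ext fun n => by simp [proj_act, add_smul, Finset.sum_add_distrib]

theorem act_sub (p q : PowerSeries ℂ) (v : P N) : act (p - q) v = act p v - act q v :=
  P.ext fun n => by simp [proj_act, sub_smul, Finset.sum_sub_distrib]

theorem act_C_mul (c : ℂ) (p : PowerSeries ℂ) (v : P N) :
    act (PowerSeries.C c * p) v = c • act p v :=
  P.ext fun n => by simp [proj_act, Finset.smul_sum, smul_smul]

theorem proj_zero (u : P N) : proj 0 u = 0 := mem_fil.1 (by rw [fil_zero]; trivial)

theorem act_one (v : P N) : act 1 v = v := P.ext fun n => by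
  rcases n with _ | n
  · rw [proj_zero, proj_zero]
  · rw [proj_act, Finset.sum_eq_single 0] <;> simp +contextual [PowerSeries.coeff_one]

theorem act_mul_X (p : PowerSeries ℂ) (v : P N) : act (p * PowerSeries.X) v =
    act p ⁅(gen .X : P N), v⁆ := P.ext fun n => by
  rcases n with _ | n
  · rw [proj_zero, proj_zero]
  · rw [proj_act, proj_act, Finset.sum_range_succ', PowerSeries.coeff_zero_mul_X, zero_smul,
      add_zero, Finset.sum_range_succ]
    -- The index shift leaves one extra top term, which lies in the kernel of the truncation.
    have h0 : proj (n + 1) (((LieAlgebra.ad ℂ (P N) (gen .X)) ^ n) ⁅(gen .X : P N), v⁆) = 0 := by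
      rw [← mem_fil, ← LieAlgebra.ad_apply ℂ, ← Module.End.mul_apply, ← pow_succ]
      exact ad_pow_mem_fil _ _ _
    rw [h0, smul_zero, add_zero]
    refine Finset.sum_congr rfl fun k _ => ?_
    rw [PowerSeries.coeff_succ_mul_X, pow_succ, Module.End.mul_apply, LieAlgebra.ad_apply]

theorem act_C (c : ℂ) (v : P N) : act (PowerSeries.C c) v = c • v := by
  rw [← mul_one (PowerSeries.C c), act_C_mul, act_one]

theorem act_lie_X (p : PowerSeries ℂ) (v : P N) :
    act p ⁅(gen .X : P N), v⁆ = ⁅(gen .X : P N), act p v⁆ := by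
  have h := act_apply_of_lie (f := LieAlgebra.ad ℂ (P N) (gen .X)) (c := 1)
    (fun n v hv => (fil N n).lie_mem hv) (fun v => by simp) p v
  rw [PowerSeries.rescale_one] at h
  exact h.symm

theorem act_mul (p q : PowerSeries ℂ) (v : P N) : act (p * q) v = act p (act q v) := by
  have hpow : ∀ (k : ℕ) (p : PowerSeries ℂ) (v : P N), act (p * PowerSeries.X ^ k) v =
      act p (((LieAlgebra.ad ℂ (P N) (gen .X)) ^ k) v) := by
    intro k
    induction k with
    | zero => intro p v; simp
    | succ k ih =>
      intro p v
      rw [pow_succ PowerSeries.X, ← mul_assoc, act_mul_X, ih, pow_succ, Module.End.mul_apply,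
        LieAlgebra.ad_apply]
  refine P.ext fun n => ?_
  -- Modulo X^n the series `q` is a polynomial, for which the claim follows from `hpow` and
  -- linearity; the remainder acts into the n-th step of the filtration.
  have hq : PowerSeries.X ^ n ∣ q - ∑ m ∈ Finset.range n,
      PowerSeries.C (PowerSeries.coeff m q) * PowerSeries.X ^ m := by
    rw [PowerSeries.X_pow_dvd_iff]
    intro m hm
    simp [PowerSeries.coeff_X_pow, hm]
  obtain ⟨r, hr⟩ := hq
  rw [sub_eq_iff_eq_add, mul_comm] at hr
  have h1 : proj n (act (p * q) v) = proj n (act (p * ∑ m ∈ Finset.range n,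
      PowerSeries.C (PowerSeries.coeff m q) * PowerSeries.X ^ m) v) := by
    conv_lhs => rw [hr]
    rw [mul_add, ← mul_assoc, act_add, hpow, map_add]
    have : proj n (act (p * r) (((LieAlgebra.ad ℂ (P N) (gen .X)) ^ n) v)) = 0 :=
      filPres_act _ n _ (ad_pow_mem_fil _ _ _)
    rw [this, zero_add]
  have h2 : ∀ s : Finset ℕ, act (p * ∑ m ∈ s,
      PowerSeries.C (PowerSeries.coeff m q) * PowerSeries.X ^ m) v = ∑ k ∈ s,
        PowerSeries.coeff k q • act p (((LieAlgebra.ad ℂ (P N) (gen .X)) ^ k) v) := by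
    intro s
    induction s using Finset.induction_on with
    | empty =>
      rw [Finset.sum_empty, Finset.sum_empty, mul_zero, ← map_zero PowerSeries.C, act_C, zero_smul]
    | insert a s ha ih =>
      rw [Finset.sum_insert ha, Finset.sum_insert ha, mul_add, act_add, ih, mul_left_comm,
        act_C_mul, hpow]
  rw [h1, h2, (filPres_act p).proj_act]
  simp

/-- The series `exp(w X)`. -/
noncomputable abbrev expSer (w : ℂ) : PowerSeries ℂ := PowerSeries.rescale w (PowerSeries.exp ℂ)

theorem coeff_expSer (w : ℂ) (k : ℕ) :
    PowerSeries.coeff k (expSer w) = w ^ k / (k.factorial : ℂ) := by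
  simp [expSer, PowerSeries.coeff_rescale, PowerSeries.coeff_exp, div_eq_mul_inv]

theorem expAd_eq_act (w : ℂ) (v : P N) : expAd w (gen .X) v = act (expSer w) v := by
  rw [expAd_apply, act]
  congr 2
  funext k
  rw [coeff_expSer]

/-- The series `(exp(w X) - 1) / X`. -/
noncomputable def phiSer (w : ℂ) : PowerSeries ℂ :=
  PowerSeries.mk fun k => w ^ (k + 1) / ((k + 1).factorial : ℂ)

theorem phiSer_mul_X (w : ℂ) : phiSer w * PowerSeries.X = expSer w - 1 := by
  ext k
  rcases k with _ | k
  · rw [PowerSeries.coeff_zero_mul_X, map_sub, coeff_expSer]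
    simp
  · rw [PowerSeries.coeff_succ_mul_X, phiSer, PowerSeries.coeff_mk, map_sub, coeff_expSer,
      PowerSeries.coeff_one, if_neg (Nat.succ_ne_zero k), sub_zero]

/-- Two filtration-preserving derivations along the same homomorphism that agree on the generators
agree. -/
theorem twisted_ext_gen (M : P N →ₗ⁅ℂ⁆ P N) (f h : P N →ₗ[ℂ] P N) (hf : FilPres f)
    (hh : FilPres h) (hf' : ∀ a b, f ⁅a, b⁆ = ⁅f a, M b⁆ + ⁅M a, f b⁆)
    (hh' : ∀ a b, h ⁅a, b⁆ = ⁅h a, M b⁆ + ⁅M a, h b⁆) (hg : ∀ s, f (gen s) = h (gen s)) (v : P N) :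
    f v = h v := by
  let S : LieSubalgebra ℂ (FreeL N) :=
    { carrier := {a | f (incl a) = h (incl a)}
      zero_mem' := by simp
      add_mem' := fun {a b} ha hb => by
        change f (incl (a + b)) = h (incl (a + b))
        rw [map_add, map_add, map_add, ha, hb]
      smul_mem' := fun c a ha => by
        change f (incl (c • a)) = h (incl (c • a))
        rw [_root_.map_smul, _root_.map_smul, _root_.map_smul, ha]
      lie_mem' := fun {a b} ha hb => by
        change f (incl ⁅a, b⁆) = h (incl ⁅a, b⁆)
        rw [LieHom.map_lie, hf', hh', ha, hb] }
  have hS : ∀ a, f (incl a) = h (incl a) := fun a => by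
    have h1 := lift_mem (fun s => FreeLieAlgebra.of ℂ s) S hg a
    have h2 : FreeLieAlgebra.lift ℂ (fun s : Gen N => FreeLieAlgebra.of ℂ s) = LieHom.id :=
      FreeLieAlgebra.hom_ext fun s => by simp
    rw [h2] at h1
    exact h1
  refine P.ext fun n => ?_
  obtain ⟨a, ha⟩ := v.exists_rep n
  have hv : proj n v = proj n (incl a) := by rw [ha n le_rfl, proj_incl]
  rw [hf.proj_eq hv, hh.proj_eq hv, hS]

theorem der_lie (D : LieDerivation ℂ (P N) (P N)) (a b : P N) :
    D ⁅a, b⁆ = ⁅D a, b⁆ + ⁅a, D b⁆ := by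
  rw [LieDerivation.apply_lie_eq_sub, ← lie_skew (D a) b, add_comm, sub_eq_add_neg]

/-- From [D, ad_x] = ad_{Dx}; the binomial coefficients come from Pascal's rule in the induction. -/
theorem der_ad_pow (D : LieDerivation ℂ (P N) (P N)) (x v : P N) (k : ℕ) :
    D (((LieAlgebra.ad ℂ (P N) x) ^ (k + 1)) v) = ((LieAlgebra.ad ℂ (P N) x) ^ (k + 1)) (D v) +
      ∑ i ∈ Finset.HasAntidiagonal.antidiagonal k, ((k + 1).choose (i.1 + 1) : ℂ) •
        ⁅((LieAlgebra.ad ℂ (P N) x) ^ i.1) (D x), ((LieAlgebra.ad ℂ (P N) x) ^ i.2) v⁆ := by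
  induction k generalizing v with
  | zero =>
    simp only [zero_add, pow_one, LieAlgebra.ad_apply, der_lie]
    simp [add_comm]
  | succ k ih =>
    set A := LieAlgebra.ad ℂ (P N) x with hA
    have hB : ∀ i j : ℕ, ⁅x, ⁅(A ^ i) (D x), (A ^ j) v⁆⁆ =
        ⁅(A ^ (i + 1)) (D x), (A ^ j) v⁆ + ⁅(A ^ i) (D x), (A ^ (j + 1)) v⁆ := fun i j => by
      rw [leibniz_lie, pow_succ' A i, pow_succ' A j, Module.End.mul_apply, Module.End.mul_apply,
        hA, LieAlgebra.ad_apply, LieAlgebra.ad_apply]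
    rw [pow_succ' A (k + 1), Module.End.mul_apply, Module.End.mul_apply, hA, LieAlgebra.ad_apply,
      LieAlgebra.ad_apply, ← hA, der_lie, ih, lie_add, lie_sum]
    have h1 : ∀ i : ℕ × ℕ, (((k + 1 + 1).choose (i.1 + 1) : ℕ) : ℂ) •
        ⁅(A ^ i.1) (D x), (A ^ i.2) v⁆ = ((k + 1).choose i.1 : ℂ) • ⁅(A ^ i.1) (D x), (A ^ i.2) v⁆ +
          ((k + 1).choose (i.1 + 1) : ℂ) • ⁅(A ^ i.1) (D x), (A ^ i.2) v⁆ := fun i => by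
      rw [Nat.choose_succ_succ, Nat.cast_add, add_smul]
    simp only [h1, Finset.sum_add_distrib]
    rw [Finset.Nat.sum_antidiagonal_succ, Finset.Nat.sum_antidiagonal_succ']
    simp only [lie_smul, hB, smul_add, Finset.sum_add_distrib]
    simp
    abel

/-- [ad^i u, ad^j v] lies in the filtration step i + j + 1, so only pairs with i + j < n survive and
the double sum can be arranged by total degree. -/
theorem proj_lie_act (p q : PowerSeries ℂ) (u v : P N) (n : ℕ) :
    proj (n + 1) ⁅act p u, act q v⁆ = ∑ k ∈ Finset.range n,
      ∑ i ∈ Finset.HasAntidiagonal.antidiagonal k, (PowerSeries.coeff i.1 p * PowerSeries.coeff i.2 q) •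
        proj (n + 1) ⁅((LieAlgebra.ad ℂ (P N) (gen .X)) ^ i.1) u,
          ((LieAlgebra.ad ℂ (P N) (gen .X)) ^ i.2) v⁆ := by
  set A := LieAlgebra.ad ℂ (P N) (gen .X)
  have hz : ∀ i j : ℕ, n ≤ i + j → proj (n + 1) ⁅(A ^ i) u, (A ^ j) v⁆ = 0 := fun i j hij =>
    fil_antitone (Nat.succ_le_succ hij) (lie_ad_pow_mem_fil _ _ _ (ad_pow_mem_fil _ _ _))
  have h1 : proj (n + 1) ⁅act p u, act q v⁆ =
      ∑ x ∈ Finset.range (n + 1) ×ˢ Finset.range (n + 1),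
        (PowerSeries.coeff x.1 p * PowerSeries.coeff x.2 q) •
          proj (n + 1) ⁅(A ^ x.1) u, (A ^ x.2) v⁆ := by
    rw [proj_lie, proj_act, proj_act, Finset.sum_product, sum_lie]
    simp only [lie_sum, smul_lie, lie_smul, smul_smul, proj_lie]
    refine Finset.sum_congr rfl fun i _ => Finset.sum_congr rfl fun j _ => ?_
    rw [mul_comm]
  rw [h1, ← Finset.sum_filter_add_sum_filter_not _ (fun x : ℕ × ℕ => x.1 + x.2 < n),
    Finset.sum_eq_zero (s := Finset.filter (fun x : ℕ × ℕ => ¬ x.1 + x.2 < n) _), add_zero,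
    ← Finset.sum_fiberwise_of_maps_to (g := fun x : ℕ × ℕ => x.1 + x.2) (t := Finset.range n)]
  · refine Finset.sum_congr rfl fun k hk => Finset.sum_congr ?_ fun _ _ => rfl
    ext x
    simp only [Finset.mem_filter, Finset.mem_product, Finset.mem_range,
      Finset.HasAntidiagonal.mem_antidiagonal] at hk ⊢
    omega
  · intro x hx
    simpa using (Finset.mem_filter.1 hx).2
  · intro x hx
    rw [hz _ _ (by simpa using (Finset.mem_filter.1 hx).2), smul_zero]

/-- Conjugation of a derivation by `exp(w X)`. -/
theorem der_act_expSer (D : LieDerivation ℂ (P N) (P N)) (hD : FilPres (D : P N →ₗ[ℂ] P N)) (w : ℂ)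
    (v : P N) : D (act (expSer w) v) =
      act (expSer w) (D v) + ⁅act (phiSer w) (D (gen .X)), act (expSer w) v⁆ := by
  refine P.ext fun n => ?_
  rcases n with _ | n
  · rw [proj_zero, proj_zero]
  · rw [map_add, proj_lie_act]
    refine (hD.proj_act _ v (n + 1)).trans ?_
    rw [proj_act, Finset.sum_range_succ', Finset.sum_range_succ', add_right_comm,
      ← Finset.sum_add_distrib]
    refine congrArg₂ _ (Finset.sum_congr rfl fun k _ => ?_) rfl
    have h := der_ad_pow D (gen .X) v k
    change _ • proj (n + 1) (D _) = _
    rw [h, map_add, smul_add, map_sum, Finset.smul_sum]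
    congr 1
    refine Finset.sum_congr rfl fun i hi => ?_
    rw [Finset.HasAntidiagonal.mem_antidiagonal] at hi
    rw [_root_.map_smul, smul_smul, coeff_expSer, coeff_expSer, phiSer, PowerSeries.coeff_mk]
    congr 1
    -- Divided by (k + 1)!, the binomial coefficient becomes 1/((i + 1)!(k - i)!), a product of
    -- coefficients of `phiSer` and `expSer`.
    have h1 := Nat.choose_mul_factorial_mul_factorial (n := i.1 + 1 + i.2) (k := i.1 + 1) (by omega)
    rw [Nat.add_sub_cancel_left] at h1
    have hk : i.1 + 1 + i.2 = k + 1 := by omega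
    rw [hk] at h1
    have h2 : (((k + 1).factorial : ℕ) : ℂ) =
        ((k + 1).choose (i.1 + 1) : ℂ) * ((i.1 + 1).factorial : ℂ) * (i.2.factorial : ℂ) := by
      exact_mod_cast h1.symm
    have h3 : ((k + 1).choose (i.1 + 1) : ℂ) ≠ 0 := by
      exact_mod_cast (Nat.choose_pos (by omega)).ne'
    have h4 : ((i.1 + 1).factorial : ℂ) ≠ 0 := by exact_mod_cast Nat.factorial_ne_zero _
    have h5 : (i.2.factorial : ℂ) ≠ 0 := by exact_mod_cast Nat.factorial_ne_zero _
    have h6 : w ^ (k + 1) = w ^ (i.1 + 1) * w ^ i.2 := by rw [← pow_add, hk]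
    rw [h2, h6]
    field_simp

end SeriesAction

/-! ### Conjugation of the derivations by M_γ, and the series laws for h_α and g_α. -/

section Gauge

variable {N : ℕ} [NeZero N]

theorem autM_X (g : JacobiGroup N) (τ : ℍ) : autM g τ (gen .X) = g.j τ • gen .X :=
  homOfGens_gen _ _ _

theorem autM_Y (g : JacobiGroup N) (τ : ℍ) :
    autM g τ (gen .Y) = (g.j τ)⁻¹ • gen .Y + (g.c / κ : ℂ) • gen .X :=
  homOfGens_gen _ _ _

theorem autM_t (g : JacobiGroup N) (τ : ℍ) (α : ZMod N × ZMod N) :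
    autM g τ (gen (.t α)) = gen (.t α) :=
  homOfGens_gen _ _ _

theorem autM_act (g : JacobiGroup N) (τ : ℍ) (p : PowerSeries ℂ) (v : P N) :
    autM g τ (act p v) = act (PowerSeries.rescale (g.j τ) p) (autM g τ v) :=
  act_apply_of_lie (f := (autM g τ : P N →ₗ[ℂ] P N)) (filPres_homOfGens _ _) (fun v => by
    change autM g τ ⁅(gen .X : P N), v⁆ = _
    rw [LieHom.map_lie, autM_X, smul_lie]
    rfl) p v

theorem automorphy_eq (g : JacobiGroup N) (x : ℍ × ℂ) (v : P N) :
    automorphy g x v = act (expSer (g.expo x.2)) (autM g x.1 v) := by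
  change autHom g x v = _
  rw [autHom_apply, expAd_eq_act]
  rfl

theorem derYdX_X : derYdX N (gen .X) = gen .Y := derOfGens_gen _ _ _
theorem derYdX_Y : derYdX N (gen .Y) = 0 := derOfGens_gen _ _ _
theorem derYdX_t (α : ZMod N × ZMod N) : derYdX N (gen (.t α)) = 0 := derOfGens_gen _ _ _

/-- The derivation `X ↦ (c/j) X`, `Y ↦ -(c/j) Y - (c²/2πi) X`, `t_α ↦ 0`, the logarithmic derivative
of `M_γ(τ)` with respect to `τ`. -/
noncomputable def dGamma (g : JacobiGroup N) (τ : ℍ) : LieDerivation ℂ (P N) (P N) :=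
  derOfGens (fun s => match s with
    | .X => (g.c / g.j τ : ℂ) • gen .X
    | .Y => -((g.c / g.j τ : ℂ) • gen .Y) - (g.c ^ 2 / κ : ℂ) • gen .X
    | .t _ => 0) (by simp)

theorem dGamma_X (g : JacobiGroup N) (τ : ℍ) :
    dGamma g τ (gen .X) = (g.c / g.j τ : ℂ) • gen .X := derOfGens_gen _ _ _
theorem dGamma_Y (g : JacobiGroup N) (τ : ℍ) : dGamma g τ (gen .Y) =
    -((g.c / g.j τ : ℂ) • gen .Y) - (g.c ^ 2 / κ : ℂ) • gen .X := derOfGens_gen _ _ _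
theorem dGamma_t (g : JacobiGroup N) (τ : ℍ) (α : ZMod N × ZMod N) :
    dGamma g τ (gen (.t α)) = 0 := derOfGens_gen _ _ _

theorem filPres_autM (g : JacobiGroup N) (τ : ℍ) : FilPres (autM g τ : P N →ₗ[ℂ] P N) :=
  filPres_homOfGens _ _

theorem FilPres.comp {f h : P N →ₗ[ℂ] P N} (hf : FilPres f) (hh : FilPres h) :
    FilPres (f ∘ₗ h) := fun n v hv => hf n _ (hh n v hv)

theorem FilPres.add {f h : P N →ₗ[ℂ] P N} (hf : FilPres f) (hh : FilPres h) :
    FilPres (f + h) := fun n v hv => (fil N n).add_mem (hf n v hv) (hh n v hv)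

theorem FilPres.smul {f : P N →ₗ[ℂ] P N} (c : ℂ) (hf : FilPres f) :
    FilPres (c • f) := fun n v hv => (fil N n).smul_mem c (hf n v hv)

/-- Both sides are derivations along M_γ, so the generators suffice. The inhomogeneous term `dGamma`
is the τ-derivative of M_γ, and so it is matched by (dM_g)M_g⁻¹ in the gauge law. -/
theorem autM_derYdX (g : JacobiGroup N) (τ : ℍ) (u : P N) : autM g τ (κ • derYdX N u) =
    (κ / g.j τ ^ 2) • derYdX N (autM g τ u) + dGamma g τ (autM g τ u) := by
  have hM := filPres_autM g τ
  have hY : FilPres (derYdX N : P N →ₗ[ℂ] P N) := filPres_derOfGens _ _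
  have hG : FilPres (dGamma g τ : P N →ₗ[ℂ] P N) := filPres_derOfGens _ _
  have h0 := g.j_ne_zero τ
  have hk := kappa_ne_zero
  refine twisted_ext_gen (autM g τ)
    ((autM g τ : P N →ₗ[ℂ] P N) ∘ₗ (κ • (derYdX N : P N →ₗ[ℂ] P N)))
    ((κ / g.j τ ^ 2) • ((derYdX N : P N →ₗ[ℂ] P N) ∘ₗ (autM g τ : P N →ₗ[ℂ] P N)) +
      (dGamma g τ : P N →ₗ[ℂ] P N) ∘ₗ (autM g τ : P N →ₗ[ℂ] P N))
    (hM.comp (hY.smul _)) (((hY.comp hM).smul _).add (hG.comp hM)) ?_ ?_ ?_ u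
  · intro a b
    change autM g τ (κ • derYdX N ⁅a, b⁆) = ⁅autM g τ (κ • derYdX N a), autM g τ b⁆ +
      ⁅autM g τ a, autM g τ (κ • derYdX N b)⁆
    simp only [der_lie, smul_add, _root_.map_add, _root_.map_smul, LieHom.map_lie, smul_lie,
      lie_smul]
  · intro a b
    change (κ / g.j τ ^ 2) • derYdX N (autM g τ ⁅a, b⁆) + dGamma g τ (autM g τ ⁅a, b⁆) =
      ⁅(κ / g.j τ ^ 2) • derYdX N (autM g τ a) + dGamma g τ (autM g τ a), autM g τ b⁆ +
      ⁅autM g τ a, (κ / g.j τ ^ 2) • derYdX N (autM g τ b) + dGamma g τ (autM g τ b)⁆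
    simp only [LieHom.map_lie, der_lie, smul_add, add_lie, lie_add, smul_lie, lie_smul]
    abel
  · intro s
    change autM g τ (κ • derYdX N (gen s)) =
      (κ / g.j τ ^ 2) • derYdX N (autM g τ (gen s)) + dGamma g τ (autM g τ (gen s))
    cases s with
    | X =>
      simp only [derYdX_X, autM_X, _root_.map_smul, autM_Y, dGamma_X, smul_add, smul_smul]
      congr 2 <;> field_simp
    | Y =>
      simp only [derYdX_X, derYdX_Y, autM_Y, _root_.map_add, _root_.map_smul, dGamma_X, dGamma_Y,
        smul_zero, _root_.map_zero, smul_sub, smul_smul, smul_neg, zero_add]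
      match_scalars <;> field_simp <;> ring
    | t α =>
      simp only [derYdX_t, autM_t, dGamma_t, smul_zero, _root_.map_zero, add_zero]

theorem delta_gen (m : ℕ) (α : ZMod N × ZMod N) (s : Gen N) :
    delta m α (gen s) = deltaVal m α s := derOfGens_gen _ _ _

theorem autM_adXt (g : JacobiGroup N) (τ : ℍ) (k : ℕ) (α : ZMod N × ZMod N) :
    autM g τ (adXt k α) = g.j τ ^ k • adXt k α := by
  induction k with
  | zero => rw [pow_zero, one_smul]; exact autM_t g τ α
  | succ k ih =>
    rw [adXt_succ, LieHom.map_lie, ih, autM_X, smul_lie, lie_smul, smul_smul, pow_succ']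

/-- Give X the weight 1, Y the weight -1 and t_α the weight 0: the values of δ_{m,α} raise the
weight by m. The X-component of M_γ(Y) does not interfere, since δ_{m,α}(X) = 0. -/
theorem autM_delta (g : JacobiGroup N) (τ : ℍ) (m : ℕ) (α : ZMod N × ZMod N) (u : P N) :
    autM g τ (delta m α u) = g.j τ ^ m • delta m α (autM g τ u) := by
  have hM := filPres_autM g τ
  have hD : FilPres (delta m α : P N →ₗ[ℂ] P N) := filPres_derOfGens _ _
  have h0 := g.j_ne_zero τ
  refine twisted_ext_gen (autM g τ)
    ((autM g τ : P N →ₗ[ℂ] P N) ∘ₗ (delta m α : P N →ₗ[ℂ] P N))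
    (g.j τ ^ m • ((delta m α : P N →ₗ[ℂ] P N) ∘ₗ (autM g τ : P N →ₗ[ℂ] P N)))
    (hM.comp hD) ((hD.comp hM).smul _) ?_ ?_ ?_ u
  · intro a b
    change autM g τ (delta m α ⁅a, b⁆) = ⁅autM g τ (delta m α a), autM g τ b⁆ +
      ⁅autM g τ a, autM g τ (delta m α b)⁆
    simp only [der_lie, _root_.map_add, LieHom.map_lie]
  · intro a b
    change g.j τ ^ m • delta m α (autM g τ ⁅a, b⁆) =
      ⁅g.j τ ^ m • delta m α (autM g τ a), autM g τ b⁆ +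
      ⁅autM g τ a, g.j τ ^ m • delta m α (autM g τ b)⁆
    simp only [LieHom.map_lie, der_lie, smul_add, smul_lie, lie_smul]
  · intro s
    change autM g τ (delta m α (gen s)) = g.j τ ^ m • delta m α (autM g τ (gen s))
    cases s with
    | X => simp [delta_gen, autM_X, deltaVal]
    | Y =>
      simp only [delta_gen, autM_Y, deltaVal, _root_.map_add, _root_.map_smul, smul_zero, add_zero,
        smul_smul, Finset.smul_sum, map_sum, LieHom.map_lie, autM_adXt, smul_lie, lie_smul]
      refine Finset.sum_congr rfl fun i hi => Finset.sum_congr rfl fun β _ => ?_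
      have hm : m = i + (m - 1 - i) + 1 := by have := Finset.mem_range.1 hi; omega
      have e : g.j τ ^ m * (g.j τ)⁻¹ = g.j τ ^ i * g.j τ ^ (m - 1 - i) := by
        conv_lhs => rw [hm, pow_succ, pow_add]
        field_simp
      congr 1
      linear_combination -(-1 : ℂ) ^ i * e
    | t β =>
      simp only [delta_gen, autM_t, deltaVal, LieHom.map_lie, _root_.map_add, _root_.map_smul,
        autM_adXt, lie_add, lie_smul, smul_add, smul_smul]
      congr 2
      ring

/-- On t_β the value is [t_β, 2t_β] = 0, and the sum at Y is empty. This disposes of A_{0,0}, the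
one coefficient that `coeffA_smul` leaves out. -/
theorem delta_zero_zero (u : P N) : delta 0 (0 : ZMod N × ZMod N) u = 0 := by
  have hD : FilPres (delta (N := N) 0 0 : P N →ₗ[ℂ] P N) := filPres_derOfGens _ _
  refine twisted_ext_gen LieHom.id (delta (N := N) 0 0 : P N →ₗ[ℂ] P N) 0 hD (fun n v _ => (fil N n).zero_mem) (fun a b => ?_) (fun a b => by simp) (fun s => ?_) u
  · exact der_lie (delta 0 0) a b
  change delta 0 0 (gen s) = 0
  rw [delta_gen]
  cases s <;> simp [deltaVal, adXt]

theorem proj_psiDer (τ : ℂ) (v : P N) (n : ℕ) : proj n (psiDer N τ v) =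
    ∑ m ∈ Finset.range n, (1 / 2 : ℂ) • ∑ α : ZMod N × ZMod N,
      coeffA m α τ • proj n (delta m α v) := by
  have h0 : proj n (psiDer N τ v) = ∑ m ∈ Finset.range n, proj n (((1 / 2 : ℂ) •
      ∑ α : ZMod N × ZMod N, coeffA m α τ • delta m α) v) := rfl
  rw [h0]
  refine Finset.sum_congr rfl fun m _ => ?_
  rw [LieDerivation.smul_apply, _root_.map_smul]
  congr 1
  have h : ∀ s : Finset (ZMod N × ZMod N), proj n ((∑ α ∈ s, coeffA m α τ • delta m α) v) =
      ∑ α ∈ s, coeffA m α τ • proj n (delta m α v) := by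
    intro s
    induction s using Finset.induction_on with
    | empty => simp
    | insert a s ha ih =>
      rw [Finset.sum_insert ha, Finset.sum_insert ha, LieDerivation.add_apply, map_add, ih,
        LieDerivation.smul_apply, _root_.map_smul]
  exact h _

theorem filPres_psiDer (τ : ℂ) : FilPres (psiDer N τ : P N →ₗ[ℂ] P N) := fun n v hv => by
  change proj n (psiDer N τ v) = 0
  rw [proj_psiDer]
  refine Finset.sum_eq_zero fun m _ => ?_
  rw [Finset.sum_eq_zero fun α _ => ?_, smul_zero]
  have : proj n (delta m α v) = 0 := filPres_derOfGens (N := N) _ _ n v hv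
  rw [this, smul_zero]

theorem psiDer_X (τ : ℂ) : psiDer N τ (gen .X) = 0 := P.ext fun n => by
  rw [proj_psiDer]
  simp [delta_gen, deltaVal]

theorem psiDer_act (τ : ℂ) (p : PowerSeries ℂ) (v : P N) :
    psiDer N τ (act p v) = act p (psiDer N τ v) := by
  have h := act_apply_of_lie (f := (psiDer N τ : P N →ₗ[ℂ] P N)) (c := 1) (filPres_psiDer τ)
    (fun v => by
      change psiDer N τ ⁅(gen .X : P N), v⁆ = (1 : ℂ) • ⁅(gen .X : P N), psiDer N τ v⁆
      rw [der_lie, psiDer_X, zero_lie, zero_add, one_smul]) p v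
  rw [PowerSeries.rescale_one] at h
  exact h

/-- The weights m + 2 of A_{m,α} and m of δ_{m,α} differ by 2 for all m, so a single factor j² comes
out. -/
theorem autM_psiDer (g : JacobiGroup N) (τ : ℍ) (u : P N) : autM g τ (psiDer N τ u) =
    (g.j τ ^ 2)⁻¹ • psiDer N ((g.γ • τ : ℍ) : ℂ) (autM g τ u) := P.ext fun n => by
  have h0 := g.j_ne_zero τ
  have hM := filPres_autM g τ
  have h1 : proj n (psiDer N τ u) = proj n (∑ m ∈ Finset.range n, (1 / 2 : ℂ) •
      ∑ α : ZMod N × ZMod N, coeffA m α τ • delta m α u) := by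
    rw [proj_psiDer]; simp
  refine (hM.proj_eq h1).trans ?_
  change proj n (autM g τ _) = _
  rw [_root_.map_smul, proj_psiDer]
  simp only [map_sum, _root_.map_smul, autM_delta, Finset.smul_sum, smul_smul]
  refine Finset.sum_congr rfl fun m _ => Finset.sum_congr rfl fun α _ => ?_
  by_cases hm : m = 0 ∧ α = 0
  · obtain ⟨rfl, rfl⟩ := hm
    simp [delta_zero_zero]
  · rw [coeffA_smul g τ α m hm, pow_add]
    congr 1
    field_simp

theorem act_sum (p : PowerSeries ℂ) {ι : Type} (s : Finset ι) (f : ι → P N) :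
    act p (∑ i ∈ s, f i) = ∑ i ∈ s, act p (f i) := map_sum _ _ _

variable (N) in
/-- The sum of the generators `t_α`. -/
noncomputable def tSum : P N := ∑ α : ZMod N × ZMod N, gen (.t α)

theorem nuTwo_eq (x : ℍ × ℂ) : nuTwo N x =
    κ • gen .Y + ∑ α, act (hSer α x.2 x.1) (gen (.t α)) := by
  simp only [hSer, act_mk]
  rfl

theorem nuOne_eq (x : ℍ × ℂ) : nuOne N x = ∑ α, act (gSer α x.2 x.1) (gen (.t α)) := by
  simp only [gSer, act_mk]
  rfl

/-- The relation enters here: φ_w(X)·[X, Y] = φ_w(X)·∑ t_α. -/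
theorem act_expSer_Y (w : ℂ) : act (expSer w) (gen .Y : P N) = gen .Y + act (phiSer w) (tSum N) := by
  have h : expSer w = 1 + phiSer w * PowerSeries.X := by rw [phiSer_mul_X]; ring
  rw [h, act_add, act_one, act_mul_X, ← relation, tSum]

theorem act_expSer_X (w : ℂ) : act (expSer w) (gen .X : P N) = gen .X := by
  have h : expSer w = 1 + phiSer w * PowerSeries.X := by rw [phiSer_mul_X]; ring
  rw [h, act_add, act_one, act_mul_X, lie_self, _root_.map_zero, add_zero]

/-- Points outside the torsion sections. -/
theorem not_inLattice_of_not_mem {x : ℍ × ℂ} (hx : x ∉ torsionLocus N) (α : ZMod N × ZMod N) :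
    ¬ InLattice x.1 (x.2 - torsionPt α x.1) := by
  have hN : (N : ℂ) ≠ 0 := Nat.cast_ne_zero.2 (NeZero.ne N)
  rintro ⟨m, n, h⟩
  refine hx ⟨α.1.val + n * N, α.2.val + m * N, ?_⟩
  rw [torsionPt, coordLift, coordLift, sub_eq_iff_eq_add] at h
  rw [h]
  push_cast
  field_simp
  ring

theorem hSer_smul_eq (g : JacobiGroup N) (x : ℍ × ℂ) (α : ZMod N × ZMod N)
    (h : ¬ InLattice x.1 (x.2 - torsionPt α x.1)) :
    hSer α (g • x).2 (g • x).1 = PowerSeries.C κ * phiSer (g.expo x.2) +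
      PowerSeries.C (g.j x.1) * (expSer (g.expo x.2) *
        PowerSeries.rescale (g.j x.1) (hSer α x.2 x.1)) := by
  refine mul_left_cancel₀ PowerSeries.X_ne_zero ?_
  rw [hSer_smul g x α h, ← phiSer_mul_X]
  ring

theorem derivative_rescale (c : ℂ) (p : PowerSeries ℂ) :
    PowerSeries.derivative ℂ (PowerSeries.rescale c p) =
      PowerSeries.C c * PowerSeries.rescale c (PowerSeries.derivative ℂ p) := by
  ext k
  rw [PowerSeries.coeff_derivative, PowerSeries.coeff_rescale, PowerSeries.coeff_C_mul,
    PowerSeries.coeff_rescale, PowerSeries.coeff_derivative]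
  ring

theorem derivative_expSer (w : ℂ) :
    PowerSeries.derivative ℂ (expSer w) = PowerSeries.C w * expSer w := by
  ext k
  rw [PowerSeries.coeff_derivative, PowerSeries.coeff_C_mul, coeff_expSer, coeff_expSer,
    Nat.factorial_succ]
  have : (k.factorial : ℂ) ≠ 0 := by exact_mod_cast Nat.factorial_ne_zero _
  have : (k + 1 : ℂ) ≠ 0 := by exact_mod_cast Nat.succ_ne_zero k
  push_cast
  field_simp
  ring

theorem X_mul_derivative_phiSer (w : ℂ) : PowerSeries.derivative ℂ (phiSer w) * PowerSeries.X =
    PowerSeries.C w * expSer w - phiSer w := by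
  have h := congrArg (PowerSeries.derivative ℂ) (phiSer_mul_X w)
  rw [Derivation.leibniz, map_sub, derivative_expSer, PowerSeries.derivative_X] at h
  simp only [smul_eq_mul, mul_one, Derivation.map_one_eq_zero, sub_zero] at h
  linear_combination h

/-- The derivative of `hSer_smul_eq`. The term with the factor w, from differentiating exp(wX), is
what mixes ν₂ into the law of ν₁. -/
theorem gSer_smul_eq (g : JacobiGroup N) (x : ℍ × ℂ) (α : ZMod N × ZMod N)
    (h : ¬ InLattice x.1 (x.2 - torsionPt α x.1)) :
    gSer α (g • x).2 (g • x).1 = PowerSeries.C κ * PowerSeries.derivative ℂ (phiSer (g.expo x.2)) +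
      PowerSeries.C (g.j x.1) * (PowerSeries.C (g.expo x.2) * (expSer (g.expo x.2) *
        PowerSeries.rescale (g.j x.1) (hSer α x.2 x.1)) +
      PowerSeries.C (g.j x.1) * (expSer (g.expo x.2) *
        PowerSeries.rescale (g.j x.1) (gSer α x.2 x.1))) := by
  rw [gSer_eq (g • x).1.im_pos (not_inLattice_smul g x α h), gSer_eq x.1.im_pos h,
    hSer_smul_eq g x α h, map_add, Derivation.leibniz, Derivation.leibniz, Derivation.leibniz,
    derivative_rescale, derivative_expSer, PowerSeries.derivative_C, PowerSeries.derivative_C]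
  simp only [smul_eq_mul]
  ring

end Gauge

/-! ### The gauge transformation law of Ω_N. -/

section Gauge2

variable {N : ℕ} [NeZero N]

theorem automorphy_Y (g : JacobiGroup N) (x : ℍ × ℂ) : automorphy g x (gen .Y) =
    (g.j x.1)⁻¹ • (gen .Y + act (phiSer (g.expo x.2)) (tSum N)) + (g.c / κ : ℂ) • gen .X := by
  rw [automorphy_eq, autM_Y, _root_.map_add, _root_.map_smul, _root_.map_smul, act_expSer_Y,
    act_expSer_X]

theorem automorphy_act_t (g : JacobiGroup N) (x : ℍ × ℂ) (p : PowerSeries ℂ)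
    (α : ZMod N × ZMod N) : automorphy g x (act p (gen (.t α))) =
      act (expSer (g.expo x.2) * PowerSeries.rescale (g.j x.1) p) (gen (.t α)) := by
  rw [automorphy_eq, autM_act, autM_t, act_mul]

theorem sum_act_C_mul_add (c : ℂ) (p : PowerSeries ℂ) (q : ZMod N × ZMod N → PowerSeries ℂ) :
    ∑ α, act (PowerSeries.C c * p + q α) (gen (.t α) : P N) =
      c • act p (tSum N) + ∑ α, act (q α) (gen (.t α)) := by
  simp only [act_add, act_C_mul, Finset.sum_add_distrib, tSum, act_sum, Finset.smul_sum]

/-- The inhomogeneous terms κφ_w(X)t_α of the h_α sum to exactly what exp(wX) adds to κY; the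
multiple of X comes from the X-component of M_γ(Y). -/
theorem nuTwo_smul (g : JacobiGroup N) {x : ℍ × ℂ} (hx : x ∉ torsionLocus N) :
    nuTwo N (g • x) = g.j x.1 • automorphy g x (nuTwo N x) - (g.j x.1 * g.c) • gen .X := by
  have h0 := g.j_ne_zero x.1
  have hk := kappa_ne_zero
  rw [nuTwo_eq, nuTwo_eq, Finset.sum_congr rfl fun α _ => by
    rw [hSer_smul_eq g x α (not_inLattice_of_not_mem hx α)], sum_act_C_mul_add, _root_.map_add,
    _root_.map_smul, automorphy_Y, map_sum]
  simp only [act_C_mul, automorphy_act_t, ← Finset.smul_sum]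
  generalize ∑ α, act (expSer (g.expo x.2) * PowerSeries.rescale (g.j x.1) (hSer α x.2 x.1))
    (gen (.t α) : P N) = S
  match_scalars <;> field_simp
  ring

/-- After substituting ∑ t_α = [X, Y] all terms are series in X applied to Y, and w(exp(wX) - 1) -
(w exp(wX) - φ_w) + w = φ_w. -/
theorem act_phiSer_Y (w : ℂ) : (w : ℂ) • act (phiSer w) (tSum N) -
    act (PowerSeries.derivative ℂ (phiSer w)) (tSum N) + w • gen .Y = act (phiSer w) (gen .Y) := by
  have hT : tSum N = ⁅(gen .X : P N), gen .Y⁆ := relation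
  rw [hT, ← act_mul_X, ← act_mul_X, X_mul_derivative_phiSer, phiSer_mul_X, ← act_C_mul, ← act_C,
    ← act_sub, ← act_add]
  congr 2
  ring

/-- The left side is the dτ-coefficient of the pullback of ν₁ + ν₂, because g^*dτ = dτ/j² and g^*dz
= dz/j - (w/j²)dτ. The last term is to cancel in `Omega_smul`. -/
theorem nuOne_smul (g : JacobiGroup N) {x : ℍ × ℂ} (hx : x ∉ torsionLocus N) :
    (g.j x.1 ^ 2)⁻¹ • nuOne N (g • x) - (g.expo x.2 / g.j x.1 ^ 2) • nuTwo N (g • x) =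
      automorphy g x (nuOne N x) -
        (κ / g.j x.1 ^ 2) • act (phiSer (g.expo x.2)) (gen .Y) := by
  have h0 := g.j_ne_zero x.1
  have hk := kappa_ne_zero
  rw [← act_phiSer_Y, nuTwo_eq, nuOne_eq, nuOne_eq, Finset.sum_congr rfl fun α _ => by
    rw [gSer_smul_eq g x α (not_inLattice_of_not_mem hx α)], sum_act_C_mul_add,
    Finset.sum_congr (s₁ := Finset.univ) (f := fun α => act (hSer α (g • x).2 (g • x).1) _) rfl
    fun α _ => by
    rw [hSer_smul_eq g x α (not_inLattice_of_not_mem hx α)], sum_act_C_mul_add, map_sum]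
  simp only [act_C_mul, act_add, automorphy_act_t, ← Finset.smul_sum, Finset.sum_add_distrib]
  generalize ∑ α, act (expSer (g.expo x.2) * PowerSeries.rescale (g.j x.1) (hSer α x.2 x.1))
    (gen (.t α) : P N) = S
  generalize ∑ α, act (expSer (g.expo x.2) * PowerSeries.rescale (g.j x.1) (gSer α x.2 x.1))
    (gen (.t α) : P N) = S'
  match_scalars <;> field_simp
  ring

/-- The derivative at `x` of `automorphy g · v`, evaluated at the tangent vector `ξ`. -/
noncomputable def dAutomorphy (g : JacobiGroup N) (x : ℍ × ℂ) (v : P N) : ℂ × ℂ →ₗ[ℂ] P N where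
  toFun ξ := (g.c * ξ.2) • ⁅(gen .X : P N), automorphy g x v⁆ +
    ξ.1 • act (expSer (g.expo x.2)) (dGamma g x.1 (autM g x.1 v))
  map_add' ξ η := by simp only [Prod.fst_add, Prod.snd_add]; module
  map_smul' c ξ := by simp only [Prod.smul_fst, Prod.smul_snd, smul_eq_mul, RingHom.id_apply]; module

theorem Omega_apply (x : ℍ × ℂ) (ξ : ℂ × ℂ) (u : P N) : Omega N x ξ u =
    ξ.1 • (κ • derYdX N u + psiDer N x.1 u + ⁅nuOne N x, u⁆) + ξ.2 • ⁅nuTwo N x, u⁆ := by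
  simp only [Omega, LieDerivation.add_apply, LieDerivation.smul_apply, LieDerivation.ad_apply_apply]

/-- The transformation rule of the connection form. -/
theorem Omega_smul (g : JacobiGroup N) {x : ℍ × ℂ} (hx : x ∉ torsionLocus N) (ξ : ℂ × ℂ) (u : P N) :
    Omega N (g • x) (ξ.1 / g.j x.1 ^ 2, ξ.2 / g.j x.1 - g.expo x.2 / g.j x.1 ^ 2 * ξ.1)
        (automorphy g x u) =
      automorphy g x (Omega N x ξ u) - dAutomorphy g x u ξ := by
  have h0 := g.j_ne_zero x.1
  -- Moving Y∂/∂X past exp(wX) creates ad(φ_w(X)Y), the counterpart of the last term of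
  -- `nuOne_smul`.
  have hconj := der_act_expSer (derYdX N) (filPres_derOfGens _ _) (g.expo x.2) (autM g x.1 u)
  rw [derYdX_X, ← automorphy_eq] at hconj
  have hpsi : (g.j x.1 ^ 2)⁻¹ • psiDer N (g • x).1 (automorphy g x u) =
      automorphy g x (psiDer N x.1 u) := by
    rw [automorphy_eq, automorphy_eq, autM_psiDer, psiDer_act, _root_.map_smul]
    rfl
  have hY : automorphy g x (κ • derYdX N u) =
      (κ / g.j x.1 ^ 2) • act (expSer (g.expo x.2)) (derYdX N (autM g x.1 u)) +
        act (expSer (g.expo x.2)) (dGamma g x.1 (autM g x.1 u)) := by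
    rw [automorphy_eq, autM_derYdX, _root_.map_add, _root_.map_smul]
  have hnu := congrArg (fun a => ⁅a, automorphy g x u⁆) (nuOne_smul g hx)
  have hnu2 := congrArg (fun a => ⁅a, automorphy g x u⁆) (nuTwo_smul g hx)
  simp only [sub_lie, smul_lie] at hnu hnu2
  rw [← LieEquiv.map_lie] at hnu hnu2
  have hd : dAutomorphy g x u ξ = (g.c * ξ.2) • ⁅(gen .X : P N), automorphy g x u⁆ +
    ξ.1 • act (expSer (g.expo x.2)) (dGamma g x.1 (autM g x.1 u)) := rfl
  rw [Omega_apply (g • x), Omega_apply x, hd, _root_.map_add, _root_.map_smul, _root_.map_add,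
    _root_.map_add, hY, hconj, ← hpsi, _root_.map_smul]
  have hnu' : automorphy g x ⁅nuOne N x, u⁆ = (g.j x.1 ^ 2)⁻¹ • ⁅nuOne N (g • x), automorphy g x u⁆ -
      (g.expo x.2 / g.j x.1 ^ 2) • ⁅nuTwo N (g • x), automorphy g x u⁆ +
      (κ / g.j x.1 ^ 2) • ⁅act (phiSer (g.expo x.2)) (gen .Y : P N), automorphy g x u⁆ := by
    rw [hnu]; abel
  rw [hnu', hnu2]
  match_scalars <;> field_simp <;> ring

end Gauge2

/-! ### The truncations are finite dimensional. -/

section FiniteDimensional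

variable {N : ℕ} [NeZero N]

instance : Finite (Gen N) := by
  refine Finite.of_surjective (fun o : Option (Option (ZMod N × ZMod N)) => match o with
    | none => Gen.X
    | some none => Gen.Y
    | some (some α) => Gen.t α) fun s => ?_
  cases s with
  | X => exact ⟨none, rfl⟩
  | Y => exact ⟨some none, rfl⟩
  | t α => exact ⟨some (some α), rfl⟩

/-- The left-normed words of length `k + 1` in the generators. -/
def words : ℕ → Set (FreeL N)
  | 0 => Set.range fun s : Gen N => FreeLieAlgebra.of ℂ s
  | k + 1 => Set.image2 (fun a b : FreeL N => ⁅a, b⁆)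
      (Set.range fun s : Gen N => FreeLieAlgebra.of ℂ s) (words k)

theorem finite_words (k : ℕ) : (words (N := N) k).Finite := by
  induction k with
  | zero => exact Set.finite_range _
  | succ k ih => exact (Set.finite_range _).image2 _ ih

theorem words_subset (k : ℕ) {a : FreeL N} (ha : a ∈ words k) : a ∈ truncIdeal N k := by
  induction k generalizing a with
  | zero => rw [truncIdeal_zero]; trivial
  | succ k ih =>
    obtain ⟨b, -, c, hc, rfl⟩ := ha
    exact lie_mem_truncIdeal b (ih hc)

/-- The left-normed words span the free Lie algebra. -/
theorem span_words : Submodule.span ℂ (⋃ k, words (N := N) k) = ⊤ := by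
  set S := Submodule.span ℂ (⋃ k, words (N := N) k) with hS
  -- The elements whose bracket preserves `S` form a subalgebra by the Jacobi identity; it contains
  -- the generators and so is everything.
  let T : LieSubalgebra ℂ (FreeL N) :=
    { carrier := {a | ∀ b ∈ S, ⁅a, b⁆ ∈ S}
      zero_mem' := fun b _ => by rw [zero_lie]; exact S.zero_mem
      add_mem' := fun {a a'} ha ha' b hb => by
        rw [add_lie]; exact S.add_mem (ha b hb) (ha' b hb)
      smul_mem' := fun c a ha b hb => by
        rw [smul_lie]; exact S.smul_mem c (ha b hb)
      lie_mem' := fun {a a'} ha ha' b hb => by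
        rw [lie_lie]; exact S.sub_mem (ha _ (ha' b hb)) (ha' _ (ha b hb)) }
  have hid : ∀ (T : LieSubalgebra ℂ (FreeL N)), (∀ s, FreeLieAlgebra.of ℂ s ∈ T) → ∀ a, a ∈ T := by
    intro T hT a
    have h1 := lift_mem (fun s => FreeLieAlgebra.of ℂ s) T hT a
    have h2 : FreeLieAlgebra.lift ℂ (fun s : Gen N => FreeLieAlgebra.of ℂ s) = LieHom.id :=
      FreeLieAlgebra.hom_ext fun s => by simp
    rw [h2] at h1
    exact h1
  have hT : ∀ a b : FreeL N, b ∈ S → ⁅a, b⁆ ∈ S := by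
    refine hid T fun s b hb => ?_
    induction hb using Submodule.span_induction with
    | mem b hb =>
      obtain ⟨k, hk⟩ := Set.mem_iUnion.1 hb
      exact Submodule.subset_span (Set.mem_iUnion.2 ⟨k + 1, _, ⟨s, rfl⟩, b, hk, rfl⟩)
    | zero => rw [lie_zero]; exact S.zero_mem
    | add b b' _ _ h h' => rw [lie_add]; exact S.add_mem h h'
    | smul c b _ h => rw [lie_smul]; exact S.smul_mem c h
  let S' : LieSubalgebra ℂ (FreeL N) := { S with lie_mem' := fun {a b} _ hb => hT a b hb }
  exact eq_top_iff.2 fun a _ => hid S'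
    (fun s => Submodule.subset_span (Set.mem_iUnion.2 ⟨0, s, rfl⟩)) a

/-- `words k` maps to zero for k ≥ n, and finitely many words remain. This makes it possible to test
holomorphy on the coordinates of a finite basis. -/
instance (n : ℕ) : Module.Finite ℂ (Trunc N n) := by
  let W : Set (Trunc N n) := tmk N n '' ⋃ k : Fin n, words (N := N) (k : ℕ)
  have hW : W.Finite := (Set.finite_iUnion fun k : Fin n => finite_words (k : ℕ)).image _
  refine ⟨⟨hW.toFinset, ?_⟩⟩
  rw [Set.Finite.coe_toFinset, eq_top_iff]
  have h1 : (⊤ : Submodule ℂ (Trunc N n)) = Submodule.map (tmk N n) ⊤ := by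
    rw [Submodule.map_top, LinearMap.range_eq_top.2 (tmk_surjective n)]
  rw [h1, ← span_words, Submodule.map_span, Submodule.span_le]
  rintro _ ⟨a, ha, rfl⟩
  obtain ⟨k, hk⟩ := Set.mem_iUnion.1 ha
  by_cases hkn : k < n
  · exact Submodule.subset_span ⟨a, Set.mem_iUnion.2 ⟨⟨k, hkn⟩, hk⟩, rfl⟩
  · have : tmk N n a = 0 := tmk_eq_zero.2 (truncIdeal_antitone (not_lt.1 hkn) (words_subset k hk))
    rw [this]
    exact Submodule.zero_mem _

theorem proj_surjective (n : ℕ) : Function.Surjective (proj (N := N) n) := fun u => by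
  obtain ⟨a, rfl⟩ := tmk_surjective n u
  exact ⟨incl a, rfl⟩

/-- Finitely many elements of `𝔭_N` lift a basis of a truncation. -/
theorem exists_lifted_basis (N : ℕ) [NeZero N] (n : ℕ) :
    ∃ (d : ℕ) (v : Fin d → P N) (c : Fin d → Trunc N n →ₗ[ℂ] ℂ),
      ∀ u, u = ∑ i, c i u • proj n (v i) := by
  let b := Module.finBasis ℂ (Trunc N n)
  choose v hv using fun i => proj_surjective n (b i)
  refine ⟨_, v, fun i => b.coord i, fun u => ?_⟩
  simp only [hv, Module.Basis.coord_apply]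
  exact (b.sum_repr u).symm

theorem trunc_ext {n : ℕ} {u v : Trunc N n} (h : ∀ φ : Trunc N n →ₗ[ℂ] ℂ, φ u = φ v) : u = v := by
  rw [← sub_eq_zero, ← Module.forall_dual_apply_eq_zero_iff ℂ]
  intro φ
  rw [map_sub, h, sub_self]

theorem P.ext_functional {u v : P N}
    (h : ∀ (n : ℕ) (φ : Trunc N n →ₗ[ℂ] ℂ), φ (proj n u) = φ (proj n v)) : u = v :=
  P.ext fun n => trunc_ext (h n)

/-- The map from a truncation to a coarser one. -/
theorem exists_transition {m n : ℕ} (h : m ≤ n) :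
    ∃ π : Trunc N n →ₗ[ℂ] Trunc N m, ∀ a, π (tmk N n a) = tmk N m a :=
  ⟨(truncIdeal N n).toSubmodule.liftQ (tmk N m) fun _ ha =>
    tmk_eq_zero.2 (truncIdeal_antitone h ha), fun _ => Submodule.liftQ_apply _ _ _⟩

theorem transition_proj {m n : ℕ} (h : m ≤ n) {π : Trunc N n →ₗ[ℂ] Trunc N m}
    (hπ : ∀ a, π (tmk N n a) = tmk N m a) (u : P N) : π (proj n u) = proj m u := by
  obtain ⟨a, ha⟩ := u.exists_rep n
  rw [ha n le_rfl, ha m h, hπ]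

/-- A filtration-preserving linear map in terms of a lifted basis. -/
theorem FilPres.proj_sum {f : P N →ₗ[ℂ] P N} (hf : FilPres f) {n d : ℕ} {v : Fin d → P N}
    {c : Fin d → Trunc N n →ₗ[ℂ] ℂ} (h : ∀ u, u = ∑ i, c i u • proj n (v i)) (u : P N) :
    proj n (f u) = ∑ i, c i (proj n u) • proj n (f (v i)) := by
  have h1 : proj n u = proj n (∑ i, c i (proj n u) • v i) := by
    rw [map_sum]
    simp only [_root_.map_smul]
    exact h _
  rw [hf.proj_eq h1]
  simp

end FiniteDimensional

/-! ### Differential calculus for functions with values in the completed Lie algebra. -/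

section Calculus

variable {N : ℕ} [NeZero N]

theorem inCoord_coord {A : Type} (f : ℍ × ℂ → A) (x : ℍ × ℂ) : inCoord f (coord x) = f x := by
  simp [inCoord, coord]

theorem coord_im_pos (x : ℍ × ℂ) : 0 < (coord x).1.im := x.1.im_pos

theorem coord_inCoord {w : ℂ × ℂ} (hw : 0 < w.1.im) :
    coord (UpperHalfPlane.ofComplex w.1, w.2) = w := by
  simp [coord, UpperHalfPlane.ofComplex_apply_of_im_pos hw]

theorem continuousAt_ofCoord (x : ℍ × ℂ) :
    Filter.Tendsto (fun w : ℂ × ℂ => (UpperHalfPlane.ofComplex w.1, w.2)) (𝓝 (coord x)) (𝓝 x) := by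
  have h1 : ContinuousAt (fun w : ℂ × ℂ => UpperHalfPlane.ofComplex w.1) (coord x) :=
    ContinuousAt.comp (g := fun z : ℂ => UpperHalfPlane.ofComplex z) (f := fun w : ℂ × ℂ => w.1)
      (UpperHalfPlane.contMDiffAt_ofComplex (n := 0) x.1.im_pos).continuousAt continuousAt_fst
  have h2 := h1.prodMk (continuousAt_snd (p := coord x))
  have h3 : Filter.Tendsto (fun w : ℂ × ℂ => (UpperHalfPlane.ofComplex w.1, w.2)) (𝓝 (coord x))
      (𝓝 (UpperHalfPlane.ofComplex (coord x).1, (coord x).2)) := h2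
  rwa [show (UpperHalfPlane.ofComplex (coord x).1, (coord x).2) = x by simp [coord]] at h3

/-- A property that holds near `x` holds near `coord x` in coordinates. -/
theorem eventually_coord {x : ℍ × ℂ} {p : ℍ × ℂ → Prop} (h : ∀ᶠ y in 𝓝 x, p y) :
    ∀ᶠ w in 𝓝 (coord x), coord (UpperHalfPlane.ofComplex w.1, w.2) = w ∧
      p (UpperHalfPlane.ofComplex w.1, w.2) := by
  filter_upwards [(continuousAt_ofCoord x).eventually h, (isOpen_lt continuous_const
    (by fun_prop : Continuous fun w : ℂ × ℂ => w.1.im)).mem_nhds (coord_im_pos x)] with w h1 h2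
  exact ⟨coord_inCoord h2, h1⟩

theorem hasDifferential_unique {s : ℍ × ℂ → P N} {s' s'' : ℂ × ℂ →ₗ[ℂ] P N} {x : ℍ × ℂ}
    (h : HasDifferential s s' x) (h' : HasDifferential s s'' x) : s' = s'' :=
  LinearMap.ext fun ξ => P.ext_functional fun n φ =>
    DFunLike.congr_fun ((h n φ).unique (h' n φ)) ξ

theorem HasDifferential.differential_eq {s : ℍ × ℂ → P N} {s' : ℂ × ℂ →ₗ[ℂ] P N} {x : ℍ × ℂ}
    (h : HasDifferential s s' x) : differential s x = s' := by
  have hex : ∃ s', HasDifferential s s' x := ⟨s', h⟩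
  rw [differential, dif_pos hex]
  exact hasDifferential_unique hex.choose_spec h

theorem HasDifferential.congr {s t : ℍ × ℂ → P N} {s' : ℂ × ℂ →ₗ[ℂ] P N} {x : ℍ × ℂ}
    (h : HasDifferential s s' x) (hst : ∀ᶠ y in 𝓝 x, t y = s y) : HasDifferential t s' x :=
  fun n φ => (h n φ).congr_of_eventuallyEq ((eventually_coord hst).mono fun w hw => by
    simp only [inCoord, hw.2])

theorem exists_hasDifferential {s : ℍ × ℂ → P N} {x : ℍ × ℂ}
    (h : ∀ (n : ℕ) (φ : Trunc N n →ₗ[ℂ] ℂ),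
      DifferentiableAt ℂ (inCoord fun y => φ (proj n (s y))) (coord x)) :
    ∃ s', HasDifferential s s' x := by
  choose D V C hC using exists_lifted_basis N
  let L : ∀ n, (Trunc N n →ₗ[ℂ] ℂ) → (ℂ × ℂ →L[ℂ] ℂ) := fun n φ =>
    fderiv ℂ (inCoord fun y => φ (proj n (s y))) (coord x)
  -- In each truncation the differential is assembled from a basis. By `hL` it represents the
  -- derivative of every functional, so it does not depend on the basis; this gives compatibility of
  -- the truncations in `hd`.
  let d : ∀ n, ℂ × ℂ → Trunc N n := fun n ξ => ∑ i, L n (C n i) ξ • proj n (V n i)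
  have hL : ∀ n φ ξ, φ (d n ξ) = L n φ ξ := by
    intro n φ ξ
    have h1 : HasFDerivAt (inCoord fun y => φ (proj n (s y)))
        (∑ i, φ (proj n (V n i)) • L n (C n i)) (coord x) := by
      have h2 := HasFDerivAt.fun_sum (u := Finset.univ) fun i _ =>
        (h n (C n i)).hasFDerivAt.const_smul (φ (proj n (V n i)))
      refine h2.congr_of_eventuallyEq (Filter.Eventually.of_forall fun w => ?_)
      change φ (proj n (s _)) = _
      conv_lhs => rw [hC n (proj n (s _)), map_sum]
      refine Finset.sum_congr rfl fun i _ => ?_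
      rw [_root_.map_smul, smul_eq_mul, mul_comm]
      rfl
    have h3 : L n φ = ∑ i, φ (proj n (V n i)) • L n (C n i) := h1.fderiv
    rw [h3, map_sum]
    simp [mul_comm]
  have hd : ∀ m n (hmn : m ≤ n) ξ (a : FreeL N), d n ξ = tmk N n a → d m ξ = tmk N m a := by
    intro m n hmn ξ a ha
    obtain ⟨π, hπ⟩ := exists_transition (N := N) hmn
    rw [← hπ, ← ha]
    refine trunc_ext fun φ => ?_
    have h1 := hL n (φ ∘ₗ π) ξ
    rw [LinearMap.comp_apply] at h1
    rw [h1, hL]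
    simp only [L, LinearMap.comp_apply, transition_proj hmn hπ]
  let s' : ℂ × ℂ →ₗ[ℂ] P N :=
    { toFun := fun ξ => P.mk (fun n => d n ξ) fun n => by
        obtain ⟨a, ha⟩ := tmk_surjective n (d n ξ)
        exact ⟨a, fun m hm => hd m n hm ξ a ha.symm⟩
      map_add' := fun ξ η => P.ext_functional fun n φ => by
        rw [map_add, map_add, proj_mk, proj_mk, proj_mk, hL, hL, hL, map_add]
      map_smul' := fun c ξ => P.ext_functional fun n φ => by
        rw [RingHom.id_apply, _root_.map_smul, _root_.map_smul, proj_mk, proj_mk, hL, hL,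
          _root_.map_smul] }
  refine ⟨s', fun n φ => (h n φ).hasFDerivAt.congr_fderiv ?_⟩
  refine ContinuousLinearMap.ext fun ξ => ?_
  exact (hL n φ ξ).symm

theorem IsHol.exists_hasDifferential {W : Set (ℍ × ℂ)} {s : ℍ × ℂ → P N} (h : IsHol W s)
    {x : ℍ × ℂ} (hx : x ∈ W) : ∃ s', HasDifferential s s' x :=
  KZB.exists_hasDifferential fun n φ => (h n φ x hx).differentiableAt

theorem IsHol.hasDifferential {W : Set (ℍ × ℂ)} {s : ℍ × ℂ → P N} (h : IsHol W s)
    {x : ℍ × ℂ} (hx : x ∈ W) : HasDifferential s (differential s x) x := by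
  obtain ⟨s', hs'⟩ := h.exists_hasDifferential hx
  rwa [hs'.differential_eq]

/-- A function on an open set that has a differential everywhere is holomorphic. -/
theorem isHol_of_hasDifferential {W : Set (ℍ × ℂ)} (hW : IsOpen W) {s : ℍ × ℂ → P N}
    (h : ∀ x ∈ W, ∃ s', HasDifferential s s' x) : IsHol W s := fun n φ x hx => by
  refine (analyticAt_and_dslope ?_).1
  filter_upwards [eventually_coord (hW.mem_nhds hx)] with w hw
  obtain ⟨s', hs'⟩ := h _ hw.2
  rw [← hw.1]
  exact (hs' n φ).differentiableAt

theorem hasDifferential_const (v : P N) (x : ℍ × ℂ) : HasDifferential (fun _ => v) 0 x :=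
  fun n φ => by
    have h := hasFDerivAt_const (𝕜 := ℂ) (φ (proj n v)) (coord x)
    refine h.congr_fderiv (ContinuousLinearMap.ext fun ξ => ?_)
    simp

/-- The product rule for a family of filtration-preserving linear maps. -/
theorem HasDifferential.apply {A : ℍ × ℂ → P N →ₗ[ℂ] P N} {A' : ℂ × ℂ →ₗ[ℂ] P N →ₗ[ℂ] P N}
    {s : ℍ × ℂ → P N} {s' : ℂ × ℂ →ₗ[ℂ] P N} {x : ℍ × ℂ} (hA : ∀ y, FilPres (A y))
    (hA' : ∀ ξ, FilPres (A' ξ)) (h : ∀ v, HasDifferential (fun y => A y v) (A'.flip v) x)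
    (hs : HasDifferential s s' x) :
    HasDifferential (fun y => A y (s y)) (A x ∘ₗ s' + A'.flip (s x)) x := fun n φ => by
  obtain ⟨d, v, c, hc⟩ := exists_lifted_basis N n
  -- Expanding s in a lifted basis reduces the claim to the scalar product rule for c_i(s)·φ(A v_i).
  have h2 := HasFDerivAt.fun_sum (u := Finset.univ) fun i _ => (hs n (c i)).mul (h (v i) n φ)
  refine (h2.congr_of_eventuallyEq (Filter.Eventually.of_forall fun w => ?_)).congr_fderiv
    (ContinuousLinearMap.ext fun ξ => ?_)
  · change φ (proj n (A _ (s _))) = _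
    rw [(hA _).proj_sum hc, map_sum]
    refine Finset.sum_congr rfl fun i _ => ?_
    rw [_root_.map_smul, smul_eq_mul]
    rfl
  · have e1 := (hA x).proj_sum hc (s' ξ)
    have e2 := (hA' ξ).proj_sum hc (s x)
    have e3 : φ (proj n ((A x ∘ₗ s' + A'.flip (s x)) ξ)) =
        φ (proj n (A x (s' ξ))) + φ (proj n (A' ξ (s x))) := by simp
    change _ = φ (proj n ((A x ∘ₗ s' + A'.flip (s x)) ξ))
    rw [e3, e1, e2, map_sum, map_sum, ← Finset.sum_add_distrib]
    simp [inCoord_coord, add_comm, mul_comm]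

theorem HasDifferential.const_apply {f : P N →ₗ[ℂ] P N} (hf : FilPres f) {s : ℍ × ℂ → P N}
    {s' : ℂ × ℂ →ₗ[ℂ] P N} {x : ℍ × ℂ} (hs : HasDifferential s s' x) :
    HasDifferential (fun y => f (s y)) (f ∘ₗ s') x := by
  have h := HasDifferential.apply (A := fun _ => f) (A' := 0) (fun _ => hf)
    (fun _ n _ _ => (fil N n).zero_mem) (fun v => hasDifferential_const _ _) hs
  have e : f ∘ₗ s' + (0 : ℂ × ℂ →ₗ[ℂ] P N →ₗ[ℂ] P N).flip (s x) = f ∘ₗ s' := by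
    ext <;> simp
  rwa [e] at h

theorem HasDifferential.add {s t : ℍ × ℂ → P N} {s' t' : ℂ × ℂ →ₗ[ℂ] P N} {x : ℍ × ℂ}
    (hs : HasDifferential s s' x) (ht : HasDifferential t t' x) :
    HasDifferential (fun y => s y + t y) (s' + t') x := fun n φ => by
  refine (((hs n φ).add (ht n φ)).congr_of_eventuallyEq
    (Filter.Eventually.of_forall fun w => ?_)).congr_fderiv (ContinuousLinearMap.ext fun ξ => ?_)
  · simp [inCoord]
  · simp

variable (N) in
/-- The adjoint action as a linear map. -/
noncomputable def adL : P N →ₗ[ℂ] P N →ₗ[ℂ] P N :=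
  LinearMap.mk₂ ℂ (fun u v => ⁅u, v⁆) (fun _ _ _ => add_lie _ _ _) (fun _ _ _ => smul_lie _ _ _)
    (fun _ _ _ => lie_add _ _ _) (fun _ _ _ => lie_smul _ _ _)

theorem adL_apply (u v : P N) : adL N u v = ⁅u, v⁆ := rfl

theorem filPres_adL (u : P N) : FilPres (adL N u) := fun n _ hv =>
  (fil N n).lie_mem hv

theorem HasDifferential.lie {s t : ℍ × ℂ → P N} {s' t' : ℂ × ℂ →ₗ[ℂ] P N} {x : ℍ × ℂ}
    (hs : HasDifferential s s' x) (ht : HasDifferential t t' x) :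
    HasDifferential (fun y => ⁅s y, t y⁆) (adL N (s x) ∘ₗ t' - adL N (t x) ∘ₗ s') x := by
  have h := HasDifferential.apply (A := fun y => adL N (s y))
    (A' := adL N ∘ₗ s') (fun y => filPres_adL _) (fun ξ => filPres_adL _) (fun v => ?_) ht
  · have e : adL N (s x) ∘ₗ t' - adL N (t x) ∘ₗ s' =
        adL N (s x) ∘ₗ t' + (adL N ∘ₗ s').flip (t x) := by
      refine LinearMap.ext fun ξ => ?_
      change ⁅s x, t' ξ⁆ - ⁅t x, s' ξ⁆ = ⁅s x, t' ξ⁆ + ⁅s' ξ, t x⁆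
      rw [← lie_skew (s' ξ) (t x), sub_eq_add_neg]
    rw [e]
    exact h
  · have h1 := hs.const_apply (f := -adL N v) fun n u hu =>
      (fil N n).neg_mem ((fil N n).lie_mem hu)
    have e1 : (fun y => adL N (s y) v) = fun y => (-adL N v) (s y) := by
      funext y
      exact (lie_skew (s y) v).symm
    have e2 : (adL N ∘ₗ s').flip v = (-adL N v) ∘ₗ s' := by
      refine LinearMap.ext fun ξ => ?_
      exact (lie_skew (s' ξ) v).symm
    rw [e1, e2]
    exact h1

/-- A scalar function times a constant vector. -/
theorem hasDifferential_smul_const {f : ℍ × ℂ → ℂ} {f' : ℂ × ℂ →L[ℂ] ℂ} {x : ℍ × ℂ}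
    (hf : HasFDerivAt (inCoord f) f' (coord x)) (v : P N) :
    HasDifferential (fun y => f y • v) ((f' : ℂ × ℂ →ₗ[ℂ] ℂ).smulRight v) x := fun n φ => by
  refine ((hf.mul_const (φ (proj n v))).congr_of_eventuallyEq
    (Filter.Eventually.of_forall fun w => ?_)).congr_fderiv (ContinuousLinearMap.ext fun ξ => ?_)
  · simp [inCoord]
  · simp [mul_comm]

theorem HasDifferential.smul {f : ℍ × ℂ → ℂ} {f' : ℂ × ℂ →L[ℂ] ℂ} {x : ℍ × ℂ}
    (hf : HasFDerivAt (inCoord f) f' (coord x)) {s : ℍ × ℂ → P N} {s' : ℂ × ℂ →ₗ[ℂ] P N}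
    (hs : HasDifferential s s' x) :
    HasDifferential (fun y => f y • s y) (f x • s' + (f' : ℂ × ℂ →ₗ[ℂ] ℂ).smulRight (s x)) x := by
  have h := HasDifferential.apply (A := fun y => f y • LinearMap.id)
    (A' := (f' : ℂ × ℂ →ₗ[ℂ] ℂ).smulRight LinearMap.id)
    (fun y n v hv => (fil N n).smul_mem _ hv) (fun ξ n v hv => (fil N n).smul_mem _ hv)
    (fun v => ?_) hs
  · have e : f x • s' + (f' : ℂ × ℂ →ₗ[ℂ] ℂ).smulRight (s x) = (f x • LinearMap.id) ∘ₗ s' +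
        ((f' : ℂ × ℂ →ₗ[ℂ] ℂ).smulRight (LinearMap.id : P N →ₗ[ℂ] P N)).flip (s x) :=
      LinearMap.ext fun ξ => by simp
    rw [e]
    exact h
  · have e : ((f' : ℂ × ℂ →ₗ[ℂ] ℂ).smulRight (LinearMap.id : P N →ₗ[ℂ] P N)).flip v =
        (f' : ℂ × ℂ →ₗ[ℂ] ℂ).smulRight v := LinearMap.ext fun ξ => by simp
    rw [e]
    exact hasDifferential_smul_const hf v

end Calculus

/-! ### Differentials of the group action and of the factors of automorphy. -/

section AutomorphyCalculus

variable {N : ℕ} [NeZero N]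

/-- Functions of a point in terms of a formula in its coordinates. -/
theorem hasFDerivAt_inCoord {A : Type} [NormedAddCommGroup A] [NormedSpace ℂ A] {f : ℍ × ℂ → A}
    {F : ℂ × ℂ → A} {F' : ℂ × ℂ →L[ℂ] A} {x : ℍ × ℂ} (h : HasFDerivAt F F' (coord x))
    (hf : ∀ y, f y = F (coord y)) : HasFDerivAt (inCoord f) F' (coord x) := by
  refine h.congr_of_eventuallyEq ?_
  filter_upwards [eventually_coord (x := x) (p := fun _ => True) (by simp)] with w hw
  rw [inCoord, hf, hw.1]

theorem hasDerivAt_moebius {a b c d t : ℂ} (hdet : a * d - b * c = 1) (hj : c * t + d ≠ 0) :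
    HasDerivAt (fun t => (a * t + b) / (c * t + d)) (1 / (c * t + d) ^ 2) t := by
  have h1 : HasDerivAt (fun t => a * t + b) a t := by
    simpa using ((hasDerivAt_id t).const_mul a).add_const b
  have h2 : HasDerivAt (fun t => c * t + d) c t := by
    simpa using ((hasDerivAt_id t).const_mul c).add_const d
  refine (h1.div h2 hj).congr_deriv ?_
  rw [← hdet]
  ring

theorem hasDerivAt_j_inv (g : JacobiGroup N) (τ : ℍ) :
    HasDerivAt (fun t : ℂ => (g.c * t + g.d)⁻¹) (-g.c / g.j τ ^ 2) τ := by
  have h2 : HasDerivAt (fun t : ℂ => g.c * t + g.d) g.c (τ : ℂ) := by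
    simpa using ((hasDerivAt_id (τ : ℂ)).const_mul (g.c : ℂ)).add_const (g.d : ℂ)
  exact h2.fun_inv (g.j_ne_zero τ)

/-- The τ-derivative of (z + mτ + n)/j is (mj - c(z + mτ + n))/j² = (md - c(z + n))/j² = -w/j², so
the exponent of the factor of automorphy reappears. -/
theorem hasFDerivAt_smul (g : JacobiGroup N) (x : ℍ × ℂ) :
    HasFDerivAt (inCoord fun y => coord (g • y))
      (((1 / g.j x.1 ^ 2 : ℂ) • ContinuousLinearMap.fst ℂ ℂ ℂ).prod
        ((1 / g.j x.1 : ℂ) • ContinuousLinearMap.snd ℂ ℂ ℂ -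
          (g.expo x.2 / g.j x.1 ^ 2 : ℂ) • ContinuousLinearMap.fst ℂ ℂ ℂ)) (coord x) := by
  have h0 := g.j_ne_zero x.1
  have h1 := (hasDerivAt_moebius g.det_complex h0).comp_hasFDerivAt (coord x)
    (hasFDerivAt_fst (𝕜 := ℂ) (E := ℂ) (F := ℂ))
  have h2 := (hasDerivAt_j_inv g x.1).comp_hasFDerivAt (coord x)
    (hasFDerivAt_fst (𝕜 := ℂ) (E := ℂ) (F := ℂ))
  have h3 : HasFDerivAt (fun w : ℂ × ℂ => w.2 + g.m * w.1 + g.n)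
      (ContinuousLinearMap.snd ℂ ℂ ℂ + (g.m : ℂ) • ContinuousLinearMap.fst ℂ ℂ ℂ) (coord x) :=
    (hasFDerivAt_snd.add (hasFDerivAt_fst.const_mul (g.m : ℂ))).add_const _
  refine hasFDerivAt_inCoord ((h1.prodMk (h3.mul h2)).congr_fderiv ?_) fun y => ?_
  · refine ContinuousLinearMap.ext fun ξ => Prod.ext ?_ ?_
    · simp [coord, JacobiGroup.j]
    · have hj : (g.c : ℂ) * x.1 + g.d = g.j x.1 := rfl
      have hj' : g.j x.1 = (g.c : ℂ) * x.1 + g.d := rfl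
      simp [coord, hj]
      rw [JacobiGroup.expo]
      field_simp
      rw [hj']
      ring
  · refine Prod.ext ?_ ?_
    · exact JacobiGroup.coe_smul_fst g y
    · exact div_eq_mul_inv _ _

theorem dAct_apply (g : JacobiGroup N) (x : ℍ × ℂ) (ξ : ℂ × ℂ) : dAct g x ξ =
    (ξ.1 / g.j x.1 ^ 2, ξ.2 / g.j x.1 - g.expo x.2 / g.j x.1 ^ 2 * ξ.1) := by
  rw [dAct, (hasFDerivAt_smul g x).fderiv]
  refine Prod.ext ?_ ?_
  · simp; ring
  · simp; ring

theorem hasFDerivAt_j (g : JacobiGroup N) (x : ℍ × ℂ) : HasFDerivAt (inCoord fun y => g.j y.1)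
    ((g.c : ℂ) • ContinuousLinearMap.fst ℂ ℂ ℂ) (coord x) :=
  hasFDerivAt_inCoord ((hasFDerivAt_fst.const_mul (g.c : ℂ)).add_const (g.d : ℂ)) fun _ => rfl

theorem hasFDerivAt_j_inv (g : JacobiGroup N) (x : ℍ × ℂ) :
    HasFDerivAt (inCoord fun y => (g.j y.1)⁻¹)
      ((-g.c / g.j x.1 ^ 2 : ℂ) • ContinuousLinearMap.fst ℂ ℂ ℂ) (coord x) :=
  hasFDerivAt_inCoord ((hasDerivAt_j_inv g x.1).comp_hasFDerivAt (coord x)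
    (hasFDerivAt_fst (𝕜 := ℂ) (E := ℂ) (F := ℂ))) fun _ => rfl

theorem hasFDerivAt_expo (g : JacobiGroup N) (x : ℍ × ℂ) :
    HasFDerivAt (inCoord fun y => g.expo y.2)
      ((g.c : ℂ) • ContinuousLinearMap.snd ℂ ℂ ℂ) (coord x) :=
  hasFDerivAt_inCoord (((hasFDerivAt_snd.add_const (g.n : ℂ)).const_mul (g.c : ℂ)).sub_const
    ((g.m : ℂ) * g.d)) fun _ => rfl

/-- The differential of `M_γ`. -/
noncomputable def dAutM (g : JacobiGroup N) (τ : ℍ) (v : P N) : ℂ × ℂ →ₗ[ℂ] P N :=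
  (LinearMap.fst ℂ ℂ ℂ).smulRight (dGamma g τ (autM g τ v))

theorem HasDifferential.congr_right {s : ℍ × ℂ → P N} {s' s'' : ℂ × ℂ →ₗ[ℂ] P N} {x : ℍ × ℂ}
    (h : HasDifferential s s' x) (e : ∀ ξ, s' ξ = s'' ξ) : HasDifferential s s'' x :=
  LinearMap.ext e ▸ h

theorem hasDifferential_autM_gen (g : JacobiGroup N) (x : ℍ × ℂ) (s : Gen N) :
    HasDifferential (fun y => autM g y.1 (gen s)) (dAutM g x.1 (gen s)) x := by
  have h0 := g.j_ne_zero x.1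
  have hk := kappa_ne_zero
  cases s with
  | X =>
    simp only [autM_X]
    refine (hasDifferential_smul_const (hasFDerivAt_j g x) _).congr_right fun ξ => ?_
    simp only [dAutM, autM_X, dGamma_X, _root_.map_smul, LinearMap.smulRight_apply, smul_smul]
    congr 1
    simp
    field_simp
  | Y =>
    simp only [autM_Y]
    refine ((hasDifferential_smul_const (hasFDerivAt_j_inv g x) _).add
      (hasDifferential_const _ x)).congr_right fun ξ => ?_
    simp only [dAutM, autM_Y, dGamma_X, dGamma_Y, _root_.map_smul, _root_.map_add,
      LinearMap.smulRight_apply, smul_smul, add_zero, LinearMap.fst_apply]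
    simp
    match_scalars <;> field_simp
    ring
  | t α =>
    simp only [autM_t]
    refine (hasDifferential_const _ x).congr_right fun ξ => ?_
    simp [dAutM, autM_t, dGamma_t]

theorem hasDifferential_autM (g : JacobiGroup N) (x : ℍ × ℂ) (v : P N) :
    HasDifferential (fun y => autM g y.1 v) (dAutM g x.1 v) x := by
  -- Closed under brackets by the product rule, because `dGamma` is a derivation; the generators
  -- then give the whole free Lie algebra.
  let S : LieSubalgebra ℂ (FreeL N) :=
    { carrier := {a | HasDifferential (fun y => autM g y.1 (incl a)) (dAutM g x.1 (incl a)) x}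
      zero_mem' := by
        change HasDifferential (fun y => autM g y.1 (incl 0)) (dAutM g x.1 (incl 0)) x
        simp only [_root_.map_zero]
        exact (hasDifferential_const _ x).congr_right fun ξ => by simp [dAutM]
      add_mem' := fun {a b} ha hb => by
        change HasDifferential (fun y => autM g y.1 (incl (a + b))) (dAutM g x.1 (incl (a + b))) x
        simp only [_root_.map_add]
        exact (HasDifferential.add ha hb).congr_right fun ξ => by simp [dAutM]
      smul_mem' := fun c a ha => by
        change HasDifferential (fun y => autM g y.1 (incl (c • a))) (dAutM g x.1 (incl (c • a))) x
        simp only [_root_.map_smul]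
        refine (HasDifferential.const_apply (f := c • LinearMap.id)
          (fun n v hv => (fil N n).smul_mem c hv) ha).congr_right fun ξ => ?_
        simp [dAutM, smul_comm c]
      lie_mem' := fun {a b} ha hb => by
        change HasDifferential (fun y => autM g y.1 (incl ⁅a, b⁆)) (dAutM g x.1 (incl ⁅a, b⁆)) x
        simp only [LieHom.map_lie]
        refine (HasDifferential.lie ha hb).congr_right fun ξ => ?_
        simp only [dAutM, LieHom.map_lie, der_lie, LinearMap.smulRight_apply, smul_add,
          LinearMap.sub_apply, LinearMap.comp_apply, adL_apply, lie_smul]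
        rw [← lie_skew (dGamma g x.1 (autM g x.1 (incl a))), smul_neg, sub_eq_add_neg, add_comm] }
  have hS : ∀ a, HasDifferential (fun y => autM g y.1 (incl a)) (dAutM g x.1 (incl a)) x := by
    intro a
    have h1 := lift_mem (fun s => FreeLieAlgebra.of ℂ s) S
      (fun s => hasDifferential_autM_gen g x s) a
    have h2 : FreeLieAlgebra.lift ℂ (fun s : Gen N => FreeLieAlgebra.of ℂ s) = LieHom.id :=
      FreeLieAlgebra.hom_ext fun s => by simp
    rw [h2] at h1
    exact h1
  -- A general element agrees with one of the free Lie algebra in the n-th truncation, and all the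
  -- maps involved respect it.
  intro n φ
  obtain ⟨a, ha⟩ := v.exists_rep n
  have hv : proj n v = proj n (incl a) := by rw [ha n le_rfl, proj_incl]
  have e1 : ∀ y : ℍ × ℂ, proj n (autM g y.1 v) = proj n (autM g y.1 (incl a)) := fun y =>
    (filPres_autM g y.1).proj_eq hv
  have hG : FilPres (dGamma g x.1 : P N →ₗ[ℂ] P N) := filPres_derOfGens _ _
  have e2 : proj n (dGamma g x.1 (autM g x.1 v)) = proj n (dGamma g x.1 (autM g x.1 (incl a))) :=
    hG.proj_eq (e1 x)
  simp only [e1]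
  refine (hS a n φ).congr_fderiv (ContinuousLinearMap.ext fun ξ => ?_)
  change φ (proj n (ξ.1 • dGamma g x.1 (autM g x.1 (incl a)))) =
    φ (proj n (ξ.1 • dGamma g x.1 (autM g x.1 v)))
  rw [_root_.map_smul, _root_.map_smul (proj n), e2]

/-- The differential of `exp(w X)`. -/
noncomputable def dExp (g : JacobiGroup N) (x : ℍ × ℂ) : ℂ × ℂ →ₗ[ℂ] P N →ₗ[ℂ] P N :=
  ((g.c : ℂ) • LinearMap.snd ℂ ℂ ℂ).smulRight (adL N (gen .X) ∘ₗ act (expSer (g.expo x.2)))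

theorem hasDifferential_exp (g : JacobiGroup N) (x : ℍ × ℂ) (v : P N) :
    HasDifferential (fun y => act (expSer (g.expo y.2)) v) ((dExp g x).flip v) x := fun n φ => by
  set e : ℕ → ℂ := fun k => φ (proj n (((LieAlgebra.ad ℂ (P N) (gen .X)) ^ k) v)) with he
  have h1 : ∀ k, HasFDerivAt (inCoord fun y => g.expo y.2 ^ k / (k.factorial : ℂ) * e k)
      ((g.c * (k * g.expo x.2 ^ (k - 1) / (k.factorial : ℂ) * e k)) •
        ContinuousLinearMap.snd ℂ ℂ ℂ) (coord x) := fun k => by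
    refine ((((hasFDerivAt_expo g x).pow k).mul_const ((k.factorial : ℂ)⁻¹ * e k)).congr_of_eventuallyEq
      (Filter.Eventually.of_forall fun w => ?_)).congr_fderiv (ContinuousLinearMap.ext fun ξ => ?_)
    · simp [inCoord, div_eq_mul_inv, mul_assoc]
    · simp [inCoord_coord]
      ring
  have h2 := HasFDerivAt.fun_sum (u := Finset.range n) fun k _ => h1 k
  refine (h2.congr_of_eventuallyEq (Filter.Eventually.of_forall fun w => ?_)).congr_fderiv
    (ContinuousLinearMap.ext fun ξ => ?_)
  · simp only [inCoord, proj_act, map_sum, _root_.map_smul, coeff_expSer, smul_eq_mul, he]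
  · have h3 : φ (proj n ((dExp g x).flip v ξ)) =
        g.c * ξ.2 * φ (proj n (act (expSer (g.expo x.2)) ⁅(gen .X : P N), v⁆)) := by
      rw [act_lie_X]
      simp [dExp, adL_apply, mul_assoc]
    change _ = φ (proj n ((dExp g x).flip v ξ))
    rw [h3, proj_act, map_sum, Finset.mul_sum, sum_apply]
    rcases n with _ | n
    · simp
    · rw [Finset.sum_range_succ', Finset.sum_range_succ (n := n)]
      have h4 : ∀ k, ((LieAlgebra.ad ℂ (P N) (gen .X)) ^ k) ⁅(gen .X : P N), v⁆ =
          ((LieAlgebra.ad ℂ (P N) (gen .X)) ^ (k + 1)) v := fun k => by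
        rw [pow_succ, Module.End.mul_apply, LieAlgebra.ad_apply]
      -- Differentiation lowers the degree in w by one, so the differentiated sum lacks the top
      -- term; that term is zero in this truncation.
      have h5 : proj (n + 1) (((LieAlgebra.ad ℂ (P N) (gen .X)) ^ (n + 1)) v) = 0 :=
        ad_pow_mem_fil _ _ _
      simp only [h4, h5, smul_zero, _root_.map_zero, mul_zero, add_zero]
      rw [show ((g.c * ((0 : ℕ) * g.expo x.2 ^ (0 - 1) / (Nat.factorial 0 : ℂ) * e 0)) •
        ContinuousLinearMap.snd ℂ ℂ ℂ) ξ = 0 by simp, add_zero]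
      refine Finset.sum_congr rfl fun k _ => ?_
      rw [_root_.map_smul, coeff_expSer, Nat.factorial_succ]
      have h6 : (k.factorial : ℂ) ≠ 0 := by exact_mod_cast Nat.factorial_ne_zero _
      have h7 : (k + 1 : ℂ) ≠ 0 := by exact_mod_cast Nat.succ_ne_zero k
      simp [he]
      field_simp

theorem filPres_dExp (g : JacobiGroup N) (x : ℍ × ℂ) (ξ : ℂ × ℂ) : FilPres (dExp g x ξ) :=
  fun n v hv => (fil N n).smul_mem _ ((fil N n).lie_mem (filPres_act _ n v hv))

theorem hasDifferential_automorphy (g : JacobiGroup N) (x : ℍ × ℂ) (v : P N) :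
    HasDifferential (fun y => automorphy g y v) (dAutomorphy g x v) x := by
  simp only [automorphy_eq]
  refine (HasDifferential.apply (A := fun y => act (expSer (g.expo y.2)))
    (fun y => filPres_act _) (filPres_dExp g x) (hasDifferential_exp g x)
    (hasDifferential_autM g x v)).congr_right fun ξ => ?_
  have e1 : dAutomorphy g x v ξ = (g.c * ξ.2) • ⁅(gen .X : P N), automorphy g x v⁆ +
    ξ.1 • act (expSer (g.expo x.2)) (dGamma g x.1 (autM g x.1 v)) := rfl
  rw [e1, automorphy_eq]
  simp [dAutM, dExp, adL_apply, add_comm]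

theorem filPres_automorphy (g : JacobiGroup N) (x : ℍ × ℂ) :
    FilPres (automorphy g x : P N →ₗ[ℂ] P N) := fun n v hv => by
  change automorphy g x v ∈ fil N n
  rw [automorphy_eq]
  exact filPres_act _ n _ (filPres_autM g x.1 n v hv)

theorem isHol_automorphy (g : JacobiGroup N) (v : P N) :
    IsHol Set.univ (fun x => automorphy g x v) :=
  isHol_of_hasDifferential isOpen_univ fun x _ => ⟨_, hasDifferential_automorphy g x v⟩

/-- `dAutomorphy` as a bilinear map. -/
noncomputable def dAutL (g : JacobiGroup N) (x : ℍ × ℂ) : ℂ × ℂ →ₗ[ℂ] P N →ₗ[ℂ] P N :=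
  LinearMap.mk₂ ℂ (fun ξ v => dAutomorphy g x v ξ) (fun ξ η v => by simp) (fun c ξ v => by simp)
    (fun _ u v => by simp [dAutomorphy]; abel) (fun c ξ v => by
      simp [dAutomorphy, smul_comm c])

theorem hasDifferential_automorphy_apply (g : JacobiGroup N) {x : ℍ × ℂ} {s : ℍ × ℂ → P N}
    {s' : ℂ × ℂ →ₗ[ℂ] P N} (hs : HasDifferential s s' x) :
    HasDifferential (fun y => automorphy g y (s y))
      ((automorphy g x : P N →ₗ[ℂ] P N) ∘ₗ s' + dAutomorphy g x (s x)) x :=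
  HasDifferential.apply (A := fun y => (automorphy g y : P N →ₗ[ℂ] P N)) (A' := dAutL g x)
    (fun y => filPres_automorphy g y)
    (fun _ n v hv => (fil N n).add_mem ((fil N n).smul_mem _ ((fil N n).lie_mem
      (filPres_automorphy g x n v hv))) ((fil N n).smul_mem _ (filPres_act _ n _
        (filPres_derOfGens _ _ n _ (filPres_autM g x.1 n v hv)))))
    (fun v => hasDifferential_automorphy g x v) hs

end AutomorphyCalculus

/-! ### The covariant derivative commutes with the group. -/

section Equivariance

variable {N : ℕ} [NeZero N]

theorem continuous_smul_jacobi (g : JacobiGroup N) : Continuous fun x : ℍ × ℂ => g • x := by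
  have hj : Continuous fun x : ℍ × ℂ => g.j x.1 := by
    unfold JacobiGroup.j
    fun_prop
  have h1 : Continuous fun x : ℍ × ℂ => g.γ • x.1 := by
    rw [UpperHalfPlane.isEmbedding_coe.continuous_iff]
    have : (fun τ : ℍ => (τ : ℂ)) ∘ (fun x : ℍ × ℂ => g.γ • x.1) =
        fun x => (g.a * x.1 + g.b) / g.j x.1 := funext fun x => JacobiGroup.coe_smul g x.1
    change Continuous ((fun τ : ℍ => (τ : ℂ)) ∘ fun x : ℍ × ℂ => g.γ • x.1)
    rw [this]
    exact Continuous.div (by fun_prop) hj fun x => g.j_ne_zero x.1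
  exact h1.prodMk (Continuous.div (by fun_prop) hj fun x => g.j_ne_zero x.1)

theorem HasDifferential.comp_smul (h : JacobiGroup N) {y : ℍ × ℂ} {t : ℍ × ℂ → P N}
    {t' : ℂ × ℂ →ₗ[ℂ] P N} (ht : HasDifferential t t' (h • y)) :
    HasDifferential (fun y => t (h • y)) (t' ∘ₗ dAct h y) y := fun n φ => by
  have h1 := hasFDerivAt_smul h y
  have h2 := ht n φ
  rw [← inCoord_coord (fun y => coord (h • y)) y] at h2
  refine ((h2.comp (coord y) h1).congr_of_eventuallyEq
    (Filter.Eventually.of_forall fun w => ?_)).congr_fderiv ?_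
  · change φ (proj n (t (h • _))) = inCoord (fun y => φ (proj n (t y))) (coord (h • _))
    rw [inCoord_coord]
  · refine ContinuousLinearMap.ext fun ξ => ?_
    change _ = φ (proj n (t' (dAct h y ξ)))
    rw [dAct, h1.fderiv]
    rfl

theorem pushSection_smul (g : JacobiGroup N) (s : ℍ × ℂ → P N) (x : ℍ × ℂ) :
    pushSection g s (g • x) = automorphy g x (s x) := by
  rw [pushSection, inv_smul_smul]

theorem isHol_pushSection (g : JacobiGroup N) {W : Set (ℍ × ℂ)} {s : ℍ × ℂ → P N} (hW : IsOpen W)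
    (hs : IsHol W s) : IsHol {y | g⁻¹ • y ∈ W} (pushSection g s) := by
  refine isHol_of_hasDifferential (hW.preimage (continuous_smul_jacobi g⁻¹)) fun y hy => ?_
  obtain ⟨s', hs'⟩ := hs.exists_hasDifferential (x := g⁻¹ • y) hy
  exact ⟨_, (hasDifferential_automorphy_apply g hs').comp_smul g⁻¹⟩

theorem Omega_smul_dAct (g : JacobiGroup N) {x : ℍ × ℂ} (hx : x ∉ torsionLocus N) (ξ : ℂ × ℂ)
    (u : P N) : Omega N (g • x) (dAct g x ξ) (automorphy g x u) =
      automorphy g x (Omega N x ξ u) - dAutomorphy g x u ξ := by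
  rw [dAct_apply, Omega_smul g hx]

/-- By the chain rule, differentiating (gs)(gx) = M_g(x)s(x) adds (dM_g)s, which is what the gauge
law of Ω_N subtracts. -/
theorem covD_pushSection (g : JacobiGroup N) {W : Set (ℍ × ℂ)} {s : ℍ × ℂ → P N} (hW : IsOpen W)
    (hs : IsHol W s) {x : ℍ × ℂ} (hxW : x ∈ W) (hx : x ∉ torsionLocus N) (ξ : ℂ × ℂ) :
    covD (pushSection g s) (g • x) (dAct g x ξ) = automorphy g x (covD s x ξ) := by
  have h1 := (isHol_pushSection g hW hs).hasDifferential (x := g • x)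
    (by change g⁻¹ • g • x ∈ W; rwa [inv_smul_smul])
  have h2 := h1.comp_smul g
  simp only [pushSection_smul] at h2
  have h3 := hasDifferential_automorphy_apply g (hs.hasDifferential hxW)
  have h4 := LinearMap.congr_fun (hasDifferential_unique h2 h3) ξ
  have e1 : covD (pushSection g s) (g • x) (dAct g x ξ) =
      differential (pushSection g s) (g • x) (dAct g x ξ) +
        Omega N (g • x) (dAct g x ξ) (pushSection g s (g • x)) := rfl
  have e2 : covD s x ξ = differential s x ξ + Omega N x ξ (s x) := rfl
  have e3 : differential (pushSection g s) (g • x) (dAct g x ξ) =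
      automorphy g x (differential s x ξ) + dAutomorphy g x (s x) ξ := h4
  rw [e1, e2, e3, pushSection_smul, Omega_smul_dAct g hx, _root_.map_add]
  abel

end Equivariance

/-! ### The torsion locus is closed, locally a single section, and invariant. -/

section TorsionLocus

variable {N : ℕ} [NeZero N]

/-- Multiplication by N reduces questions about Λ_N to the lattice, hence to the zeros of θ. -/
theorem mem_torsionLocus_iff {x : ℍ × ℂ} :
    x ∈ torsionLocus N ↔ InLattice x.1 (N * x.2) := by
  have hN : (N : ℂ) ≠ 0 := Nat.cast_ne_zero.2 (NeZero.ne N)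
  constructor
  · rintro ⟨a, b, h⟩
    exact ⟨b, a, by rw [h]; field_simp; ring⟩
  · rintro ⟨m, n, h⟩
    refine ⟨n, m, mul_left_cancel₀ hN ?_⟩
    rw [h]
    field_simp
    ring

theorem isOpen_compl_torsionLocus : IsOpen (torsionLocus N)ᶜ := by
  rw [isOpen_iff_mem_nhds]
  intro x hx
  have h1 : ¬ InLattice x.1 (N * x.2) := fun h => hx (mem_torsionLocus_iff.2 h)
  have h2 : Filter.Tendsto (fun y : ℍ × ℂ => ((N : ℂ) * y.2, (y.1 : ℂ))) (𝓝 x)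
      (𝓝 (N * x.2, (x.1 : ℂ))) := Continuous.tendsto' (by fun_prop) _ _ rfl
  filter_upwards [h2.eventually (eventually_not_inLattice_of_not x.1.im_pos h1)] with y hy h3
  exact hy.2 (mem_torsionLocus_iff.1 h3)

/-- Locally the torsion locus consists of a single section. -/
theorem eventually_not_mem_torsionLocus {x : ℍ × ℂ} {a b : ℤ}
    (h : x.2 = (a : ℂ) / N + (b : ℂ) / N * x.1) :
    ∀ᶠ y : ℍ × ℂ in 𝓝 x, y.2 - (a : ℂ) / N - (b : ℂ) / N * y.1 ≠ 0 → y ∉ torsionLocus N := by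
  have hN : (N : ℂ) ≠ 0 := Nat.cast_ne_zero.2 (NeZero.ne N)
  have h2 : Filter.Tendsto (fun y : ℍ × ℂ => ((N : ℂ) * y.2 - a - b * y.1, (y.1 : ℂ))) (𝓝 x)
      (𝓝 (0, (x.1 : ℂ))) := by
    refine Continuous.tendsto' (by fun_prop) _ _ (Prod.ext ?_ rfl)
    dsimp only
    rw [h]
    field_simp
    ring
  filter_upwards [h2.eventually (eventually_not_inLattice_zero x.1.im_pos)] with y hy hne hmem
  obtain ⟨m, n, hmn⟩ := mem_torsionLocus_iff.1 hmem
  rcases hy.2 with h0 | h0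
  · refine hne (mul_left_cancel₀ hN ?_)
    rw [mul_zero, ← h0]
    field_simp
  · exact h0 ⟨m - b, n - a, by rw [hmn]; push_cast; ring⟩

theorem smul_mem_torsionLocus (g : JacobiGroup N) {x : ℍ × ℂ} (hx : x ∈ torsionLocus N) :
    g • x ∈ torsionLocus N := by
  rw [mem_torsionLocus_iff] at hx ⊢
  obtain ⟨q, p, h⟩ := hx
  refine ⟨(q + N * g.m) * g.d - (p + N * g.n) * g.c,
    (p + N * g.n) * g.a - (q + N * g.m) * g.b, ?_⟩
  have h0 := g.j_ne_zero x.1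
  rw [JacobiGroup.smul_snd, JacobiGroup.coe_smul_fst]
  field_simp
  rw [JacobiGroup.j]
  push_cast
  linear_combination h - (((q : ℂ) + N * g.m) * x.1 + (p + N * g.n)) * g.det_complex

theorem smul_mem_torsionLocus_iff (g : JacobiGroup N) {x : ℍ × ℂ} :
    g • x ∈ torsionLocus N ↔ x ∈ torsionLocus N := by
  refine ⟨fun h => ?_, smul_mem_torsionLocus g⟩
  have := smul_mem_torsionLocus g⁻¹ h
  rwa [inv_smul_smul] at this

end TorsionLocus

/-! ### Logarithmic poles of Ω_N and of covariant derivatives. -/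

section LogForm

variable {N : ℕ} [NeZero N]

theorem filPres_adL_flip (v : P N) : FilPres ((adL N).flip v) := fun n u hu => by
  change ⁅u, v⁆ ∈ fil N n
  rw [← lie_skew]
  exact (fil N n).neg_mem ((fil N n).lie_mem hu)

/-- The coefficient of `ad_X^k t_α` in a functional of a bracket with `v`. -/
noncomputable def bracketCoef {n : ℕ} (φ : Trunc N n →ₗ[ℂ] ℂ) (v : P N) (α : ZMod N × ZMod N)
    (k : ℕ) : ℂ := φ (proj n ⁅((LieAlgebra.ad ℂ (P N) (gen .X)) ^ k) (gen (.t α)), v⁆)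

theorem functional_lie_sum_act {n : ℕ} (φ : Trunc N n →ₗ[ℂ] ℂ) (v : P N)
    (p : ZMod N × ZMod N → PowerSeries ℂ) :
    φ (proj n ⁅∑ α, act (p α) (gen (.t α)), v⁆) = ∑ α, ∑ k ∈ Finset.range n,
      PowerSeries.coeff k (p α) * bracketCoef φ v α k := by
  rw [sum_lie, map_sum, map_sum]
  refine Finset.sum_congr rfl fun α _ => ?_
  have h := (filPres_adL_flip v).proj_act (p α) (gen (.t α)) n
  change proj n ⁅act (p α) (gen (.t α)), v⁆ = _ at h
  rw [h, map_sum]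
  simp only [_root_.map_smul, smul_eq_mul]
  rfl

/-- The coefficient of `dτ` in `Ω_N v`, up to the part that is holomorphic everywhere. -/
noncomputable def regCoef {n : ℕ} (φ : Trunc N n →ₗ[ℂ] ℂ) (v : P N) (τ : ℂ) : ℂ :=
  φ (proj n (κ • derYdX N v)) + ∑ m ∈ Finset.range n, 1 / 2 * ∑ α : ZMod N × ZMod N,
    coeffA m α τ * φ (proj n (delta m α v))

theorem functional_Omega {n : ℕ} (φ : Trunc N n →ₗ[ℂ] ℂ) (v : P N) (x : ℍ × ℂ) (ξ : ℂ × ℂ) :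
    φ (proj n (Omega N x ξ v)) =
      ξ.1 * (regCoef φ v x.1 + ∑ α, ∑ k ∈ Finset.range n,
        PowerSeries.coeff k (gSer α x.2 x.1) * bracketCoef φ v α k) +
      ξ.2 * (φ (proj n (κ • ⁅(gen .Y : P N), v⁆)) + ∑ α, ∑ k ∈ Finset.range n,
        PowerSeries.coeff k (hSer α x.2 x.1) * bracketCoef φ v α k) := by
  rw [Omega_apply, nuOne_eq, nuTwo_eq, add_lie, smul_lie, regCoef, ← functional_lie_sum_act,
    ← functional_lie_sum_act]
  simp only [map_add, _root_.map_smul, smul_eq_mul, proj_psiDer, map_sum]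

theorem analyticAt_regCoef {n : ℕ} (φ : Trunc N n →ₗ[ℂ] ℂ) (v : P N) {w : ℂ × ℂ}
    (hw : 0 < w.1.im) : AnalyticAt ℂ (fun w : ℂ × ℂ => regCoef φ v w.1) w := by
  unfold regCoef
  refine analyticAt_const.add (Finset.analyticAt_fun_sum _ fun m _ => analyticAt_const.mul
    (Finset.analyticAt_fun_sum _ fun α _ => AnalyticAt.mul ?_ analyticAt_const))
  exact AnalyticAt.fun_comp (g := coeffA m α) (f := fun w : ℂ × ℂ => w.1)
    (analyticAt_coeffA hw m α) analyticAt_fst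

/-- The coefficients of `Ω_N v` in terms of coordinates. -/
noncomputable def tauCoef {n : ℕ} (φ : Trunc N n →ₗ[ℂ] ℂ) (v : P N) (w : ℂ × ℂ) : ℂ :=
  regCoef φ v w.1 + ∑ α, ∑ k ∈ Finset.range n,
    PowerSeries.coeff k (gSer α w.2 w.1) * bracketCoef φ v α k

/-- The coefficients of `Ω_N v` in terms of coordinates. -/
noncomputable def zCoef {n : ℕ} (φ : Trunc N n →ₗ[ℂ] ℂ) (v : P N) (w : ℂ × ℂ) : ℂ :=
  φ (proj n (κ • ⁅(gen .Y : P N), v⁆)) + ∑ α, ∑ k ∈ Finset.range n,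
    PowerSeries.coeff k (hSer α w.2 w.1) * bracketCoef φ v α k

theorem analyticAt_tauCoef {n : ℕ} (φ : Trunc N n →ₗ[ℂ] ℂ) (v : P N) {x : ℍ × ℂ}
    (hx : x ∉ torsionLocus N) : AnalyticAt ℂ (tauCoef φ v) (coord x) :=
  (analyticAt_regCoef φ v x.1.im_pos).add (Finset.analyticAt_fun_sum _ fun α _ =>
    Finset.analyticAt_fun_sum _ fun k _ => (analyticAt_coeff_gSer x.1.im_pos
      (not_inLattice_of_not_mem hx α) k).mul analyticAt_const)

theorem analyticAt_zCoef {n : ℕ} (φ : Trunc N n →ₗ[ℂ] ℂ) (v : P N) {x : ℍ × ℂ}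
    (hx : x ∉ torsionLocus N) : AnalyticAt ℂ (zCoef φ v) (coord x) :=
  analyticAt_const.add (Finset.analyticAt_fun_sum _ fun α _ =>
    Finset.analyticAt_fun_sum _ fun k _ => (analyticAt_coeff_hSer x.1.im_pos
      (not_inLattice_of_not_mem hx α) k).mul analyticAt_const)

/-- The simple poles of the coefficients of `Ω_N v` along a torsion section. -/
theorem exists_pole_Omega {n : ℕ} (φ : Trunc N n →ₗ[ℂ] ℂ) (v : P N) {x : ℍ × ℂ} (a b : ℤ)
    (hx : x.2 = (a : ℂ) / N + (b : ℂ) / N * (x.1 : ℂ)) :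
    ∃ (r : ℂ) (p q : ℂ × ℂ → ℂ), AnalyticAt ℂ p (coord x) ∧ AnalyticAt ℂ q (coord x) ∧
      ∀ᶠ w : ℂ × ℂ in 𝓝 (coord x), w.2 - (a : ℂ) / N - (b : ℂ) / N * w.1 ≠ 0 →
        tauCoef φ v w = p w - (b : ℂ) / N * r / (w.2 - (a : ℂ) / N - (b : ℂ) / N * w.1) ∧
        zCoef φ v w = q w + r / (w.2 - (a : ℂ) / N - (b : ℂ) / N * w.1) := by
  choose ρ hρ using exists_pole_hSer (N := N) (w := coord x) x.1.im_pos a b hx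
  choose q hq hqe using hρ
  refine ⟨∑ α, ∑ k ∈ Finset.range n, ρ α * ((-((b : ℂ) / N)) ^ k / k.factorial) *
      bracketCoef φ v α k,
    fun w => regCoef φ v w.1 + ∑ α, ∑ k ∈ Finset.range n, q α (k + 1) w * (k + 1) *
      bracketCoef φ v α k,
    fun w => φ (proj n (κ • ⁅(gen .Y : P N), v⁆)) + ∑ α, ∑ k ∈ Finset.range n, q α k w *
      bracketCoef φ v α k, ?_, ?_, ?_⟩
  · exact (analyticAt_regCoef φ v x.1.im_pos).add (Finset.analyticAt_fun_sum _ fun α _ =>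
      Finset.analyticAt_fun_sum _ fun k _ => ((hq α (k + 1)).mul analyticAt_const).mul
        analyticAt_const)
  · exact analyticAt_const.add (Finset.analyticAt_fun_sum _ fun α _ =>
      Finset.analyticAt_fun_sum _ fun k _ => (hq α k).mul analyticAt_const)
  -- The range goes one step beyond n because the k-th coefficient of g_α involves the (k + 1)-st of
  -- h_α.
  · have hall : ∀ᶠ w : ℂ × ℂ in 𝓝 (coord x), ∀ α, ∀ k ∈ Finset.range (n + 1), _ :=
      Filter.eventually_all.2 fun α => (Filter.eventually_all_finset _).2 fun k _ => hqe α k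
    filter_upwards [hall] with w hw hne
    constructor
    · rw [tauCoef, add_sub_assoc, Finset.mul_sum, Finset.sum_div, ← Finset.sum_sub_distrib]
      congr 1
      refine Finset.sum_congr rfl fun α _ => ?_
      rw [Finset.mul_sum, Finset.sum_div, ← Finset.sum_sub_distrib]
      refine Finset.sum_congr rfl fun k hk => ?_
      have hk' := Finset.mem_range.1 hk
      rw [(hw α k (Finset.mem_range.2 (by omega)) hne).2,
        (hw α (k + 1) (Finset.mem_range.2 (by omega)) hne).1, Nat.factorial_succ]
      have h6 : (k.factorial : ℂ) ≠ 0 := by exact_mod_cast Nat.factorial_ne_zero _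
      have h7 : (k + 1 : ℂ) ≠ 0 := by exact_mod_cast Nat.succ_ne_zero k
      -- As (k + 1)/(k + 1)! = 1/k!, the residue of g_α differs from that of h_α only by the extra
      -- factor -b/N.
      rw [pow_succ (-((b : ℂ) / N))]
      generalize -((b : ℂ) / N) ^ k = B
      generalize hB : (b : ℂ) / N = β at hne ⊢
      push_cast
      field_simp
      ring
    · rw [zCoef, add_assoc, Finset.sum_div, ← Finset.sum_add_distrib]
      congr 1
      refine Finset.sum_congr rfl fun α _ => ?_
      rw [Finset.sum_div, ← Finset.sum_add_distrib]
      refine Finset.sum_congr rfl fun k hk => ?_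
      have hk' := Finset.mem_range.1 hk
      rw [(hw α k (Finset.mem_range.2 (by omega)) hne).1]
      ring

/-- The covariant derivative in terms of coordinates. -/
theorem functional_covD {n : ℕ} (φ : Trunc N n →ₗ[ℂ] ℂ) {d : ℕ} {v : Fin d → P N}
    {c : Fin d → Trunc N n →ₗ[ℂ] ℂ} (hc : ∀ u, u = ∑ i, c i u • proj n (v i)) {W : Set (ℍ × ℂ)}
    {s : ℍ × ℂ → P N} (hs : IsHol W s) {x : ℍ × ℂ} (hx : x ∈ W) (ξ : ℂ × ℂ) :
    φ (proj n (covD s x ξ)) = fderiv ℂ (inCoord fun y => φ (proj n (s y))) (coord x) ξ +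
      (ξ.1 * ∑ i, c i (proj n (s x)) * tauCoef φ (v i) (coord x) +
        ξ.2 * ∑ i, c i (proj n (s x)) * zCoef φ (v i) (coord x)) := by
  have e : covD s x ξ = differential s x ξ + Omega N x ξ (s x) := rfl
  have hO : FilPres (Omega N x ξ : P N →ₗ[ℂ] P N) := fun n u hu => by
    change Omega N x ξ u ∈ fil N n
    rw [Omega_apply]
    have hY : FilPres (derYdX N : P N →ₗ[ℂ] P N) := filPres_derOfGens _ _
    exact (fil N n).add_mem ((fil N n).smul_mem _ ((fil N n).add_mem ((fil N n).add_mem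
      ((fil N n).smul_mem _ (hY n u hu)) (filPres_psiDer _ n u hu)) ((fil N n).lie_mem hu)))
      ((fil N n).smul_mem _ ((fil N n).lie_mem hu))
  have e2 := hO.proj_sum hc (s x)
  change proj n (Omega N x ξ (s x)) = ∑ i, c i (proj n (s x)) • proj n (Omega N x ξ (v i)) at e2
  rw [e, map_add, map_add, (hs.hasDifferential hx n φ).fderiv, e2, map_sum]
  congr 1
  rw [Finset.mul_sum, Finset.mul_sum, ← Finset.sum_add_distrib]
  refine Finset.sum_congr rfl fun i _ => ?_
  rw [_root_.map_smul, functional_Omega, smul_eq_mul]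
  change _ * (ξ.1 * tauCoef φ (v i) (coord x) + ξ.2 * zCoef φ (v i) (coord x)) = _
  ring

/-- The covariant derivative of a holomorphic section is a logarithmic form. -/
theorem isLogForm_covD {W : Set (ℍ × ℂ)} (hW : IsOpen W) {s : ℍ × ℂ → P N} (hs : IsHol W s)
    {ω : ℍ × ℂ → (ℂ × ℂ →ₗ[ℂ] P N)} (hω : ∀ x ∈ W \ torsionLocus N, ω x = covD s x) :
    IsLogForm W ω := by
  have hF : ∀ (n : ℕ) (φ : Trunc N n →ₗ[ℂ] ℂ) (x : ℍ × ℂ), x ∈ W → ∀ ξ : ℂ × ℂ,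
      AnalyticAt ℂ (fun w => fderiv ℂ (inCoord fun y => φ (proj n (s y))) w ξ) (coord x) :=
    fun n φ x hx ξ => ((ContinuousLinearMap.apply ℂ ℂ ξ).analyticAt _).fun_comp
      (hs n φ x hx).fderiv
  refine ⟨fun ξ n φ x hx => ?_, fun x hx a b hab n φ => ?_⟩
  · obtain ⟨d, v, c, hc⟩ := exists_lifted_basis N n
    have h1 : AnalyticAt ℂ (fun w => fderiv ℂ (inCoord fun y => φ (proj n (s y))) w ξ +
        (ξ.1 * ∑ i, inCoord (fun y => c i (proj n (s y))) w * tauCoef φ (v i) w +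
          ξ.2 * ∑ i, inCoord (fun y => c i (proj n (s y))) w * zCoef φ (v i) w)) (coord x) :=
      (hF n φ x hx.1 ξ).add ((analyticAt_const.mul (Finset.analyticAt_fun_sum _ fun i _ =>
        (hs n (c i) x hx.1).mul (analyticAt_tauCoef φ (v i) hx.2))).add
        (analyticAt_const.mul (Finset.analyticAt_fun_sum _ fun i _ =>
        (hs n (c i) x hx.1).mul (analyticAt_zCoef φ (v i) hx.2))))
    refine h1.congr ?_
    have hev : ∀ᶠ y in 𝓝 x, y ∈ W \ torsionLocus N :=
      (hW.inter isOpen_compl_torsionLocus).mem_nhds hx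
    filter_upwards [eventually_coord hev] with w hw
    change _ = φ (proj n (ω (_, _) ξ))
    rw [hω _ hw.2, functional_covD φ hc hs hw.2.1, hw.1]
    rfl
  · obtain ⟨d, v, c, hc⟩ := exists_lifted_basis N n
    choose r p q hp hq he using fun i => exists_pole_Omega φ (v i) a b hab
    refine ⟨fun w => fderiv ℂ (inCoord fun y => φ (proj n (s y))) w (1, 0) +
        ∑ i, inCoord (fun y => c i (proj n (s y))) w * p i w,
      fun w => fderiv ℂ (inCoord fun y => φ (proj n (s y))) w (0, 1) +
        ∑ i, inCoord (fun y => c i (proj n (s y))) w * q i w,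
      fun w => ∑ i, inCoord (fun y => c i (proj n (s y))) w * r i, ?_, ?_, ?_, ?_⟩
    · exact (hF n φ x hx _).add (Finset.analyticAt_fun_sum _ fun i _ =>
        (hs n (c i) x hx).mul (hp i))
    · exact (hF n φ x hx _).add (Finset.analyticAt_fun_sum _ fun i _ =>
        (hs n (c i) x hx).mul (hq i))
    · exact Finset.analyticAt_fun_sum _ fun i _ => (hs n (c i) x hx).mul analyticAt_const
    · have hev : ∀ᶠ y in 𝓝 x, y ∈ W ∧
          (y.2 - (a : ℂ) / N - (b : ℂ) / N * y.1 ≠ 0 → y ∉ torsionLocus N) :=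
        Filter.Eventually.and (hW.mem_nhds hx) (eventually_not_mem_torsionLocus hab)
      filter_upwards [eventually_coord hev, Filter.eventually_all.2 he] with w hw hwe hne ξ
      have hfst : ((UpperHalfPlane.ofComplex w.1 : ℍ) : ℂ) = w.1 := congrArg Prod.fst hw.1
      have hmem := hw.2.2 (by rwa [hfst])
      change φ (proj n (ω (_, _) ξ)) = _
      rw [hω _ ⟨hw.2.1, hmem⟩, functional_covD φ hc hs hw.2.1, hw.1]
      have hlin : fderiv ℂ (inCoord fun y => φ (proj n (s y))) w ξ =
          fderiv ℂ (inCoord fun y => φ (proj n (s y))) w (1, 0) * ξ.1 +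
            fderiv ℂ (inCoord fun y => φ (proj n (s y))) w (0, 1) * ξ.2 := by
        have : ξ = ξ.1 • ((1, 0) : ℂ × ℂ) + ξ.2 • ((0, 1) : ℂ × ℂ) := by ext <;> simp
        conv_lhs => rw [this, map_add, _root_.map_smul, _root_.map_smul]
        simp [mul_comm]
      rw [hlin]
      change _ + (ξ.1 * ∑ i, inCoord (fun y => c i (proj n (s y))) w * tauCoef φ (v i) w +
        ξ.2 * ∑ i, inCoord (fun y => c i (proj n (s y))) w * zCoef φ (v i) w) = _
      have e1 : ∑ i, inCoord (fun y => c i (proj n (s y))) w * tauCoef φ (v i) w =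
          ∑ i, inCoord (fun y => c i (proj n (s y))) w * p i w - (b : ℂ) / N *
            (∑ i, inCoord (fun y => c i (proj n (s y))) w * r i) /
              (w.2 - (a : ℂ) / N - (b : ℂ) / N * w.1) := by
        rw [Finset.mul_sum, Finset.sum_div, ← Finset.sum_sub_distrib]
        refine Finset.sum_congr rfl fun i _ => ?_
        rw [(hwe i hne).1]
        ring
      have e2 : ∑ i, inCoord (fun y => c i (proj n (s y))) w * zCoef φ (v i) w =
          ∑ i, inCoord (fun y => c i (proj n (s y))) w * q i w +
            (∑ i, inCoord (fun y => c i (proj n (s y))) w * r i) /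
              (w.2 - (a : ℂ) / N - (b : ℂ) / N * w.1) := by
        rw [Finset.sum_div, ← Finset.sum_add_distrib]
        refine Finset.sum_congr rfl fun i _ => ?_
        rw [(hwe i hne).2]
        ring
      -- The polar parts -(b/N)r dτ/ℓ and r dz/ℓ combine to r dℓ/ℓ.
      rw [e1, e2]
      ring

theorem isHol_const (W : Set (ℍ × ℂ)) (v : P N) : IsHol W (fun _ => v) := fun _ _ _ _ =>
  analyticAt_const

/-- Ω_N v is the covariant derivative of the constant section v. -/
theorem isLogForm_OmegaApply (v : P N) : IsLogForm Set.univ (fun x => OmegaApply N x v) :=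
  isLogForm_covD isOpen_univ (isHol_const Set.univ v) fun x _ => by
    rw [covD, (hasDifferential_const v x).differential_eq, zero_add]

end LogForm

/-! ### Descent to the universal elliptic curve. -/

section Descent

variable {N : ℕ} [NeZero N]

theorem isOpen_pre (U : TopologicalSpace.Opens (E N)) : IsOpen (pre U) :=
  U.isOpen.preimage continuous_quotient_mk'

theorem smul_mem_pre (U : TopologicalSpace.Opens (E N)) (g : JacobiGroup N) (x : ℍ × ℂ) :
    g • x ∈ pre U ↔ x ∈ pre U := by
  change toE (g • x) ∈ U ↔ toE x ∈ U
  rw [toE_smul]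

theorem smul_mem_pre_diff (U : TopologicalSpace.Opens (E N)) (g : JacobiGroup N) (x : ℍ × ℂ) :
    g • x ∈ pre U \ torsionLocus N ↔ x ∈ pre U \ torsionLocus N :=
  and_congr (smul_mem_pre U g x) (not_congr (smul_mem_torsionLocus_iff g))

theorem pushSection_eq {U : TopologicalSpace.Opens (E N)} (s : Sections U) (g : JacobiGroup N) :
    pushSection g s.1 = s.1 := funext fun y => by
  have h := congrArg Total.vec (s.2.2.1 g (g⁻¹ • y))
  change automorphy g (g⁻¹ • y) (s.1 (g⁻¹ • y)) = s.1 (g • g⁻¹ • y) at h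
  rw [pushSection, h, smul_inv_smul]

open Classical in
/-- The covariant derivative outside the torsion sections. -/
noncomputable def nablaVal (U : TopologicalSpace.Opens (E N)) (s : ℍ × ℂ → P N) (x : ℍ × ℂ) :
    ℂ × ℂ →ₗ[ℂ] P N :=
  if x ∈ pre U \ torsionLocus N then covD s x else 0

theorem nablaVal_of_mem {U : TopologicalSpace.Opens (E N)} (s : ℍ × ℂ → P N) {x : ℍ × ℂ}
    (hx : x ∈ pre U \ torsionLocus N) : nablaVal U s x = covD s x := if_pos hx

theorem nablaVal_of_not_mem {U : TopologicalSpace.Opens (E N)} (s : ℍ × ℂ → P N) {x : ℍ × ℂ}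
    (hx : x ∉ pre U \ torsionLocus N) : nablaVal U s x = 0 := if_neg hx

/-- An equivariant section satisfies gs = s, so ∇(gs) = g(∇s) says that ∇s is equivariant; Λ_N is
invariant, so the extension by zero keeps this. -/
theorem nablaVal_mem {U : TopologicalSpace.Opens (E N)} (s : Sections U) :
    nablaVal U s.1 ∈ LogForms U := by
  refine ⟨isLogForm_covD (isOpen_pre U) s.2.1 fun x hx => nablaVal_of_mem s.1 hx,
    fun g x ξ => ?_, fun x hx => nablaVal_of_not_mem s.1 hx⟩
  by_cases hx : x ∈ pre U \ torsionLocus N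
  · rw [nablaVal_of_mem _ hx, nablaVal_of_mem _ ((smul_mem_pre_diff U g x).2 hx)]
    have h := covD_pushSection g (isOpen_pre U) s.2.1 hx.1 hx.2 ξ
    rwa [pushSection_eq] at h
  · rw [nablaVal_of_not_mem _ hx, nablaVal_of_not_mem _ fun h => hx ((smul_mem_pre_diff U g x).1 h)]
    simp

theorem covD_of_hasDifferential {s : ℍ × ℂ → P N} {s' : ℂ × ℂ →ₗ[ℂ] P N} {x : ℍ × ℂ}
    (h : HasDifferential s s' x) (ξ : ℂ × ℂ) : covD s x ξ = s' ξ + Omega N x ξ (s x) := by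
  rw [covD, h.differential_eq]
  rfl

theorem covD_add {W : Set (ℍ × ℂ)} {s t : ℍ × ℂ → P N} (hs : IsHol W s) (ht : IsHol W t)
    {x : ℍ × ℂ} (hx : x ∈ W) : covD (s + t) x = covD s x + covD t x := by
  have h1 := hs.hasDifferential hx
  have h2 := ht.hasDifferential hx
  refine LinearMap.ext fun ξ => ?_
  rw [LinearMap.add_apply, covD_of_hasDifferential (s := s + t) (h1.add h2),
    covD_of_hasDifferential h1, covD_of_hasDifferential h2, Pi.add_apply, _root_.map_add,
    LinearMap.add_apply]
  abel

theorem covD_const_smul {W : Set (ℍ × ℂ)} (c : ℂ) {s : ℍ × ℂ → P N} (hs : IsHol W s)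
    {x : ℍ × ℂ} (hx : x ∈ W) : covD (c • s) x = c • covD s x := by
  have h1 := hs.hasDifferential hx
  have h2 : HasDifferential (c • s) (c • differential s x) x := fun n φ => by
    refine (((h1 n φ).const_mul c).congr_of_eventuallyEq
      (Filter.Eventually.of_forall fun w => ?_)).congr_fderiv (ContinuousLinearMap.ext fun ξ => ?_)
    · simp [inCoord]
    · simp
  refine LinearMap.ext fun ξ => ?_
  rw [LinearMap.smul_apply, covD_of_hasDifferential h2, covD_of_hasDifferential h1, Pi.smul_apply,
    _root_.map_smul, smul_add, LinearMap.smul_apply]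

theorem covD_congr {W : Set (ℍ × ℂ)} (hW : IsOpen W) {s t : ℍ × ℂ → P N} (hs : IsHol W s)
    (hst : ∀ y ∈ W, t y = s y) {x : ℍ × ℂ} (hx : x ∈ W) : covD t x = covD s x := by
  have h1 := hs.hasDifferential hx
  have h2 := h1.congr (t := t) (Filter.mem_of_superset (hW.mem_nhds hx) hst)
  rw [covD, covD, h2.differential_eq, hst x hx]

/-- The Leibniz rule. -/
theorem covD_smul {W : Set (ℍ × ℂ)} {f : ℍ × ℂ → ℂ} {s : ℍ × ℂ → P N} (hf : IsHolFun W f)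
    (hs : IsHol W s) {x : ℍ × ℂ} (hx : x ∈ W) (ξ : ℂ × ℂ) :
    covD (fun y => f y • s y) x ξ =
      fderiv ℂ (inCoord f) (coord x) ξ • s x + f x • covD s x ξ := by
  have h1 := hs.hasDifferential hx
  have h2 := HasDifferential.smul (hf x hx).differentiableAt.hasFDerivAt h1
  rw [covD_of_hasDifferential h2, covD_of_hasDifferential h1, _root_.map_smul, smul_add]
  simp
  abel

theorem IsHol.mono {W W' : Set (ℍ × ℂ)} {s : ℍ × ℂ → P N} (h : IsHol W s) (hW : W' ⊆ W) :
    IsHol W' s := fun n φ x hx => h n φ x (hW hx)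

theorem isHol_smul {W : Set (ℍ × ℂ)} {f : ℍ × ℂ → ℂ} {s : ℍ × ℂ → P N} (hf : IsHolFun W f)
    (hs : IsHol W s) : IsHol W (fun y => f y • s y) := fun n φ x hx => by
  refine ((hf x hx).mul (hs n φ x hx)).congr (Filter.Eventually.of_forall fun w => ?_)
  simp [inCoord]

variable (N) in
/-- The connection on `𝒫_N` induced by `d + Ω_N`. -/
noncomputable def kzbConnection : LogConnection N where
  nabla U :=
    { toFun := fun s => ⟨nablaVal U s.1, nablaVal_mem s⟩
      map_add' := fun s t => Subtype.ext (funext fun x => by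
        change nablaVal U (s.1 + t.1) x = nablaVal U s.1 x + nablaVal U t.1 x
        by_cases hx : x ∈ pre U \ torsionLocus N
        · rw [nablaVal_of_mem _ hx, nablaVal_of_mem _ hx, nablaVal_of_mem _ hx,
            covD_add s.2.1 t.2.1 hx.1]
        · rw [nablaVal_of_not_mem _ hx, nablaVal_of_not_mem _ hx, nablaVal_of_not_mem _ hx,
            add_zero])
      map_smul' := fun c s => Subtype.ext (funext fun x => by
        change nablaVal U (c • s.1) x = c • nablaVal U s.1 x
        by_cases hx : x ∈ pre U \ torsionLocus N
        · rw [nablaVal_of_mem _ hx, nablaVal_of_mem _ hx, covD_const_smul c s.2.1 hx.1]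
        · rw [nablaVal_of_not_mem _ hx, nablaVal_of_not_mem _ hx, smul_zero]) }
  restrict U V hVU s t hst x hx := by
    change nablaVal V t.1 x = nablaVal U s.1 x
    have hUV : pre V ⊆ pre U := fun y hy => hVU hy
    -- On Λ_N both sides are zero by convention.
    by_cases hΛ : x ∈ torsionLocus N
    · rw [nablaVal_of_not_mem _ fun h => h.2 hΛ, nablaVal_of_not_mem _ fun h => h.2 hΛ]
    · rw [nablaVal_of_mem _ ⟨hx, hΛ⟩, nablaVal_of_mem _ ⟨hUV hx, hΛ⟩]
      exact covD_congr (isOpen_pre V) (s.2.1.mono hUV) hst hx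
  leibniz U f hf s t hst x hx ξ := by
    change nablaVal U t.1 x ξ = _ + f x • nablaVal U s.1 x ξ
    rw [nablaVal_of_mem _ hx, nablaVal_of_mem _ hx, ← covD_smul hf.1 s.2.1 hx.1,
      covD_congr (isOpen_pre U) (isHol_smul hf.1 s.2.1) hst hx.1]

theorem kzbConnection_nabla {U : TopologicalSpace.Opens (E N)} (s : Sections U) {x : ℍ × ℂ}
    (hx : x ∈ pre U \ torsionLocus N) : (((kzbConnection N).nabla U) s).1 x = covD s.1 x :=
  nablaVal_of_mem s.1 hx

theorem LogConnection.ext_nabla {D D' : LogConnection N} (h : D.nabla = D'.nabla) : D = D' := by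
  cases D
  cases D'
  cases h
  rfl

/-- Logarithmic forms over U are zero by definition at all other points, so the hypothesis
determines every value. -/
theorem eq_kzbConnection {D : LogConnection N}
    (hD : ∀ (U : TopologicalSpace.Opens (E N)) (s : Sections U),
      ∀ x ∈ pre U \ torsionLocus N, (D.nabla U s).1 x = covD s.1 x) : D = kzbConnection N := by
  refine LogConnection.ext_nabla (funext fun U => LinearMap.ext fun s =>
    Subtype.ext (funext fun x => ?_))
  by_cases hx : x ∈ pre U \ torsionLocus N
  · rw [hD U s x hx, kzbConnection_nabla s hx]
  · rw [(D.nabla U s).2.2.2 x hx, ((kzbConnection N).nabla U s).2.2.2 x hx]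

end Descent

end KZB

/-! ### The proposition. -/

theorem mainTheorem6 (N : ℕ) [NeZero N] :
    -- the connection form is logarithmic, and the factors of automorphy are holomorphic
    (∀ v : KZB.P N, KZB.IsLogForm Set.univ (fun x => KZB.OmegaApply N x v)) ∧
    (∀ (g : KZB.JacobiGroup N) (v : KZB.P N),
      KZB.IsHol Set.univ (fun x => KZB.automorphy g x v)) ∧
    -- `∇(g s) = g(∇ s)` for all `g` and all holomorphic sections `s` over open sets
    (∀ (g : KZB.JacobiGroup N) (W : Set (ℍ × ℂ)) (s : ℍ × ℂ → KZB.P N), IsOpen W → KZB.IsHol W s →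
      KZB.IsHol {y | g⁻¹ • y ∈ W} (KZB.pushSection g s) ∧
      ∀ x ∈ W \ KZB.torsionLocus N, ∀ ξ : ℂ × ℂ,
        KZB.covD (KZB.pushSection g s) (g • x) (KZB.dAct g x ξ) =
          KZB.automorphy g x (KZB.covD s x ξ)) ∧
    -- `g^* Ω = M_g Ω M_g⁻¹ - (d M_g) M_g⁻¹`
    (∀ (g : KZB.JacobiGroup N) (x : ℍ × ℂ), x ∉ KZB.torsionLocus N → ∀ (ξ : ℂ × ℂ) (v : KZB.P N),
      KZB.Omega N (g • x) (KZB.dAct g x ξ) v =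
        KZB.automorphy g x (KZB.Omega N x ξ ((KZB.automorphy g x).symm v)) -
          KZB.differential (fun y => KZB.automorphy g y ((KZB.automorphy g x).symm v)) x ξ) ∧
    -- descent to `𝒫_N → ℰ_N`
    ∃! D : KZB.LogConnection N, ∀ (U : TopologicalSpace.Opens (KZB.E N)) (s : KZB.Sections U),
      ∀ x ∈ KZB.pre U \ KZB.torsionLocus N, (D.nabla U s).1 x = KZB.covD s.1 x := by
  refine ⟨KZB.isLogForm_OmegaApply, KZB.isHol_automorphy, fun g W s hW hs =>
    ⟨KZB.isHol_pushSection g hW hs, fun x hx ξ => KZB.covD_pushSection g hW hs hx.1 hx.2 ξ⟩,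
    fun g x hx ξ v => ?_, KZB.kzbConnection N, fun U s x hx => KZB.kzbConnection_nabla s hx,
    fun D hD => KZB.eq_kzbConnection hD⟩
  -- The gauge law is applied to M_g(x)⁻¹v. With this vector held fixed, the differential of y ↦
  -- M_g(y)M_g(x)⁻¹v at x is (dM_g)M_g⁻¹v.
  have h := KZB.Omega_smul_dAct g hx ξ ((KZB.automorphy g x).symm v)
  rw [LieEquiv.apply_symm_apply] at h
  rw [h, (KZB.hasDifferential_automorphy g x _).differential_eq]
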